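/- Let $n\ge 1$ be an integer and let $f:[0,\infty)\to\mathbb{R}$ be continuous with $f(s)>0$ for all $s>0$. Assume that $$n=1\quad\text{or}\quad s\mapsto f(s)/s^p \text{ is nonincreasing on } (0,\infty) \text{ for some } p\in(1,p_B),\qquad p_B:=\frac{n(n+2)}{(n-1)^2}.$$ Assume in addition that at least one of the following holds: (a) $f$ has regular variation at $0$ and at $\infty$ with indices greater than $1$; that is, there are $m_0,m_1>1$ such that, with $L_i(s)=s^{-m_i}f(s)$, one has for every $s>0$ $$\lim_{\lambda\to0^+}\frac{L_0(\lambda s)}{L_0(\lambda)}=1\quad\text{and}\quad \lim_{\lambda\to\infty}\frac{L_1(\lambda s)}{L_1(\lambda)}=1;$$ (b) there are $q>1$ and $\sigma>0$ such that $f$ is nondecreasing on some neighborhood of $\infty$, $f(s)\ge s^q$ for all sufficiently large $s$, and $s\mapsto f(s)/s^\sigma$ is nondecreasing on $(0,\delta)$ for some $\delta>0$. Then the equation $$u_t-\Delta u=f(u),\qquad x\in\mathbb{R}^n,\ t\in\mathbb{R},$$ has no nontrivial strong solution. Here a strong solution is a function $u\ge 0$ (a.e.) on $\mathbb{R}^n\times\mathbb{R}$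 which belongs to $W^{2,1;r}_{loc}(\mathbb{R}^n\times\mathbb{R})$ for every finite $r\ge1$ (that is, $u$ and its weak derivatives $\partial_t u$, $\partial_{x_i}u$, $\partial_{x_i}\partial_{x_j}u$ lie in $L^r_{loc}(\mathbb{R}^n\times\mathbb{R})$) and satisfies the equation almost everywhere; it is nontrivial if it is not equal to $0$ almost everywhere. -/

import Mathlib

open MeasureTheory Filter Topology Set
open scoped ENNReal ContDiff

noncomputable section

/-- Space-time `ℝⁿ × ℝ`, with points `(x, t)` and Lebesgue measure `volume`. -/
abbrev SpaceTime (n : ℕ) : Type := EuclideanSpace ℝ (Fin n) × ℝ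

/-- The `i`-th spatial unit vector of `ℝⁿ × ℝ`. -/
def spaceDir {n : ℕ} (i : Fin n) : SpaceTime n := (EuclideanSpace.single i 1, 0)

/-- The unit vector of `ℝⁿ × ℝ` in the time direction. -/
def timeDir (n : ℕ) : SpaceTime n := (0, 1)

/-- `w` is the weak (distributional) derivative of `u` on all of `ℝⁿ × ℝ` in the direction `e`;
both are locally integrable and the test functions are those of class `C_c^∞`. -/
def HasWeakDirDeriv {n : ℕ} (u w : SpaceTime n → ℝ) (e : SpaceTime n) : Prop :=
  LocallyIntegrable u volume ∧ LocallyIntegrable w volume ∧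
    ∀ φ : SpaceTime n → ℝ, ContDiff ℝ ∞ φ → HasCompactSupport φ →
      ∫ z, u z * fderiv ℝ φ z e = -∫ z, w z * φ z

/-- `u ∈ L^r_loc(ℝⁿ × ℝ)`. -/
def MemLrLoc {n : ℕ} (r : ℝ≥0∞) (u : SpaceTime n → ℝ) : Prop :=
  ∀ K : Set (SpaceTime n), IsCompact K → MemLp u r (volume.restrict K)

/-- `u ∈ W^{2,1;r}_loc(ℝⁿ × ℝ)` with weak derivatives `ut = ∂ₜu`, `Du i = ∂ᵢu`,
`D2u i j = ∂ⱼ∂ᵢu`: all of them, and `u`, lie in `L^r_loc`. -/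
structure HasW21Loc {n : ℕ} (r : ℝ≥0∞) (u ut : SpaceTime n → ℝ)
    (Du : Fin n → SpaceTime n → ℝ) (D2u : Fin n → Fin n → SpaceTime n → ℝ) : Prop where
  time_deriv : HasWeakDirDeriv u ut (timeDir n)
  space_deriv : ∀ i, HasWeakDirDeriv u (Du i) (spaceDir i)
  space_deriv₂ : ∀ i j, HasWeakDirDeriv (Du i) (D2u i j) (spaceDir j)
  mem : MemLrLoc r u
  mem_time : MemLrLoc r ut
  mem_space : ∀ i, MemLrLoc r (Du i)
  mem_space₂ : ∀ i j, MemLrLoc r (D2u i j)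

/-- `u` is a (nonnegative) strong solution of `u_t - Δu = f(u)` in `ℝⁿ × ℝ`:
`u ∈ W^{2,1;r}_loc` for every finite `r`, and the equation holds almost everywhere.
Only the values of `f` on `[0, ∞)` matter. (The weak derivatives are unique up to null sets,
so they can be chosen independently of `r`.) -/
def IsStrongSolution {n : ℕ} (f : ℝ → ℝ) (u : SpaceTime n → ℝ) : Prop :=
  (∀ᵐ z, 0 ≤ u z) ∧
    ∃ (ut : SpaceTime n → ℝ) (Du : Fin n → SpaceTime n → ℝ)
      (D2u : Fin n → Fin n → SpaceTime n → ℝ),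
      (∀ r : ℝ≥0∞, 1 ≤ r → r ≠ ⊤ → HasW21Loc r u ut Du D2u) ∧
        ∀ᵐ z, ut z - ∑ i, D2u i i z = f (u z)

/-- `f` has regular variation with index `m` along the filter `l`: the function
`L(s) = s^{-m} f(s)` satisfies `L(λ s) / L(λ) → 1` as `λ → l`, for each `s > 0`. -/
def RegularVariation (f : ℝ → ℝ) (m : ℝ) (l : Filter ℝ) : Prop :=
  ∀ s : ℝ, 0 < s →
    Tendsto (fun c : ℝ => ((c * s) ^ (-m) * f (c * s)) / (c ^ (-m) * f c)) l (𝓝 1)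

/-- Regular variation at `∞` with index `m`. -/
def RegularVariationAtInfty (f : ℝ → ℝ) (m : ℝ) : Prop := RegularVariation f m atTop

/-- Regular variation at `0` with index `m`. -/
def RegularVariationAtZero (f : ℝ → ℝ) (m : ℝ) : Prop := RegularVariation f m (𝓝[>] 0)

/-- The exponent `p_B = n(n+2)/(n-1)²`, meaningful for `n ≥ 2`. -/
def pB (n : ℕ) : ℝ := (n : ℝ) * ((n : ℝ) + 2) / ((n : ℝ) - 1) ^ 2

end

/-!
A nonnegative solution on the whole of space-time has finite energy
`∫ ((∂ₜu)² + |∇u|⁴ / u²)` with a bound tending to `0` on larger and larger parabolic cylinders, so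
that it is constant; then `f(u) = 0` and `u = 0`.

The bound comes from integral identities tested with a cut-off `φ`. Bochner's identity and
the identity for `∇·(φ |∇v|² ∇v / v)`, combined with the Cauchy–Schwarz inequality between the trace
and the Frobenius norm of the matrix `∂ᵢⱼv - a ∂ᵢv ∂ⱼv / v` (`trace_sq_le_hessSq`), bound
`∫ φ |∇v|⁴ / v²` by `∫ φ (∂ₜv)²` and by cut-off terms. They leave a term `∫ φ f(v) |∇v|² / v`, whose
sign is right for a suitable `a` because `f(s) / s ^ p` is nonincreasing with `p < pB n`
(`nonposOn_subhomogeneous`, `exists_trace_coefficient`); for `n = 1` its bad part is absent.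
Multiplication of the equation by `φ ∂ₜv` bounds `∫ φ (∂ₜv)²`, where the potential
`∫₀ᵘ f` is at most a constant times `u f(u)` because `f` is almost increasing, and multiplication by
`v` bounds the integral of `v f(v)`. The result is `energy_estimate`. Its remainder
`R⁻⁴ ∫ v²` is absorbed by `R⁻² ∫ v f(v)` by means of Young's inequality: superlinearity gives a
negative power of `R` which beats the volume `R ^ (n + 2)` of the cylinder
(`exists_growth_absorption`, `exists_energy_decay`).

Rather than the solution itself, which is neither smooth nor positive and for which `f` is only
continuous, these estimates concern arbitrary smooth positive functions `v`, with the defect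
`∂ₜv - Δv - f(v)` as an extra error term. A strong solution has a continuous representative, by
a Morrey-type argument (`exists_continuous_representative`), so that its mollifications, shifted by
small positive constants, have locally uniformly small defect (`IsDistribSolution.exists_approx`).
Letting the approximation improve on a cylinder which is large but fixed, one finds that all
distributional first derivatives of `u` vanish (`IsDistribSolution.integral_mul_dirD_eq_zero`).

The growth properties of `f` under the hypothesis of regular variation are Potter's bounds, which
follow from a Baire category argument in logarithmic coordinates (`exists_increment_bound`).
-/

/-! ### Directional derivatives and integration by parts -/

/-- The directional derivative of `w` in the direction `e`, as a function on space-time. -/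
noncomputable def dirD {n : ℕ} (e : SpaceTime n) (w : SpaceTime n → ℝ) : SpaceTime n → ℝ :=
  fun z => fderiv ℝ w z e

section DirectionalDerivative

variable {n : ℕ} {e e' : SpaceTime n} {w g : SpaceTime n → ℝ} {K : Set (SpaceTime n)}

theorem ContDiff.dirD (hw : ContDiff ℝ ∞ w) (e : SpaceTime n) : ContDiff ℝ ∞ (dirD e w) :=
  (hw.fderiv_right (m := ∞) (by simp)).clm_apply contDiff_const

theorem dirD_eq {w' : SpaceTime n →L[ℝ] ℝ} {z : SpaceTime n} (h : HasFDerivAt w w' z) :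
    dirD e w z = w' e := by
  rw [dirD, h.fderiv]

theorem dirD_mul {z : SpaceTime n} (hw : DifferentiableAt ℝ w z) (hg : DifferentiableAt ℝ g z) :
    dirD e (fun z => w z * g z) z = dirD e w z * g z + w z * dirD e g z := by
  have h := dirD_eq (e := e) (hw.hasFDerivAt.fun_mul hg.hasFDerivAt)
  rw [h]
  simp [dirD]
  ring

theorem dirD_add {z : SpaceTime n} (hw : DifferentiableAt ℝ w z) (hg : DifferentiableAt ℝ g z) :
    dirD e (fun z => w z + g z) z = dirD e w z + dirD e g z := by
  rw [dirD_eq (hw.hasFDerivAt.fun_add hg.hasFDerivAt)]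
  simp [dirD]

theorem dirD_comp {z : SpaceTime n} {F : ℝ → ℝ} {F' : ℝ} (hF : HasDerivAt F F' (w z))
    (hw : DifferentiableAt ℝ w z) :
    dirD e (fun z => F (w z)) z = F' * dirD e w z := by
  have h : HasFDerivAt (fun z => F (w z)) (F' • fderiv ℝ w z) z :=
    hF.comp_hasFDerivAt z hw.hasFDerivAt
  rw [dirD_eq h]
  simp [dirD]

theorem dirD_comm (hw : ContDiff ℝ ∞ w) (z : SpaceTime n) :
    dirD e (dirD e' w) z = dirD e' (dirD e w) z := by
  have hs : IsSymmSndFDerivAt ℝ w z :=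
    (hw.contDiffAt).isSymmSndFDerivAt (by simp; exact WithTop.coe_le_coe.2 le_top)
  have hd : DifferentiableAt ℝ (fderiv ℝ w) z :=
    ((hw.fderiv_right (m := ∞) (by simp)).differentiable (by simp)) z
  have key : ∀ a b : SpaceTime n, dirD a (dirD b w) z = fderiv ℝ (fderiv ℝ w) z a b := by
    intro a b
    have h : HasFDerivAt (dirD b w) _ z := hd.hasFDerivAt.clm_apply (hasFDerivAt_const b z)
    rw [dirD_eq h]
    simp
  rw [key, key]
  exact hs.eq e e'

/-- Vanishing off a closed set passes to directional derivatives. -/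
theorem dirD_eq_zero_off (hK : IsClosed K) (h : ∀ z ∉ K, w z = 0) :
    ∀ z ∉ K, dirD e w z = 0 := by
  intro z hz
  have : w =ᶠ[𝓝 z] fun _ => 0 := by
    filter_upwards [hK.isOpen_compl.mem_nhds hz] with y hy using h y hy
  rw [dirD, this.fderiv_eq]
  simp

instance (n : ℕ) : (volume : Measure (SpaceTime n)).IsAddHaarMeasure :=
  inferInstanceAs (((volume : Measure (EuclideanSpace ℝ (Fin n))).prod
    (volume : Measure ℝ)).IsAddHaarMeasure)

theorem integrable_of_zero_off (hK : IsCompact K) (hg : Continuous g) (h : ∀ z ∉ K, g z = 0) :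
    Integrable g :=
  hg.integrable_of_hasCompactSupport (HasCompactSupport.intro hK h)

/-- The divergence theorem for a compactly supported field pointing in a fixed direction. -/
theorem integral_dirD_eq_zero (hK : IsCompact K) (hg : Differentiable ℝ g)
    (hg' : Continuous (dirD e g)) (h : ∀ z ∉ K, g z = 0) :
    ∫ z, dirD e g z = 0 := by
  have h1 := integral_mul_fderiv_eq_neg_fderiv_mul_of_integrable
    (μ := (volume : Measure (SpaceTime n))) (f := fun _ => (1 : ℝ)) (g := g) (v := e)
    (by simp) ?_ ?_ (fun _ _ => differentiableAt_const _) (fun z _ => hg z)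
  · simpa [dirD] using h1
  · simp only [one_mul]
    exact integrable_of_zero_off hK hg' (dirD_eq_zero_off hK.isClosed h)
  · simp only [one_mul]
    exact integrable_of_zero_off hK hg.continuous h

/-- A continuous function vanishing off `K` whose integral is nonpositive. Integral identities and
inequalities are carried around in this form so that they can be combined pointwise. -/
structure NonposOn (K : Set (SpaceTime n)) (h : SpaceTime n → ℝ) : Prop where
  cont : Continuous h
  zero_off : ∀ z ∉ K, h z = 0
  integral_le : ∫ z, h z ≤ 0

/-- A continuous function vanishing off `K` whose integral is zero. -/
structure NullOn (K : Set (SpaceTime n)) (h : SpaceTime n → ℝ) : Prop where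
  cont : Continuous h
  zero_off : ∀ z ∉ K, h z = 0
  integral_eq : ∫ z, h z = 0

variable {h h' : SpaceTime n → ℝ}

theorem NullOn.nonposOn (hh : NullOn K h) : NonposOn K h :=
  ⟨hh.cont, hh.zero_off, hh.integral_eq.le⟩

theorem NullOn.const_mul (hh : NullOn K h) (c : ℝ) : NullOn K (fun z => c * h z) :=
  ⟨hh.cont.const_mul c, fun z hz => by simp [hh.zero_off z hz], by
    rw [integral_const_mul, hh.integral_eq, mul_zero]⟩

theorem NullOn.add (hK : IsCompact K) (hh : NullOn K h) (hh' : NullOn K h') :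
    NullOn K (fun z => h z + h' z) :=
  ⟨hh.cont.add hh'.cont, fun z hz => by simp [hh.zero_off z hz, hh'.zero_off z hz], by
    rw [integral_add (integrable_of_zero_off hK hh.cont hh.zero_off)
      (integrable_of_zero_off hK hh'.cont hh'.zero_off), hh.integral_eq, hh'.integral_eq, add_zero]⟩

theorem NullOn.sum {ι : Type*} {s : Finset ι} {k : ι → SpaceTime n → ℝ} (hK : IsCompact K)
    (hk : ∀ i ∈ s, NullOn K (k i)) : NullOn K (fun z => ∑ i ∈ s, k i z) := by
  refine ⟨continuous_finsetSum _ fun i hi => (hk i hi).cont,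
    fun z hz => Finset.sum_eq_zero fun i hi => (hk i hi).zero_off z hz, ?_⟩
  rw [integral_finsetSum _ fun i hi =>
    integrable_of_zero_off hK (hk i hi).cont (hk i hi).zero_off]
  exact Finset.sum_eq_zero fun i hi => (hk i hi).integral_eq

theorem NonposOn.add (hK : IsCompact K) (hh : NonposOn K h) (hh' : NonposOn K h') :
    NonposOn K (fun z => h z + h' z) :=
  ⟨hh.cont.add hh'.cont, fun z hz => by simp [hh.zero_off z hz, hh'.zero_off z hz], by
    rw [integral_add (integrable_of_zero_off hK hh.cont hh.zero_off)
      (integrable_of_zero_off hK hh'.cont hh'.zero_off)]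
    linarith [hh.integral_le, hh'.integral_le]⟩

theorem NullOn.congr (hh : NullOn K h) (he : ∀ z, h' z = h z) : NullOn K h' := by
  rwa [show h' = h from funext he]

/-- The divergence of a field in a fixed direction, in computed form, integrates to zero. -/
theorem nullOn_of_dirD (hK : IsCompact K) (hg : Differentiable ℝ g)
    (hg' : ∀ z, dirD e g z = h z) (hc : Continuous h) (h0 : ∀ z ∉ K, g z = 0) : NullOn K h := by
  obtain rfl : dirD e g = h := funext hg'
  exact ⟨hc, dirD_eq_zero_off hK.isClosed h0, integral_dirD_eq_zero hK hg hc h0⟩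

/-- If `A ≤ B + h` pointwise and `∫ h ≤ 0`, then `∫ A ≤ ∫ B`. -/
theorem NonposOn.integral_le_integral {A B : SpaceTime n → ℝ} (hK : IsCompact K)
    (hh : NonposOn K h) (hA : Continuous A) (hA0 : ∀ z ∉ K, A z = 0) (hB : Continuous B)
    (hB0 : ∀ z ∉ K, B z = 0) (hle : ∀ z, A z ≤ B z + h z) : ∫ z, A z ≤ ∫ z, B z := by
  have iA := integrable_of_zero_off hK hA hA0
  have iB := integrable_of_zero_off hK hB hB0
  have ih := integrable_of_zero_off hK hh.cont hh.zero_off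
  have h1 : ∫ z, A z ≤ ∫ z, (B z + h z) := integral_mono iA (iB.add ih) hle
  rw [integral_add iB ih] at h1
  linarith [hh.integral_le]

end DirectionalDerivative

/-! ### Integral identities for smooth positive functions -/

section Identities

variable {n : ℕ} {K : Set (SpaceTime n)} {φ v : SpaceTime n → ℝ}

/-- The spatial partial derivative `∂ᵢ v`. -/
noncomputable abbrev dX (i : Fin n) (v : SpaceTime n → ℝ) : SpaceTime n → ℝ := dirD (spaceDir i) v

/-- The time derivative `∂ₜ v`. -/
noncomputable abbrev dT (v : SpaceTime n → ℝ) : SpaceTime n → ℝ := dirD (timeDir n) v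

/-- The spatial Laplacian. -/
noncomputable def lap (v : SpaceTime n → ℝ) (z : SpaceTime n) : ℝ := ∑ i, dX i (dX i v) z

/-- The product `∇φ · ∇v` of spatial gradients. -/
noncomputable def gradDot (φ v : SpaceTime n → ℝ) (z : SpaceTime n) : ℝ := ∑ i, dX i φ z * dX i v z

/-- The squared length `|∇v|²` of the spatial gradient. -/
noncomputable def gradSq (v : SpaceTime n → ℝ) (z : SpaceTime n) : ℝ := ∑ i, dX i v z ^ 2

/-- The squared Frobenius norm `|D²v|²` of the spatial Hessian. -/
noncomputable def hessSq (v : SpaceTime n → ℝ) (z : SpaceTime n) : ℝ :=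
  ∑ i, ∑ j, dX j (dX i v) z ^ 2

/-- The value `D²v(∇v, ∇v)` of the spatial Hessian on the gradient. -/
noncomputable def hessGrad (v : SpaceTime n → ℝ) (z : SpaceTime n) : ℝ :=
  ∑ i, ∑ j, dX i v z * dX j v z * dX i (dX j v) z

theorem continuous_lap (hv : ContDiff ℝ ∞ v) : Continuous (lap v) :=
  continuous_finsetSum _ fun _ _ => ((hv.dirD _).dirD _).continuous

theorem continuous_gradDot (hφ : ContDiff ℝ ∞ φ) (hv : ContDiff ℝ ∞ v) :
    Continuous (gradDot φ v) :=
  continuous_finsetSum _ fun _ _ => ((hφ.dirD _).continuous.mul (hv.dirD _).continuous)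

theorem continuous_gradSq (hv : ContDiff ℝ ∞ v) : Continuous (gradSq v) :=
  continuous_finsetSum _ fun _ _ => (hv.dirD _).continuous.pow 2

theorem gradSq_nonneg (v : SpaceTime n → ℝ) (z : SpaceTime n) : 0 ≤ gradSq v z :=
  Finset.sum_nonneg fun _ _ => sq_nonneg _

theorem gradDot_eq_zero_off (hK : IsClosed K) (h : ∀ z ∉ K, φ z = 0) :
    ∀ z ∉ K, gradDot φ v z = 0 := fun z hz =>
  Finset.sum_eq_zero fun i _ => by
    simp only [dX, dirD_eq_zero_off (e := spaceDir i) hK h z hz, zero_mul]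

theorem lap_eq_zero_off (hK : IsClosed K) (h : ∀ z ∉ K, φ z = 0) :
    ∀ z ∉ K, lap φ z = 0 := fun z hz =>
  Finset.sum_eq_zero fun i _ =>
    dirD_eq_zero_off (e := spaceDir i) hK (dirD_eq_zero_off hK h) z hz

theorem gradDot_sq_le (φ v : SpaceTime n → ℝ) (z : SpaceTime n) :
    gradDot φ v z ^ 2 ≤ gradSq φ z * gradSq v z :=
  Finset.sum_mul_sq_le_sq_mul_sq _ _ _

theorem ContDiff.smooth_differentiable (hv : ContDiff ℝ ∞ v) : Differentiable ℝ v :=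
  hv.differentiable (by simp)

/-- `∫ φ ∂ₜv Δv = ½ ∫ ∂ₜφ |∇v|² - ∫ ∂ₜv ∇φ·∇v`. -/
theorem nullOn_time_laplacian (hK : IsCompact K) (hφ : ContDiff ℝ ∞ φ) (h0 : ∀ z ∉ K, φ z = 0)
    (hv : ContDiff ℝ ∞ v) :
    NullOn K (fun z => φ z * dT v z * lap v z + dT v z * gradDot φ v z
      - 1 / 2 * dT φ z * gradSq v z) := by
  have key : ∀ i : Fin n, NullOn K (fun z => φ z * dT v z * dX i (dX i v) z
      + dT v z * (dX i φ z * dX i v z) - 1 / 2 * dT φ z * dX i v z ^ 2) := by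
    intro i
    have dφ := hφ.smooth_differentiable
    have dt := (hv.dirD (timeDir n)).smooth_differentiable
    have dx := (hv.dirD (spaceDir i)).smooth_differentiable
    have cφ := hφ.continuous
    have cφt := (hφ.dirD (timeDir n)).continuous
    have cφx := (hφ.dirD (spaceDir i)).continuous
    have ct := (hv.dirD (timeDir n)).continuous
    have cx := (hv.dirD (spaceDir i)).continuous
    have ctx := ((hv.dirD (timeDir n)).dirD (spaceDir i)).continuous
    have cxx := ((hv.dirD (spaceDir i)).dirD (spaceDir i)).continuous
    have A : NullOn K (fun z => (dX i φ z * dT v z + φ z * dX i (dT v) z) * dX i v z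
        + φ z * dT v z * dX i (dX i v) z) := by
      refine nullOn_of_dirD (g := fun z => φ z * dT v z * dX i v z) (e := spaceDir i) hK
        ((dφ.fun_mul dt).fun_mul dx) (fun z => ?_) (by fun_prop) (fun z hz => by simp [h0 z hz])
      rw [dirD_mul ((dφ.fun_mul dt) z) (dx z), dirD_mul (dφ z) (dt z)]
    have B : NullOn K (fun z => (dT φ z * dX i v z + φ z * dX i (dT v) z) * dX i v z
        + φ z * dX i v z * dX i (dT v) z) := by
      refine nullOn_of_dirD (g := fun z => φ z * dX i v z * dX i v z) (e := timeDir n) hK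
        ((dφ.fun_mul dx).fun_mul dx) (fun z => ?_) (by fun_prop) (fun z hz => by simp [h0 z hz])
      rw [dirD_mul ((dφ.fun_mul dx) z) (dx z), dirD_mul (dφ z) (dx z), dirD_comm hv]
    exact (A.add hK (B.const_mul (-1 / 2))).congr fun z => by ring
  refine (NullOn.sum (s := Finset.univ) hK fun i _ => key i).congr fun z => ?_
  simp only [Finset.sum_sub_distrib, Finset.sum_add_distrib, ← Finset.mul_sum, lap, gradDot, gradSq]

/-- `∫ φ ∂ₜv f(v) = - ∫ ∂ₜφ F(v)` when `F' = f`. -/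
theorem nullOn_time_potential (hK : IsCompact K) (hφ : ContDiff ℝ ∞ φ) (h0 : ∀ z ∉ K, φ z = 0)
    (hv : ContDiff ℝ ∞ v) {f F : ℝ → ℝ} (hf : Continuous f) (hF : ∀ s, HasDerivAt F (f s) s) :
    NullOn K (fun z => φ z * dT v z * f (v z) + dT φ z * F (v z)) := by
  have dF : Differentiable ℝ F := fun s => (hF s).differentiableAt
  have dv := hv.smooth_differentiable
  have cφ := hφ.continuous
  have cφt := (hφ.dirD (timeDir n)).continuous
  have ct := (hv.dirD (timeDir n)).continuous
  have cF := dF.continuous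
  have dFv : Differentiable ℝ (fun z => F (v z)) := dF.comp dv
  refine nullOn_of_dirD (g := fun z => φ z * F (v z)) (e := timeDir n) hK
    (hφ.smooth_differentiable.fun_mul dFv) (fun z => ?_) (by fun_prop)
    (fun z hz => by simp [h0 z hz])
  rw [dirD_mul (hφ.smooth_differentiable z) (dFv z), dirD_comp (hF _) (dv z)]
  ring

/-- The integrated Bochner formula
`∫ φ |D²v|² = ∫ φ (Δv)² + ½ ∫ Δφ |∇v|² + ∫ Δv ∇φ·∇v`. -/
theorem nullOn_bochner (hK : IsCompact K) (hφ : ContDiff ℝ ∞ φ) (h0 : ∀ z ∉ K, φ z = 0)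
    (hv : ContDiff ℝ ∞ v) :
    NullOn K (fun z => φ z * hessSq v z - φ z * lap v z ^ 2 - 1 / 2 * lap φ z * gradSq v z
      - lap v z * gradDot φ v z) := by
  have key : ∀ i j : Fin n, NullOn K (fun z => φ z * dX j (dX i v) z ^ 2
      - φ z * (dX i (dX i v) z * dX j (dX j v) z) - 1 / 2 * (dX j (dX j φ) z * dX i v z ^ 2)
      - dX j (dX j v) z * (dX i φ z * dX i v z)) := by
    intro i j
    have dφ := hφ.smooth_differentiable
    have dφj := (hφ.dirD (spaceDir j)).smooth_differentiable
    have di := (hv.dirD (spaceDir i)).smooth_differentiable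
    have dij := ((hv.dirD (spaceDir i)).dirD (spaceDir j)).smooth_differentiable
    have djj := ((hv.dirD (spaceDir j)).dirD (spaceDir j)).smooth_differentiable
    have cφ := hφ.continuous
    have cφj := (hφ.dirD (spaceDir j)).continuous
    have cφi := (hφ.dirD (spaceDir i)).continuous
    have cφjj := ((hφ.dirD (spaceDir j)).dirD (spaceDir j)).continuous
    have ci := (hv.dirD (spaceDir i)).continuous
    have cij := ((hv.dirD (spaceDir i)).dirD (spaceDir j)).continuous
    have cii := ((hv.dirD (spaceDir i)).dirD (spaceDir i)).continuous
    have cjj := ((hv.dirD (spaceDir j)).dirD (spaceDir j)).continuous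
    have cijj := (((hv.dirD (spaceDir i)).dirD (spaceDir j)).dirD (spaceDir j)).continuous
    -- the two third derivatives that occur are equal
    have h3 : ∀ z, dX i (dX j (dX j v)) z = dX j (dX j (dX i v)) z := by
      intro z
      have : dX i (dX j v) = dX j (dX i v) := funext fun y => dirD_comm hv y
      rw [dX, dX, dirD_comm (hv.dirD _) z]
      exact congrArg (fun w => dX j w z) this
    have A : NullOn K (fun z => (dX j φ z * dX i v z + φ z * dX j (dX i v) z) * dX j (dX i v) z
        + φ z * dX i v z * dX j (dX j (dX i v)) z) := by
      refine nullOn_of_dirD (g := fun z => φ z * dX i v z * dX j (dX i v) z) (e := spaceDir j) hK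
        ((dφ.fun_mul di).fun_mul dij) (fun z => ?_) (by fun_prop) (fun z hz => by simp [h0 z hz])
      rw [dirD_mul ((dφ.fun_mul di) z) (dij z), dirD_mul (dφ z) (di z)]
    have B : NullOn K (fun z => (dX i φ z * dX i v z + φ z * dX i (dX i v) z) * dX j (dX j v) z
        + φ z * dX i v z * dX j (dX j (dX i v)) z) := by
      refine nullOn_of_dirD (g := fun z => φ z * dX i v z * dX j (dX j v) z) (e := spaceDir i) hK
        ((dφ.fun_mul di).fun_mul djj) (fun z => ?_) (by fun_prop) (fun z hz => by simp [h0 z hz])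
      rw [dirD_mul ((dφ.fun_mul di) z) (djj z), dirD_mul (dφ z) (di z), ← h3]
    have C : NullOn K (fun z => (dX j (dX j φ) z * dX i v z + dX j φ z * dX j (dX i v) z) * dX i v z
        + dX j φ z * dX i v z * dX j (dX i v) z) := by
      refine nullOn_of_dirD (g := fun z => dX j φ z * dX i v z * dX i v z) (e := spaceDir j) hK
        ((dφj.fun_mul di).fun_mul di) (fun z => ?_) (by fun_prop)
        (fun z hz => by simp [dX, dirD_eq_zero_off (e := spaceDir j) hK.isClosed h0 z hz])
      rw [dirD_mul ((dφj.fun_mul di) z) (di z), dirD_mul (dφj z) (di z)]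
    exact ((A.add hK (B.const_mul (-1))).add hK (C.const_mul (-1 / 2))).congr fun z => by ring
  refine (NullOn.sum (s := Finset.univ) hK fun i _ =>
    NullOn.sum (s := Finset.univ) hK fun j _ => key i j).congr fun z => ?_
  simp only [Finset.sum_sub_distrib, ← Finset.mul_sum, ← Finset.sum_mul, lap, gradDot, gradSq,
    hessSq, sq (∑ i, _)]
  ring

/-- `∫ φ v⁻¹ D²v(∇v,∇v) = -½ ∫ φ v⁻¹ |∇v|² Δv + ½ ∫ φ v⁻² |∇v|⁴ - ½ ∫ v⁻¹ |∇v|² ∇φ·∇v`. -/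
theorem nullOn_hessGrad (hK : IsCompact K) (hφ : ContDiff ℝ ∞ φ) (h0 : ∀ z ∉ K, φ z = 0)
    (hv : ContDiff ℝ ∞ v) (hpos : ∀ z, 0 < v z) :
    NullOn K (fun z => φ z * (hessGrad v z / v z) + 1 / 2 * (φ z * (gradSq v z * lap v z / v z))
      - 1 / 2 * (φ z * (gradSq v z ^ 2 / v z ^ 2)) + 1 / 2 * (gradSq v z * gradDot φ v z / v z)) := by
  have key : ∀ i j : Fin n, NullOn K (fun z =>
      φ z * (dX i v z * dX j v z * dX i (dX j v) z / v z)
      + 1 / 2 * (φ z * (dX j v z ^ 2 * dX i (dX i v) z / v z))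
      - 1 / 2 * (φ z * (dX i v z ^ 2 * dX j v z ^ 2 / v z ^ 2))
      + 1 / 2 * (dX j v z ^ 2 * (dX i φ z * dX i v z) / v z)) := by
    intro i j
    have dφ := hφ.smooth_differentiable
    have dv := hv.smooth_differentiable
    have hne : ∀ z, v z ≠ 0 := fun z => (hpos z).ne'
    have dinv : Differentiable ℝ (fun z => (v z)⁻¹) := dv.fun_inv hne
    have di := (hv.dirD (spaceDir i)).smooth_differentiable
    have dj := (hv.dirD (spaceDir j)).smooth_differentiable
    have cφ := hφ.continuous
    have cv := hv.continuous
    have cφi := (hφ.dirD (spaceDir i)).continuous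
    have ci := (hv.dirD (spaceDir i)).continuous
    have cj := (hv.dirD (spaceDir j)).continuous
    have cij := ((hv.dirD (spaceDir j)).dirD (spaceDir i)).continuous
    have cii := ((hv.dirD (spaceDir i)).dirD (spaceDir i)).continuous
    have A : NullOn K (fun z => ((dX i φ z * (v z)⁻¹ + φ z * (-(v z ^ 2)⁻¹ * dX i v z)) * dX i v z
          + φ z * (v z)⁻¹ * dX i (dX i v) z) * (dX j v z * dX j v z)
        + φ z * (v z)⁻¹ * dX i v z * (dX i (dX j v) z * dX j v z + dX j v z * dX i (dX j v) z)) := by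
      refine nullOn_of_dirD (g := fun z => φ z * (v z)⁻¹ * dX i v z * (dX j v z * dX j v z))
        (e := spaceDir i) hK (((dφ.fun_mul dinv).fun_mul di).fun_mul (dj.fun_mul dj)) (fun z => ?_)
        (by fun_prop (disch := intro z; first | exact hne z | exact pow_ne_zero 2 (hne z)))
        (fun z hz => by simp [h0 z hz])
      rw [dirD_mul (((dφ.fun_mul dinv).fun_mul di) z) ((dj.fun_mul dj) z), dirD_mul ((dφ.fun_mul dinv) z) (di z),
        dirD_mul (dφ z) (dinv z), dirD_mul (dj z) (dj z),
        dirD_comp (F := fun s => s⁻¹) (hasDerivAt_inv (hne z)) (dv z)]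
    refine (A.const_mul (1 / 2)).congr fun z => ?_
    have := hne z
    field_simp
    ring
  refine (NullOn.sum (s := Finset.univ) hK fun i _ =>
    NullOn.sum (s := Finset.univ) hK fun j _ => key i j).congr fun z => ?_
  simp only [Finset.sum_sub_distrib, Finset.sum_add_distrib, ← Finset.mul_sum, ← Finset.sum_mul,
    ← Finset.sum_div, lap, gradDot, gradSq, hessGrad, sq (∑ i, _)]

/-- `∫ φ v Δv = - ∫ φ |∇v|² - ∫ v ∇φ·∇v`. -/
theorem nullOn_self_laplacian (hK : IsCompact K) (hφ : ContDiff ℝ ∞ φ) (h0 : ∀ z ∉ K, φ z = 0)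
    (hv : ContDiff ℝ ∞ v) :
    NullOn K (fun z => φ z * v z * lap v z + φ z * gradSq v z + v z * gradDot φ v z) := by
  have key : ∀ i : Fin n, NullOn K (fun z => φ z * v z * dX i (dX i v) z
      + φ z * dX i v z ^ 2 + v z * (dX i φ z * dX i v z)) := by
    intro i
    have dφ := hφ.smooth_differentiable
    have dv := hv.smooth_differentiable
    have dx := (hv.dirD (spaceDir i)).smooth_differentiable
    have cφ := hφ.continuous
    have cv := hv.continuous
    have cφx := (hφ.dirD (spaceDir i)).continuous
    have cx := (hv.dirD (spaceDir i)).continuous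
    have cxx := ((hv.dirD (spaceDir i)).dirD (spaceDir i)).continuous
    refine nullOn_of_dirD (g := fun z => φ z * v z * dX i v z) (e := spaceDir i) hK
      ((dφ.fun_mul dv).fun_mul dx) (fun z => ?_) (by fun_prop) (fun z hz => by simp [h0 z hz])
    rw [dirD_mul ((dφ.fun_mul dv) z) (dx z), dirD_mul (dφ z) (dv z)]
    ring
  refine (NullOn.sum (s := Finset.univ) hK fun i _ => key i).congr fun z => ?_
  simp only [Finset.sum_add_distrib, ← Finset.mul_sum, lap, gradDot, gradSq]

/-- `∫ φ v ∂ₜv = - ½ ∫ ∂ₜφ v²`. -/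
theorem nullOn_self_time (hK : IsCompact K) (hφ : ContDiff ℝ ∞ φ) (h0 : ∀ z ∉ K, φ z = 0)
    (hv : ContDiff ℝ ∞ v) :
    NullOn K (fun z => φ z * v z * dT v z + 1 / 2 * dT φ z * v z ^ 2) := by
  have dφ := hφ.smooth_differentiable
  have dv := hv.smooth_differentiable
  have cφ := hφ.continuous
  have cv := hv.continuous
  have cφt := (hφ.dirD (timeDir n)).continuous
  have ct := (hv.dirD (timeDir n)).continuous
  have A : NullOn K (fun z => (dT φ z * v z + φ z * dT v z) * v z + φ z * v z * dT v z) := by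
    refine nullOn_of_dirD (g := fun z => φ z * v z * v z) (e := timeDir n) hK
      ((dφ.fun_mul dv).fun_mul dv) (fun z => ?_) (by fun_prop) (fun z hz => by simp [h0 z hz])
    rw [dirD_mul ((dφ.fun_mul dv) z) (dv z), dirD_mul (dφ z) (dv z)]
  exact (A.const_mul (1 / 2)).congr fun z => by ring

end Identities

/-! ### Nonlinearities with `f(s) / s ^ p` nonincreasing -/

section Subhomogeneous

variable {n : ℕ} {K : Set (SpaceTime n)} {φ v : SpaceTime n → ℝ}

/-- Integration by parts for a `C¹` nonlinearity `G` with `G' ≤ p G / s`. -/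
theorem nonposOn_subhomogeneous_of_hasDerivAt (hK : IsCompact K) (hφ : ContDiff ℝ ∞ φ)
    (hφ0 : ∀ z, 0 ≤ φ z) (h0 : ∀ z ∉ K, φ z = 0) (hv : ContDiff ℝ ∞ v) (hpos : ∀ z, 0 < v z)
    {G G' : ℝ → ℝ} {p : ℝ} (hG : ∀ s, 0 < s → HasDerivAt G (G' s) s)
    (hG' : ContinuousOn G' (Ioi 0)) (hle : ∀ s, 0 < s → G' s ≤ p * (G s / s)) :
    NonposOn K (fun z => -(φ z * (G (v z) * lap v z)) - p * (φ z * (G (v z) * gradSq v z / v z))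
      - G (v z) * gradDot φ v z) := by
  have dφ := hφ.smooth_differentiable
  have dv := hv.smooth_differentiable
  have dG : Differentiable ℝ (fun z => G (v z)) := fun z =>
    (hG _ (hpos z)).differentiableAt.comp z (dv z)
  have cφ := hφ.continuous
  have cv := hv.continuous
  have cG := dG.continuous
  have cG' : Continuous fun z => G' (v z) :=
    hG'.comp_continuous cv hpos
  have cL := continuous_lap hv
  have cN := continuous_gradSq hv
  have cd := continuous_gradDot hφ hv
  have key : ∀ i : Fin n, NullOn K (fun z => φ z * (G (v z) * dX i (dX i v) z)
      + φ z * (G' (v z) * dX i v z ^ 2) + G (v z) * (dX i φ z * dX i v z)) := by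
    intro i
    have dx := (hv.dirD (spaceDir i)).smooth_differentiable
    have cφx := (hφ.dirD (spaceDir i)).continuous
    have cx := (hv.dirD (spaceDir i)).continuous
    have cxx := ((hv.dirD (spaceDir i)).dirD (spaceDir i)).continuous
    have c : Continuous (fun z => φ z * (G (v z) * dX i (dX i v) z)
        + φ z * (G' (v z) * dX i v z ^ 2) + G (v z) * (dX i φ z * dX i v z)) :=
      ((cφ.mul (cG.mul cxx)).add (cφ.mul (cG'.mul (cx.pow 2)))).add (cG.mul (cφx.mul cx))
    refine nullOn_of_dirD (g := fun z => φ z * G (v z) * dX i v z) (e := spaceDir i) hK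
      ((dφ.fun_mul dG).fun_mul dx) (fun z => ?_) c (fun z hz => by simp [h0 z hz])
    rw [dirD_mul ((dφ.fun_mul dG) z) (dx z), dirD_mul (dφ z) (dG z), dirD_comp (hG _ (hpos z)) (dv z)]
    ring
  have hnull : NullOn K (fun z => φ z * (G (v z) * lap v z)
      + φ z * (G' (v z) * gradSq v z) + G (v z) * gradDot φ v z) := by
    refine (NullOn.sum (s := Finset.univ) hK fun i _ => key i).congr fun z => ?_
    simp only [Finset.sum_add_distrib, ← Finset.mul_sum, lap, gradDot, gradSq]
  have hd0 := gradDot_eq_zero_off (φ := φ) (v := v) hK.isClosed h0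
  have c : Continuous (fun z => -(φ z * (G (v z) * lap v z))
      - p * (φ z * (G (v z) * gradSq v z / v z)) - G (v z) * gradDot φ v z) :=
    ((cφ.mul (cG.mul cL)).neg.sub (continuous_const.mul (cφ.mul ((cG.mul cN).div cv
      fun z => (hpos z).ne')))).sub (cG.mul cd)
  refine ⟨c, fun z hz => by simp [h0 z hz, hd0 z hz], ?_⟩
  have := (hnull.const_mul (-1)).nonposOn.integral_le_integral (B := fun _ => 0) hK c
    (fun z hz => by simp [h0 z hz, hd0 z hz]) continuous_const (fun _ _ => rfl) fun z => ?_
  · simpa using this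
  · have h1 : G' (v z) * gradSq v z ≤ p * (G (v z) / v z) * gradSq v z :=
      mul_le_mul_of_nonneg_right (hle _ (hpos z)) (gradSq_nonneg v z)
    have h2 := mul_le_mul_of_nonneg_left h1 (hφ0 z)
    have h3 : p * (φ z * (G (v z) * gradSq v z / v z))
      = φ z * (p * (G (v z) / v z) * gradSq v z) := by ring
    linarith

/-- If `f(s) / s ^ p` is nonincreasing, then
`- ∫ φ f(v) Δv ≤ p ∫ φ f(v) |∇v|² / v + ∫ f(v) ∇φ·∇v`, which for smooth `f` is integration by
parts together with `f' ≤ p f / s`. Here `f` is merely continuous, and `f(s) / s ^ p` is replaced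
by its averages over `[s, s + δ]`, which are `C¹` and nonincreasing. -/
theorem nonposOn_subhomogeneous (hK : IsCompact K) (hφ : ContDiff ℝ ∞ φ)
    (hφ0 : ∀ z, 0 ≤ φ z) (h0 : ∀ z ∉ K, φ z = 0) (hv : ContDiff ℝ ∞ v) (hpos : ∀ z, 0 < v z)
    {f : ℝ → ℝ} {p : ℝ} (hf : Continuous f) (hfpos : ∀ s, 0 < s → 0 < f s)
    (hanti : AntitoneOn (fun s : ℝ => f s / s ^ p) (Ioi 0)) :
    NonposOn K (fun z => -(φ z * (f (v z) * lap v z)) - p * (φ z * (f (v z) * gradSq v z / v z))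
      - f (v z) * gradDot φ v z) := by
  set h : ℝ → ℝ := fun s => f s / s ^ p with hh
  have hc : ContinuousOn h (Ioi 0) := hf.continuousOn.div
    (fun s hs => (Real.continuousAt_rpow_const s p (Or.inl (ne_of_gt hs))).continuousWithinAt)
    (fun s hs => (Real.rpow_pos_of_pos hs p).ne')
  have hhpos : ∀ s, 0 < s → 0 < h s := fun s hs => div_pos (hfpos s hs) (Real.rpow_pos_of_pos hs p)
  have hint : ∀ a b : ℝ, 0 < a → 0 < b → IntervalIntegrable h volume a b := fun a b ha hb =>
    (hc.mono fun x hx => lt_of_lt_of_le (lt_min ha hb) hx.1).intervalIntegrable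
  set H : ℝ → ℝ := fun s => ∫ t in (1 : ℝ)..s, h t with hH
  have hHd : ∀ s, 0 < s → HasDerivAt H (h s) s := fun s hs =>
    intervalIntegral.integral_hasDerivAt_right (hint 1 s one_pos hs)
      (hc.stronglyMeasurableAtFilter isOpen_Ioi s hs) (hc.continuousAt (Ioi_mem_nhds hs))
  -- bounds for the averages, from monotonicity
  have hav : ∀ s δ : ℝ, 0 < s → 0 < δ → h (s + δ) ≤ (H (s + δ) - H s) / δ ∧
      (H (s + δ) - H s) / δ ≤ h s := by
    intro s δ hs hδ
    have e : H (s + δ) - H s = ∫ t in s..(s + δ), h t := by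
      rw [hH, intervalIntegral.integral_interval_sub_left (hint _ _ one_pos (by positivity))
        (hint _ _ one_pos hs)]
    have i1 := hint s (s + δ) hs (by positivity)
    rw [e, le_div_iff₀ hδ, div_le_iff₀ hδ]
    constructor
    · calc h (s + δ) * δ = ∫ _t in s..(s + δ), h (s + δ) := by simp; ring
        _ ≤ _ := intervalIntegral.integral_mono_on (by linarith) (by simp) i1 fun t ht =>
          hanti (lt_of_lt_of_le hs ht.1) (by simp; positivity) ht.2
    · calc (∫ t in s..(s + δ), h t) ≤ ∫ _t in s..(s + δ), h s :=
          intervalIntegral.integral_mono_on (by linarith) i1 (by simp) fun t ht =>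
          hanti hs (lt_of_lt_of_le hs ht.1) ht.1
        _ = h s * δ := by simp; ring
  set G : ℝ → ℝ → ℝ := fun δ s => s ^ p * ((H (s + δ) - H s) / δ) with hG
  have hGle : ∀ δ s : ℝ, 0 < δ → 0 < s → 0 ≤ G δ s ∧ G δ s ≤ f s := by
    intro δ s hδ hs
    have hp := Real.rpow_pos_of_pos hs p
    refine ⟨mul_nonneg hp.le ((hhpos _ (by positivity)).le.trans (hav s δ hs hδ).1), ?_⟩
    calc G δ s ≤ s ^ p * h s := mul_le_mul_of_nonneg_left (hav s δ hs hδ).2 hp.le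
      _ = f s := by rw [hh]; field_simp
  have hGlim : ∀ s : ℝ, 0 < s → Tendsto (fun k : ℕ => G (1 / ((k : ℝ) + 1)) s) atTop (𝓝 (f s)) := by
    intro s hs
    have hp := Real.rpow_pos_of_pos hs p
    have e : f s = s ^ p * h s := by rw [hh]; field_simp
    rw [e]
    refine Tendsto.const_mul _ (tendsto_of_tendsto_of_tendsto_of_le_of_le (g := fun k : ℕ =>
      h (s + 1 / ((k : ℝ) + 1))) (h := fun _ => h s) ?_ tendsto_const_nhds
      (fun k => (hav s _ hs (by positivity)).1) (fun k => (hav s _ hs (by positivity)).2))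
    have : ContinuousAt h s := hc.continuousAt (Ioi_mem_nhds hs)
    refine this.tendsto.comp ?_
    simpa using tendsto_one_div_add_atTop_nhds_zero_nat.const_add s
  have hGd : ∀ δ : ℝ, 0 < δ → NonposOn K (fun z => -(φ z * (G δ (v z) * lap v z))
      - p * (φ z * (G δ (v z) * gradSq v z / v z)) - G δ (v z) * gradDot φ v z) := by
    intro δ hδ
    refine nonposOn_subhomogeneous_of_hasDerivAt (G := G δ) (G' := fun s => p * s ^ (p - 1) *
      ((H (s + δ) - H s) / δ) + s ^ p * ((h (s + δ) - h s) / δ)) hK hφ hφ0 h0 hv hpos ?_ ?_ ?_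
    · intro s hs
      refine (Real.hasDerivAt_rpow_const (Or.inl hs.ne')).mul (HasDerivAt.div_const ?_ δ)
      exact ((hHd (s + δ) (by positivity)).comp_add_const s δ).sub (hHd s hs)
    · have c1 : ContinuousOn H (Ioi 0) := fun s hs => (hHd s hs).continuousAt.continuousWithinAt
      have m : MapsTo (fun s : ℝ => s + δ) (Ioi 0) (Ioi 0) := fun s hs => by
        simp only [mem_Ioi] at hs ⊢; positivity
      have c2 : ContinuousOn (fun s : ℝ => H (s + δ)) (Ioi 0) := c1.comp (by fun_prop) m
      have c3 : ContinuousOn (fun s : ℝ => h (s + δ)) (Ioi 0) := hc.comp (by fun_prop) m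
      have c4 : ∀ q : ℝ, ContinuousOn (fun s : ℝ => s ^ q) (Ioi 0) := fun q s hs =>
        (Real.continuousAt_rpow_const s q (Or.inl (ne_of_gt hs))).continuousWithinAt
      have := c4 p
      have := c4 (p - 1)
      fun_prop
    · intro s hs
      have hp := Real.rpow_pos_of_pos hs p
      have h1 : h (s + δ) - h s ≤ 0 := sub_nonpos.2 (hanti hs (by simp; positivity) (by linarith))
      have h2 : s ^ p * ((h (s + δ) - h s) / δ) ≤ 0 :=
        mul_nonpos_of_nonneg_of_nonpos hp.le (div_nonpos_of_nonpos_of_nonneg h1 hδ.le)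
      have h3 : p * s ^ (p - 1) * ((H (s + δ) - H s) / δ) = p * (G δ s / s) := by
        rw [Real.rpow_sub_one hs.ne', hG]; ring
      linarith
  have cφ := hφ.continuous
  have cv := hv.continuous
  have cL := continuous_lap hv
  have cN := continuous_gradSq hv
  have cd := continuous_gradDot hφ hv
  have hd0 := gradDot_eq_zero_off (φ := φ) (v := v) hK.isClosed h0
  have hne : ∀ z, v z ≠ 0 := fun z => (hpos z).ne'
  refine ⟨by fun_prop (disch := exact hne), fun z hz => by simp [h0 z hz, hd0 z hz], ?_⟩
  refine le_of_tendsto (tendsto_integral_of_dominated_convergence (fun z => f (v z) *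
    (φ z * |lap v z| + |p| * (φ z * (gradSq v z / v z)) + |gradDot φ v z|))
    (fun k : ℕ => (hGd (1 / ((k : ℝ) + 1)) (by positivity)).cont.aestronglyMeasurable) ?_ ?_ ?_)
    (Eventually.of_forall fun k : ℕ => (hGd (1 / ((k : ℝ) + 1)) (by positivity)).integral_le)
  · exact integrable_of_zero_off hK (by fun_prop (disch := exact hne)) fun z hz => by
      simp [h0 z hz, hd0 z hz]
  · refine fun k => Eventually.of_forall fun z => ?_
    obtain ⟨g0, g1⟩ := hGle (1 / ((k : ℝ) + 1)) (v z) (by positivity) (hpos z)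
    set g := G (1 / ((k : ℝ) + 1)) (v z)
    have hN := gradSq_nonneg v z
    have hX : 0 ≤ φ z * (gradSq v z / v z) := mul_nonneg (hφ0 z) (div_nonneg hN (hpos z).le)
    have e : -(φ z * (g * lap v z)) - p * (φ z * (g * gradSq v z / v z)) - g * gradDot φ v z
      = g * (-(φ z * lap v z) - p * (φ z * (gradSq v z / v z)) - gradDot φ v z) := by ring
    rw [e, norm_mul, Real.norm_eq_abs, abs_of_nonneg g0]
    refine mul_le_mul g1 ?_ (abs_nonneg _) (g0.trans g1)
    refine (norm_sub_le _ _).trans (add_le_add ((norm_sub_le _ _).trans (add_le_add ?_ ?_)) le_rfl)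
    · rw [norm_neg, norm_mul, Real.norm_eq_abs, Real.norm_eq_abs, abs_of_nonneg (hφ0 z)]
    · rw [norm_mul, Real.norm_eq_abs, Real.norm_eq_abs, abs_of_nonneg hX]
  · refine Eventually.of_forall fun z => ?_
    have := hGlim (v z) (hpos z)
    exact (((this.mul_const _).const_mul _).neg.sub
      (((this.mul_const _).div_const _).const_mul _ |>.const_mul _)).sub (this.mul_const _)

end Subhomogeneous

/-! ### Absorption of error terms, pointwise -/

section Absorption

/-- Young's inequality in the form used to absorb cross terms. -/
theorem abs_le_of_sq_le_mul {x A B ε : ℝ} (hA : 0 ≤ A) (hB : 0 ≤ B) (hε : 0 < ε)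
    (h : x ^ 2 ≤ A * B) : |x| ≤ ε * A + ε⁻¹ * B := by
  have hi : 0 < ε⁻¹ := inv_pos.2 hε
  have h1 : ε * ε⁻¹ = 1 := mul_inv_cancel₀ hε.ne'
  refine abs_le_of_sq_le_sq ?_ (by positivity)
  have e : (ε * A + ε⁻¹ * B) ^ 2 = (ε * A - ε⁻¹ * B) ^ 2 + 4 * (ε * ε⁻¹) * (A * B) := by ring
  rw [e, h1]
  nlinarith [sq_nonneg (ε * A - ε⁻¹ * B), mul_nonneg hA hB]

/-- Pointwise form of the estimate of `∫ φ (∂ₜv)²`. Here `τ = ∂ₜv`, `L = Δv`, `N = |∇v|²`,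
`d = ∇φ·∇v`, `φt = ∂ₜφ`, and `r = R⁻²` is the scale of the cut-off. -/
theorem time_energy_pointwise {φ ψ τ L f e N d φt F c r v CF : ℝ} (hφ : 0 ≤ φ) (hψ : 0 ≤ ψ)
    (hf : 0 ≤ f) (hN : 0 ≤ N) (hv : 0 ≤ v) (hCF : 0 ≤ CF) (hc : 0 ≤ c) (hr : 0 ≤ r) (hL : τ - L - f = e)
    (hd : d ^ 2 ≤ c * r * φ * ψ * N) (ht : |φt| ≤ c * r * ψ) (hF0 : 0 ≤ F) (hF : F ≤ CF * (v * f)) :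
    φ * τ ^ 2 ≤ 2 * ((φ * τ * L + τ * d - 1 / 2 * φt * N) + (φ * τ * f + φt * F))
      + (2 + 10 * c + 2 * c * CF) *
        (r * ψ * N + r * ψ * (v * f) + φ * (e ^ 2 + f * |e|)) := by
  obtain rfl : L = τ - f - e := by linarith
  have b1 : |τ * d| ≤ 1 / 4 * (φ * τ ^ 2) + (1 / 4 : ℝ)⁻¹ * (c * (r * ψ * N)) := by
    refine abs_le_of_sq_le_mul (by positivity) (by positivity) (by norm_num) ?_
    calc (τ * d) ^ 2 = τ ^ 2 * d ^ 2 := by ring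
      _ ≤ τ ^ 2 * (c * r * φ * ψ * N) := by gcongr
      _ = _ := by ring
  have b2 : |φt * N| ≤ c * (r * ψ * N) := by
    rw [abs_mul, abs_of_nonneg hN]
    calc |φt| * N ≤ c * r * ψ * N := by gcongr
      _ = _ := by ring
  have b3 : |φt * F| ≤ c * CF * (r * ψ * (v * f)) := by
    rw [abs_mul, abs_of_nonneg hF0]
    calc |φt| * F ≤ c * r * ψ * (CF * (v * f)) := by gcongr
      _ = _ := by ring
  have b4 : φ * τ * e ≤ 1 / 4 * (φ * τ ^ 2) + φ * e ^ 2 := by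
    nlinarith [mul_nonneg hφ (sq_nonneg (τ / 2 - e))]
  have b5 : 0 ≤ φ * (f * |e|) := by positivity
  have g1 : 0 ≤ c * CF * (r * ψ * N) := by positivity
  have g2 : 0 ≤ c * (r * ψ * N) := by positivity
  have g3 : 0 ≤ c * (r * ψ * (v * f)) := by positivity
  have g4 : 0 ≤ r * ψ * N := by positivity
  have g5 : 0 ≤ r * ψ * (v * f) := by positivity
  have g6 : 0 ≤ c * (φ * e ^ 2) := by positivity
  have g7 : 0 ≤ c * (φ * (f * |e|)) := by positivity
  have g8 : 0 ≤ c * CF * (φ * e ^ 2) := by positivity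
  have g9 : 0 ≤ c * CF * (φ * (f * |e|)) := by positivity
  have k1 := neg_abs_le (τ * d)
  have k2 := le_abs_self (φt * N)
  have k3 := neg_abs_le (φt * F)
  rw [show (1 / 4 : ℝ)⁻¹ = 4 by norm_num] at b1
  linarith only [b1, b2, b3, b4, b5, g1, g2, g3, g4, g5, g6, g7, g8, g9, k1, k2, k3]

/-- Pointwise form of the gradient estimate. With `q = |∇v|² / v`, `H = |D²v|²` and
`s = D²v(∇v,∇v) / v`, the last hypothesis is the Cauchy–Schwarz inequality between the trace and
the Frobenius norm of the matrix `∂ᵢⱼv - a ∂ᵢv ∂ⱼv / v`. -/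
theorem gradient_energy_pointwise {a p γ k c : ℝ} (ha : 0 < a) (hk : 0 ≤ k) (hγ : γ = 1 - k)
    (hγ0 : 0 ≤ γ) (hI : 0 < a - γ * a ^ 2) (hM : 0 < a * (1 + 2 * k) - p * γ) (hc : 0 ≤ c) :
    ∃ C : ℝ, 0 ≤ C ∧ ∀ φ ψ τ L f e q d φt Δφ H s r v : ℝ, 0 ≤ φ → 0 ≤ ψ → 0 ≤ f → 0 ≤ q →
      0 < v → 0 ≤ r → τ - L - f = e → d ^ 2 ≤ c * r * φ * ψ * (q * v) → |φt| ≤ c * r * ψ →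
      |Δφ| ≤ c * r * ψ → k * (L - a * q) ^ 2 ≤ H - 2 * a * s + a ^ 2 * q ^ 2 →
      (a - γ * a ^ 2) / 2 * (φ * q ^ 2) ≤
        (φ * H - φ * L ^ 2 - 1 / 2 * Δφ * (q * v) - L * d)
        + (-2 * a) * (φ * s + 1 / 2 * (φ * (q * L)) - 1 / 2 * (φ * q ^ 2) + 1 / 2 * (q * d))
        + γ * (φ * τ * L + τ * d - 1 / 2 * φt * (q * v))
        + γ * (-(φ * (f * L)) - p * (φ * (f * q)) - f * d)
        + C * (φ * τ ^ 2 + r * ψ * (q * v) + r * ψ * (v * f) + φ * (e ^ 2 + f * |e|)) := by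
  set A := a * (1 + 2 * k) with hA
  set cI := a - γ * a ^ 2 with hcI
  set cM := A - p * γ with hcM
  have hA0 : 0 < A := by positivity
  have hγ1 : γ ≤ 1 := by linarith
  set ε := min (cI / (2 * (2 * A + a))) (cM / 2) with hε
  have hε0 : 0 < ε := lt_min (by positivity) (by positivity)
  have hε1 : ε * (2 * A + a) ≤ cI / 2 := by
    have h : ε ≤ cI / (2 * (2 * A + a)) := min_le_left _ _
    rw [le_div_iff₀ (by positivity)] at h
    linarith
  have hε2 : 2 * ε ≤ cM := by
    have h : ε ≤ cM / 2 := min_le_right _ _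
    linarith
  have hi : 0 < ε⁻¹ := inv_pos.2 hε0
  refine ⟨4 + 5 * c + 2 * (A * ε⁻¹) + 2 * (c * ε⁻¹) + a * c * ε⁻¹, by positivity, ?_⟩
  intro φ ψ τ L f e q d φt Δφ H s r v hφ hψ hf hq hv hr hL hd ht hΔ htr
  obtain rfl : L = τ - f - e := by linarith
  set T := φ * τ ^ 2 with hT
  set G := r * ψ * (q * v) with hG
  set P := r * ψ * (v * f) with hP
  set E := φ * e ^ 2 with hE
  set E' := φ * (f * |e|) with hE'
  set X := φ * q ^ 2 with hX
  set Y := φ * (f * q) with hY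
  have T0 : 0 ≤ T := by positivity
  have G0 : 0 ≤ G := by positivity
  have P0 : 0 ≤ P := by positivity
  have E0 : 0 ≤ E := by positivity
  have E0' : 0 ≤ E' := by positivity
  have X0 : 0 ≤ X := by positivity
  have Y0 : 0 ≤ Y := by positivity
  have hd' : d ^ 2 ≤ φ * (c * G) := hd.trans (le_of_eq (by rw [hG]; ring))
  have b1 : |τ * d| ≤ 1 * T + 1⁻¹ * (c * G) := by
    refine abs_le_of_sq_le_mul T0 (by positivity) one_pos ?_
    calc (τ * d) ^ 2 = τ ^ 2 * d ^ 2 := by ring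
      _ ≤ τ ^ 2 * (φ * (c * G)) := by gcongr
      _ = _ := by rw [hT]; ring
  have b2 : |φt * (q * v)| ≤ c * G := by
    rw [abs_mul, abs_of_nonneg (by positivity : 0 ≤ q * v)]
    calc |φt| * (q * v) ≤ c * r * ψ * (q * v) := by gcongr
      _ = _ := by rw [hG]; ring
  have b3 : |Δφ * (q * v)| ≤ c * G := by
    rw [abs_mul, abs_of_nonneg (by positivity : 0 ≤ q * v)]
    calc |Δφ| * (q * v) ≤ c * r * ψ * (q * v) := by gcongr
      _ = _ := by rw [hG]; ring
  have b4 : |f * d| ≤ ε * Y + ε⁻¹ * (c * P) := by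
    refine abs_le_of_sq_le_mul Y0 (by positivity) hε0 ?_
    calc (f * d) ^ 2 = f ^ 2 * d ^ 2 := by ring
      _ ≤ f ^ 2 * (φ * (c * G)) := by gcongr
      _ = _ := by rw [hY, hP, hG]; ring
  have b5 : |φ * τ * e| ≤ 1 * T + 1⁻¹ * E := by
    refine abs_le_of_sq_le_mul T0 E0 one_pos (le_of_eq ?_)
    rw [hT, hE]; ring
  have b6 : φ * (f * e) ≤ E' := by
    rw [hE']; gcongr; exact le_abs_self e
  have b7 : |φ * q * τ| ≤ ε * X + ε⁻¹ * T := by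
    refine abs_le_of_sq_le_mul X0 T0 hε0 (le_of_eq ?_)
    rw [hT, hX]; ring
  have b8 : |φ * q * e| ≤ ε * X + ε⁻¹ * E := by
    refine abs_le_of_sq_le_mul X0 E0 hε0 (le_of_eq ?_)
    rw [hE, hX]; ring
  have b9 : |e * d| ≤ 1 * E + 1⁻¹ * (c * G) := by
    refine abs_le_of_sq_le_mul E0 (by positivity) one_pos ?_
    calc (e * d) ^ 2 = e ^ 2 * d ^ 2 := by ring
      _ ≤ e ^ 2 * (φ * (c * G)) := by gcongr
      _ = _ := by rw [hE]; ring
  have b10 : |q * d| ≤ ε * X + ε⁻¹ * (c * G) := by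
    refine abs_le_of_sq_le_mul X0 (by positivity) hε0 ?_
    calc (q * d) ^ 2 = q ^ 2 * d ^ 2 := by ring
      _ ≤ q ^ 2 * (φ * (c * G)) := by gcongr
      _ = _ := by rw [hX]; ring
  -- the inequality before absorption
  have main : cI * X + cM * Y ≤
      (φ * H - φ * (τ - f - e) ^ 2 - 1 / 2 * Δφ * (q * v) - (τ - f - e) * d)
        + (-2 * a) * (φ * s + 1 / 2 * (φ * (q * (τ - f - e))) - 1 / 2 * (φ * q ^ 2)
          + 1 / 2 * (q * d))
        + γ * (φ * τ * (τ - f - e) + τ * d - 1 / 2 * φt * (q * v))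
        + γ * (-(φ * (f * (τ - f - e))) - p * (φ * (f * q)) - f * d)
        + (γ * (-(τ * d) + 1 / 2 * (φt * (q * v)) + f * d - φ * τ * e + φ * (f * e) + φ * e ^ 2)
          + A * (φ * q * τ - φ * q * e) + 1 / 2 * (Δφ * (q * v)) + (τ * d - f * d - e * d)
          + a * (q * d)) := by
    have h := mul_le_mul_of_nonneg_left htr hφ
    obtain rfl : k = 1 - γ := by linarith
    rw [hcI, hcM, hX, hY, hA]
    linarith
  have m1 : γ * (-(τ * d) + 1 / 2 * (φt * (q * v)) + f * d - φ * τ * e + φ * (f * e) + φ * e ^ 2)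
      ≤ 1 * ((1 * T + 1⁻¹ * (c * G)) + 1 / 2 * (c * G) + (ε * Y + ε⁻¹ * (c * P))
        + (1 * T + 1⁻¹ * E) + E' + E) := by
    refine (mul_le_mul_of_nonneg_left ?_ hγ0).trans (mul_le_mul_of_nonneg_right hγ1 ?_)
    · linarith [neg_abs_le (τ * d), le_abs_self (φt * (q * v)), le_abs_self (f * d),
        neg_abs_le (φ * τ * e)]
    · positivity
  have m2 : A * (φ * q * τ - φ * q * e) ≤ A * ((ε * X + ε⁻¹ * T) + (ε * X + ε⁻¹ * E)) := by
    refine mul_le_mul_of_nonneg_left ?_ hA0.le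
    linarith [le_abs_self (φ * q * τ), neg_abs_le (φ * q * e)]
  have m3 : a * (q * d) ≤ a * (ε * X + ε⁻¹ * (c * G)) :=
    mul_le_mul_of_nonneg_left ((le_abs_self _).trans b10) ha.le
  have m4 : ε * (2 * A + a) * X ≤ cI / 2 * X := mul_le_mul_of_nonneg_right hε1 X0
  have m5 : 2 * ε * Y ≤ cM * Y := mul_le_mul_of_nonneg_right hε2 Y0
  have fin : ∀ x : ℝ, 0 ≤ x → 0 ≤ c * x ∧ 0 ≤ A * ε⁻¹ * x ∧ 0 ≤ c * ε⁻¹ * x ∧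
      0 ≤ a * c * ε⁻¹ * x := fun x hx => ⟨by positivity, by positivity, by positivity, by positivity⟩
  obtain ⟨t1, t2, t3, t4⟩ := fin T T0
  obtain ⟨u1, u2, u3, u4⟩ := fin G G0
  obtain ⟨v1, v2, v3, v4⟩ := fin P P0
  obtain ⟨w1, w2, w3, w4⟩ := fin E E0
  obtain ⟨y1, y2, y3, y4⟩ := fin E' E0'
  have hsplit : φ * (e ^ 2 + f * |e|) = E + E' := by rw [hE, hE']; ring
  rw [hsplit]
  simp only [one_mul, inv_one] at b1 b5 b9 m1
  linarith [neg_abs_le (f * d), neg_abs_le (e * d), le_abs_self (τ * d),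
    le_abs_self (Δφ * (q * v))]

/-- Pointwise form of the estimate obtained by testing the equation with `ψ v`. Here
`d = ∇ψ·∇v` and `ψt = ∂ₜψ`. -/
theorem potential_energy_pointwise {φ ψ χ τ L f e N d ψt c r v : ℝ} (hφ : 0 ≤ φ) (hψ : 0 ≤ ψ)
    (hχ : 0 ≤ χ) (hψχ : ψ ^ 2 ≤ φ * χ) (hf : 0 ≤ f) (hN : 0 ≤ N) (hc : 0 ≤ c) (hr : 0 ≤ r)
    (hL : τ - L - f = e) (hd : d ^ 2 ≤ c * r * ψ * χ * N) (ht : |ψt| ≤ c * r * χ) :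
    r * ψ * (v * f) ≤ r * (ψ * v * τ + 1 / 2 * ψt * v ^ 2)
      + (-r) * (ψ * v * L + ψ * N + v * d)
      + (2 + 2 * c) * (r * ψ * N + r ^ 2 * χ * v ^ 2 + φ * (e ^ 2 + f * |e|)) := by
  obtain rfl : L = τ - f - e := by linarith
  have b1 : |ψt * v ^ 2| ≤ c * r * χ * v ^ 2 := by
    rw [abs_mul, abs_of_nonneg (sq_nonneg v)]; gcongr
  have b2 : |r * (v * d)| ≤ 1 * (r * ψ * N) + 1⁻¹ * (c * (r ^ 2 * χ * v ^ 2)) := by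
    refine abs_le_of_sq_le_mul (by positivity) (by positivity) one_pos ?_
    calc (r * (v * d)) ^ 2 = r ^ 2 * v ^ 2 * d ^ 2 := by ring
      _ ≤ r ^ 2 * v ^ 2 * (c * r * ψ * χ * N) := by gcongr
      _ = _ := by ring
  have b3 : |r * ψ * (v * e)| ≤ 1 * (r ^ 2 * χ * v ^ 2) + 1⁻¹ * (φ * e ^ 2) := by
    refine abs_le_of_sq_le_mul (by positivity) (by positivity) one_pos ?_
    calc (r * ψ * (v * e)) ^ 2 = r ^ 2 * v ^ 2 * e ^ 2 * ψ ^ 2 := by ring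
      _ ≤ r ^ 2 * v ^ 2 * e ^ 2 * (φ * χ) := by gcongr
      _ = _ := by ring
  have b1' := mul_le_mul_of_nonneg_left b1 hr
  have k1 := mul_le_mul_of_nonneg_left (neg_abs_le (ψt * v ^ 2)) hr
  have k2 := le_abs_self (r * (v * d))
  have k3 := neg_abs_le (r * ψ * (v * e))
  have g1 : 0 ≤ r ^ 2 * χ * v ^ 2 := by positivity
  have g2 : 0 ≤ r * ψ * N := by positivity
  have g3 : 0 ≤ φ * e ^ 2 := by positivity
  have g4 : 0 ≤ φ * (f * |e|) := by positivity
  have g5 : 0 ≤ c * (r ^ 2 * χ * v ^ 2) := by positivity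
  have g6 : 0 ≤ c * (r * ψ * N) := by positivity
  have g7 : 0 ≤ c * (φ * e ^ 2) := by positivity
  have g8 : 0 ≤ c * (φ * (f * |e|)) := by positivity
  simp only [one_mul, inv_one] at b2 b3
  linarith

/-- Interpolation of the quadratic gradient term between `φ |∇v|⁴ / v²` and `v²`. -/
theorem gradient_interpolation_pointwise {φ ψ χ q r v ε : ℝ} (hφ : 0 ≤ φ)
    (hχ : 0 ≤ χ) (hψχ : ψ ^ 2 ≤ φ * χ) (hε : 0 < ε) :
    r * ψ * (q * v) ≤ ε * (φ * q ^ 2) + ε⁻¹ * (r ^ 2 * χ * v ^ 2) := by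
  refine (le_abs_self _).trans (abs_le_of_sq_le_mul (by positivity) (by positivity) hε ?_)
  calc (r * ψ * (q * v)) ^ 2 = r ^ 2 * q ^ 2 * v ^ 2 * ψ ^ 2 := by ring
    _ ≤ r ^ 2 * q ^ 2 * v ^ 2 * (φ * χ) := by gcongr
    _ = _ := by ring

/-- Closing a chain of estimates: a linear system of inequalities between the energy densities
`T, X, G, P, Q`, with `h₁, h₂, h₄` to be integrated away, bounds `T` and `X` by the data `D`
and `E`. -/
theorem linear_absorption {C₁ C₂ C₄ κ₀ : ℝ} (h1 : 0 ≤ C₁) (h2 : 0 ≤ C₂) (h4 : 0 ≤ C₄)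
    (hκ : 0 < κ₀) {Cκ : ℝ → ℝ} (hCκ : ∀ κ, 0 < κ → 0 ≤ Cκ κ) :
    ∃ l₁ l₄ ε κ C : ℝ, 0 ≤ l₁ ∧ 0 ≤ l₄ ∧ 0 < ε ∧ 0 < κ ∧ 0 ≤ C ∧
      ∀ T X G P Q D E H₁ H₂ H₄ : ℝ,
        0 ≤ G → 0 ≤ P → 0 ≤ Q → 0 ≤ D → 0 ≤ E →
        T ≤ H₁ + C₁ * (G + P + E) →
        κ₀ * X ≤ H₂ + C₂ * (T + G + P + E) →
        G ≤ ε * X + ε⁻¹ * Q →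
        P ≤ H₄ + C₄ * (G + Q + E) →
        Q ≤ κ * P + Cκ κ * D →
        T + κ₀ / 2 * X ≤ H₂ + l₁ * H₁ + l₄ * H₄ + C * (D + E) := by
  set B := C₂ + (C₂ + 1) * C₁ with hB
  have hB0 : 0 ≤ B := by positivity
  set B' := B + (B + 1) * C₄ + 1 with hB'
  have hB0' : 0 < B' := by positivity
  set ε := κ₀ / (2 * B') with hε
  have hε0 : 0 < ε := by positivity
  set B'' := B' * (1 + ε⁻¹) with hB''
  have hB0'' : 0 < B'' := by positivity
  have hC := hCκ B''⁻¹ (by positivity)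
  refine ⟨C₂ + 1, B + 1, ε, B''⁻¹, B'' * Cκ B''⁻¹ + B', by positivity, by positivity, hε0,
    by positivity, by positivity, ?_⟩
  intro T X G P Q D E H₁ H₂ H₄ hG hP hQ hD hE i1 i2 i3 i4 i5
  have a1 : κ₀ * X + T + P ≤ H₂ + (C₂ + 1) * H₁ + (B + 1) * H₄ + B' * (G + Q + E) := by
    have j1 := mul_le_mul_of_nonneg_left i1 (by positivity : 0 ≤ C₂ + 1)
    have j4 := mul_le_mul_of_nonneg_left i4 (by positivity : 0 ≤ B + 1)
    have j5 : 0 ≤ B * Q := by positivity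
    have e1 : (C₂ + 1) * (C₁ * (G + P + E)) = (B - C₂) * (G + P + E) := by rw [hB]; ring
    have e2 : B' * (G + Q + E) = B * (G + Q + E) + (B + 1) * (C₄ * (G + Q + E)) + (G + Q + E) := by
      rw [hB']; ring
    linarith
  have a2 : B' * G ≤ κ₀ / 2 * X + B' * ε⁻¹ * Q := by
    have h := mul_le_mul_of_nonneg_left i3 hB0'.le
    have e : B' * (ε * X) = κ₀ / 2 * X := by rw [hε]; field_simp
    linarith
  have a3 : B'' * Q ≤ P + B'' * Cκ B''⁻¹ * D := by
    have h := mul_le_mul_of_nonneg_left i5 hB0''.le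
    have e : B'' * (B''⁻¹ * P) = P := by field_simp
    linarith
  have e3 : B'' * Q = B' * Q + B' * ε⁻¹ * Q := by rw [hB'']; ring
  have p1 : 0 ≤ B'' * Cκ B''⁻¹ * E := by positivity
  have p2 : 0 ≤ B' * D := by positivity
  linarith

end Absorption

/-! ### The energy estimate -/

section Energy

variable {n : ℕ} {K : Set (SpaceTime n)} {φ ψ χ v : SpaceTime n → ℝ}

/-- Cauchy–Schwarz between the trace and the Frobenius norm, for the matrix
`∂ᵢⱼv - a ∂ᵢv ∂ⱼv / v`. -/
theorem trace_sq_le_hessSq (hv : ContDiff ℝ ∞ v) (a : ℝ) (z : SpaceTime n) :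
    (n : ℝ)⁻¹ * (lap v z - a * (gradSq v z / v z)) ^ 2 ≤
      hessSq v z - 2 * a * (hessGrad v z / v z) + a ^ 2 * (gradSq v z / v z) ^ 2 := by
  set M : Fin n → Fin n → ℝ := fun i j => dX j (dX i v) z - a * (dX i v z * dX j v z / v z) with hM
  have e1 : ∑ i, M i i = lap v z - a * (gradSq v z / v z) := by
    simp only [hM, Finset.sum_sub_distrib, ← Finset.mul_sum, ← Finset.sum_div, lap, gradSq, sq]
  have e2 : ∑ i, ∑ j, M i j ^ 2 =
      hessSq v z - 2 * a * (hessGrad v z / v z) + a ^ 2 * (gradSq v z / v z) ^ 2 := by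
    have : ∀ i j, M i j ^ 2 = dX j (dX i v) z ^ 2
        - 2 * a * (dX i v z * dX j v z * dX i (dX j v) z / v z)
        + a ^ 2 * (dX i v z ^ 2 * dX j v z ^ 2 / v z ^ 2) := by
      intro i j
      have hc : dX i (dX j v) z = dX j (dX i v) z := dirD_comm hv z
      rw [hM, hc]
      ring
    simp only [this, Finset.sum_sub_distrib, Finset.sum_add_distrib, ← Finset.mul_sum,
      ← Finset.sum_mul, ← Finset.sum_div, hessSq, hessGrad, gradSq, div_pow, sq (∑ i, _)]
  rw [← e1, ← e2]
  rcases Nat.eq_zero_or_pos n with rfl | hn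
  · simp
  have hn' : (0 : ℝ) < n := by exact_mod_cast hn
  have h1 : (∑ i, M i i) ^ 2 ≤ n * ∑ i, M i i ^ 2 := by
    simpa using sq_sum_le_card_mul_sum_sq (s := (Finset.univ : Finset (Fin n))) (f := fun i => M i i)
  have h2 : ∑ i, M i i ^ 2 ≤ ∑ i, ∑ j, M i j ^ 2 := Finset.sum_le_sum fun i _ =>
    Finset.single_le_sum (f := fun j => M i j ^ 2) (fun j _ => sq_nonneg _) (Finset.mem_univ i)
  rw [inv_mul_le_iff₀ hn']
  exact h1.trans (mul_le_mul_of_nonneg_left h2 hn'.le)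

/-- Three nested cut-off weights supported in `K`, with derivatives controlled at the parabolic
scale `r = R⁻²`. The model is `φ = ηᵐ`, `ψ = ηᵐ⁻²`, `χ = ηᵐ⁻⁴`. -/
structure CutoffWeights (K : Set (SpaceTime n)) (c r : ℝ) (φ ψ χ : SpaceTime n → ℝ) : Prop where
  smooth_φ : ContDiff ℝ ∞ φ
  smooth_ψ : ContDiff ℝ ∞ ψ
  cont_χ : Continuous χ
  φ_nonneg : ∀ z, 0 ≤ φ z
  ψ_nonneg : ∀ z, 0 ≤ ψ z
  χ_nonneg : ∀ z, 0 ≤ χ z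
  φ_off : ∀ z ∉ K, φ z = 0
  ψ_off : ∀ z ∉ K, ψ z = 0
  sq_ψ : ∀ z, ψ z ^ 2 ≤ φ z * χ z
  grad_φ : ∀ z, gradSq φ z ≤ c * r * φ z * ψ z
  time_φ : ∀ z, |dT φ z| ≤ c * r * ψ z
  lap_φ : ∀ z, |lap φ z| ≤ c * r * ψ z
  grad_ψ : ∀ z, gradSq ψ z ≤ c * r * ψ z * χ z
  time_ψ : ∀ z, |dT ψ z| ≤ c * r * χ z

/-- The defect of `v` in the equation `∂ₜv - Δv = f(v)`. -/
noncomputable def defect (f : ℝ → ℝ) (v : SpaceTime n → ℝ) (z : SpaceTime n) : ℝ :=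
  dT v z - lap v z - f (v z)

theorem continuous_defect {f : ℝ → ℝ} (hf : Continuous f) (hv : ContDiff ℝ ∞ v) :
    Continuous (defect f v) :=
  ((hv.dirD _).continuous.sub (continuous_lap hv)).sub (hf.comp hv.continuous)

/-- The local energy estimate. For a smooth positive `v`, the integral of
`φ ((∂ₜv)² + |∇v|⁴ / v²)` is controlled by the defect of `v` in the equation and by any `D`
dominating the lower-order term `r² χ v²` up to a small multiple of `r ψ v f(v)`.
The constant does not depend on the scale `r`, on the weights or on `v`. -/
theorem energy_estimate {f F : ℝ → ℝ} (hf : Continuous f) (hfpos : ∀ s, 0 < s → 0 < f s)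
    (hF : ∀ s, HasDerivAt F (f s) s) (hF0 : ∀ s, 0 < s → 0 ≤ F s) {CF : ℝ} (hCF : 0 ≤ CF)
    (hFle : ∀ s, 0 < s → F s ≤ CF * (s * f s)) (hn : 1 ≤ n) {a p : ℝ} (ha : 0 < a)
    (hI : 0 < a - (1 - (n : ℝ)⁻¹) * a ^ 2)
    (hM : 0 < a * (1 + 2 * (n : ℝ)⁻¹) - p * (1 - (n : ℝ)⁻¹))
    (hsub : n = 1 ∨ AntitoneOn (fun s : ℝ => f s / s ^ p) (Ioi 0)) {c : ℝ} (hc : 0 ≤ c)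
    {Cκ : ℝ → ℝ} (hCκ : ∀ κ, 0 < κ → 0 ≤ Cκ κ) :
    ∃ C κ₀ : ℝ, 0 ≤ C ∧ 0 < κ₀ ∧ ∀ (K : Set (SpaceTime n)) (r : ℝ) (φ ψ χ D : SpaceTime n → ℝ),
      IsCompact K → 0 ≤ r → CutoffWeights K c r φ ψ χ → Continuous D → (∀ z, 0 ≤ D z) →
      (∀ z ∉ K, D z = 0) →
      (∀ κ, 0 < κ → ∀ z s, 0 < s →
        r ^ 2 * χ z * s ^ 2 ≤ κ * (r * ψ z * (s * f s)) + Cκ κ * D z) →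
      ∀ v : SpaceTime n → ℝ, ContDiff ℝ ∞ v → (∀ z, 0 < v z) →
        ∫ z, (φ z * dT v z ^ 2 + κ₀ * (φ z * (gradSq v z / v z) ^ 2)) ≤
          C * ∫ z, (D z + φ z * (defect f v z ^ 2 + f (v z) * |defect f v z|)) := by
  have hn' : (1 : ℝ) ≤ n := by exact_mod_cast hn
  set k : ℝ := (n : ℝ)⁻¹ with hk
  have hk0 : 0 ≤ k := by positivity
  have hk1 : k ≤ 1 := inv_le_one_of_one_le₀ hn'
  set γ : ℝ := 1 - k with hγ
  have hγ0 : 0 ≤ γ := by linarith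
  obtain ⟨C₂, hC₂, hgrad⟩ := gradient_energy_pointwise ha hk0 hγ hγ0 hI hM hc
  set κ₀ := (a - γ * a ^ 2) / 2 with hκ₀
  have hκpos : 0 < κ₀ := by positivity
  obtain ⟨l₁, l₄, ε, κ, C, hl₁, hl₄, hε, hκ, hC, habs⟩ := linear_absorption
    (C₁ := 2 + 10 * c + 2 * c * CF) (C₄ := 2 + 2 * c) (by positivity) hC₂ (by positivity) hκpos hCκ
  refine ⟨C, κ₀ / 2, hC, by positivity, ?_⟩
  intro K r φ ψ χ D hK hr hw cD hD hD0 hgrow v hv hpos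
  have h₁ := nullOn_time_laplacian hK hw.smooth_φ hw.φ_off hv
  have h₂ := nullOn_time_potential hK hw.smooth_φ hw.φ_off hv hf hF
  have h₃ := nullOn_bochner hK hw.smooth_φ hw.φ_off hv
  have h₄ := nullOn_hessGrad hK hw.smooth_φ hw.φ_off hv hpos
  have h₆ := nullOn_self_laplacian hK hw.smooth_ψ hw.ψ_off hv
  have h₇ := nullOn_self_time hK hw.smooth_ψ hw.ψ_off hv
  have cφ := hw.smooth_φ.continuous
  have cv := hv.continuous
  have cN := continuous_gradSq hv
  have cL := continuous_lap hv
  have cd := continuous_gradDot hw.smooth_φ hv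
  have cfv : Continuous fun z => f (v z) := hf.comp cv
  have ce := continuous_defect hf hv
  have ct : Continuous (dT v) := (hv.dirD _).continuous
  have hne : ∀ z, v z ≠ 0 := fun z => (hpos z).ne'
  have cq : Continuous fun z => gradSq v z / v z := cN.div cv hne
  -- in one space dimension the coefficient `γ` of this term vanishes
  have h₅ : NonposOn K (fun z => γ * (-(φ z * (f (v z) * lap v z))
      - p * (φ z * (f (v z) * (gradSq v z / v z))) - f (v z) * gradDot φ v z)) := by
    rcases hsub with h | h
    · have : γ = 0 := by rw [hγ, hk, h]; simp
      simp only [this, zero_mul]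
      exact ⟨continuous_const, fun _ _ => rfl, by simp⟩
    · have hh := nonposOn_subhomogeneous hK hw.smooth_φ hw.φ_nonneg hw.φ_off hv hpos hf hfpos h
      have e : (fun z => γ * (-(φ z * (f (v z) * lap v z))
          - p * (φ z * (f (v z) * (gradSq v z / v z))) - f (v z) * gradDot φ v z))
        = fun z => γ * (-(φ z * (f (v z) * lap v z))
          - p * (φ z * (f (v z) * gradSq v z / v z)) - f (v z) * gradDot φ v z) := by
        funext z; ring
      rw [e]
      refine ⟨hh.cont.const_mul γ, fun z hz => by rw [hh.zero_off z hz, mul_zero], ?_⟩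
      rw [integral_const_mul]
      exact mul_nonpos_of_nonneg_of_nonpos hγ0 hh.integral_le
  have hnull := ((((h₃.add hK (h₄.const_mul (-2 * a))).add hK (h₁.const_mul γ)).add hK
    ((h₁.add hK h₂).const_mul (l₁ * 2))).add hK
    (((h₇.const_mul r).add hK (h₆.const_mul (-r))).const_mul l₄)).nonposOn.add hK h₅
  rw [← integral_const_mul]
  refine hnull.integral_le_integral hK ?_ ?_ ?_ ?_ ?_
  · exact (cφ.mul (ct.pow 2)).add (continuous_const.mul (cφ.mul (cq.pow 2)))
  · intro z hz; simp [hw.φ_off z hz]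
  · exact continuous_const.mul (cD.add (cφ.mul ((ce.pow 2).add (cfv.mul ce.abs))))
  · intro z hz; simp [hw.φ_off z hz, hD0 z hz]
  intro z
  have q0 : 0 ≤ gradSq v z / v z := div_nonneg (gradSq_nonneg v z) (hpos z).le
  have qv : gradSq v z / v z * v z = gradSq v z := div_mul_cancel₀ _ (hne z)
  have f0 := (hfpos _ (hpos z)).le
  have φ0 := hw.φ_nonneg z
  have ψ0 := hw.ψ_nonneg z
  have χ0 := hw.χ_nonneg z
  have hdφ : gradDot φ v z ^ 2 ≤ c * r * φ z * ψ z * gradSq v z :=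
    (gradDot_sq_le φ v z).trans (mul_le_mul_of_nonneg_right (hw.grad_φ z) (gradSq_nonneg v z))
  have hdψ : gradDot ψ v z ^ 2 ≤ c * r * ψ z * χ z * gradSq v z :=
    (gradDot_sq_le ψ v z).trans (mul_le_mul_of_nonneg_right (hw.grad_ψ z) (gradSq_nonneg v z))
  have i1 := time_energy_pointwise (e := defect f v z) φ0 ψ0 f0 (gradSq_nonneg v z) (hpos z).le
    hCF hc hr rfl hdφ (hw.time_φ z) (hF0 _ (hpos z)) (hFle _ (hpos z))
  have i2 := hgrad (φ z) (ψ z) (dT v z) (lap v z) (f (v z)) (defect f v z) (gradSq v z / v z)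
    (gradDot φ v z) (dT φ z) (lap φ z) (hessSq v z) (hessGrad v z / v z) r (v z) φ0 ψ0 f0 q0
    (hpos z) hr rfl (by rw [qv]; exact hdφ) (hw.time_φ z) (hw.lap_φ z) (trace_sq_le_hessSq hv a z)
  have i3 := gradient_interpolation_pointwise (r := r) (q := gradSq v z / v z) (v := v z) φ0 χ0
    (hw.sq_ψ z) hε
  have i4 := potential_energy_pointwise (e := defect f v z) (v := v z) φ0 ψ0 χ0 (hw.sq_ψ z) f0
    (gradSq_nonneg v z) hc hr rfl hdψ (hw.time_ψ z)
  rw [qv] at i2 i3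
  have key := habs _ _ _ _ _ (D z) _ _ _ _ (by have := gradSq_nonneg v z; positivity)
    (by have := (hpos z).le; positivity) (by positivity) (hD z) (by positivity) i1 i2 i3 i4
    (hgrow κ hκ z (v z) (hpos z))
  refine key.trans (le_of_eq ?_)
  ring

end Energy

/-! ### Parabolic cut-off functions -/

section Cutoff

variable {n : ℕ} {K : Set (SpaceTime n)} {θ : SpaceTime n → ℝ}

theorem dirD_pow_succ (hθ : Differentiable ℝ θ) (e : SpaceTime n) (j : ℕ) (z : SpaceTime n) :
    dirD e (fun z => θ z ^ (j + 1)) z = (j + 1) * θ z ^ j * dirD e θ z := by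
  rw [dirD_comp (F := fun s => s ^ (j + 1)) (hasDerivAt_pow (j + 1) (θ z)) (hθ z)]
  simp

theorem gradSq_pow_succ (hθ : Differentiable ℝ θ) (j : ℕ) (z : SpaceTime n) :
    gradSq (fun z => θ z ^ (j + 1)) z = (j + 1) ^ 2 * (θ z ^ j) ^ 2 * gradSq θ z := by
  simp only [gradSq, dX, dirD_pow_succ hθ, mul_pow, Finset.mul_sum]

theorem lap_pow_add_two (hθ : ContDiff ℝ ∞ θ) (j : ℕ) (z : SpaceTime n) :
    lap (fun z => θ z ^ (j + 2)) z =
      (j + 2) * θ z ^ (j + 1) * lap θ z + (j + 2) * (j + 1) * θ z ^ j * gradSq θ z := by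
  have hd := hθ.smooth_differentiable
  have key : ∀ i : Fin n, dX i (dX i (fun z => θ z ^ (j + 2))) z =
      (j + 2) * θ z ^ (j + 1) * dX i (dX i θ) z
        + (j + 2) * (j + 1) * θ z ^ j * dX i θ z ^ 2 := by
    intro i
    have e1 : dX i (fun z => θ z ^ (j + 2)) = fun z => (j + 2) * (θ z ^ (j + 1) * dX i θ z) := by
      funext y
      have := dirD_pow_succ hd (spaceDir i) (j + 1) y
      push_cast at this
      rw [dX, this]
      ring
    have d1 : Differentiable ℝ fun z => θ z ^ (j + 1) := hd.fun_pow (j + 1)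
    have d2 : Differentiable ℝ (dX i θ) := (hθ.dirD _).smooth_differentiable
    rw [e1, dX, dirD_mul (differentiableAt_const _) ((d1.fun_mul d2) z), dirD_mul (d1 z) (d2 z),
      dirD_pow_succ hd]
    have : dirD (spaceDir i) (fun _ : SpaceTime n => ((j : ℝ) + 2)) z = 0 := by simp [dirD]
    rw [this]
    ring
  simp only [lap, key, Finset.sum_add_distrib, ← Finset.mul_sum, gradSq]

/-- Powers of a smooth bump with values in `[0, 1]` form a triple of cut-off weights. -/
theorem exists_cutoffWeights_pow (hK : IsCompact K) (hθ : ContDiff ℝ ∞ θ) (h0 : ∀ z, 0 ≤ θ z)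
    (h1 : ∀ z, θ z ≤ 1) (hoff : ∀ z ∉ K, θ z = 0) (k : ℕ) :
    ∃ c : ℝ, 0 ≤ c ∧ CutoffWeights K c 1 (fun z => θ z ^ (k + 4)) (fun z => θ z ^ (k + 2))
      (fun z => θ z ^ k) := by
  have hbd : ∀ g : SpaceTime n → ℝ, Continuous g → (∀ z ∉ K, g z = 0) →
      ∃ B : ℝ, 0 ≤ B ∧ ∀ z, |g z| ≤ B := by
    intro g hg hg0
    obtain ⟨B, hB⟩ := hK.exists_bound_of_continuousOn hg.continuousOn
    refine ⟨max B 0, le_max_right _ _, fun z => ?_⟩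
    by_cases hz : z ∈ K
    · exact (hB z hz).trans (le_max_left _ _)
    · rw [hg0 z hz]; simp
  obtain ⟨B₁, hB₁, b₁⟩ := hbd (gradSq θ) (continuous_gradSq hθ) fun z hz =>
    Finset.sum_eq_zero fun i _ => by
      simp only [dX, dirD_eq_zero_off (e := spaceDir i) hK.isClosed hoff z hz]; simp
  obtain ⟨B₂, hB₂, b₂⟩ := hbd (dT θ) (hθ.dirD _).continuous
    (dirD_eq_zero_off hK.isClosed hoff)
  obtain ⟨B₃, hB₃, b₃⟩ := hbd (lap θ) (continuous_lap hθ) (lap_eq_zero_off hK.isClosed hoff)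
  have b₁' : ∀ z, gradSq θ z ≤ B₁ := fun z => (le_abs_self _).trans (b₁ z)
  have hd := hθ.smooth_differentiable
  set m : ℝ := k + 4 with hm
  have hk : (0 : ℝ) ≤ k := Nat.cast_nonneg k
  have hm0 : 0 ≤ m := by positivity
  have mono : ∀ (z : SpaceTime n) (i j : ℕ), i ≤ j → θ z ^ j ≤ θ z ^ i := fun z i j hij =>
    pow_le_pow_of_le_one (h0 z) (h1 z) hij
  refine ⟨m ^ 2 * B₁ + m * B₂ + m * B₃, by positivity, ?_⟩
  have c1 : m ^ 2 * B₁ ≤ m ^ 2 * B₁ + m * B₂ + m * B₃ := by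
    have := mul_nonneg hm0 hB₂; have := mul_nonneg hm0 hB₃; linarith
  have c2 : m * B₂ ≤ m ^ 2 * B₁ + m * B₂ + m * B₃ := by
    have := mul_nonneg (sq_nonneg m) hB₁; have := mul_nonneg hm0 hB₃; linarith
  constructor
  · exact hθ.pow _
  · exact hθ.pow _
  · exact hθ.continuous.pow _
  · exact fun z => pow_nonneg (h0 z) _
  · exact fun z => pow_nonneg (h0 z) _
  · exact fun z => pow_nonneg (h0 z) _
  · exact fun z hz => by rw [hoff z hz]; simp
  · exact fun z hz => by rw [hoff z hz]; simp
  · exact fun z => le_of_eq (by ring)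
  · intro z
    have e : gradSq (fun z => θ z ^ (k + 4)) z = m ^ 2 * (θ z ^ (k + 3)) ^ 2 * gradSq θ z := by
      rw [gradSq_pow_succ hd (k + 3), hm]; push_cast; ring
    have t := h0 z
    calc _ = m ^ 2 * (θ z ^ (k + 3)) ^ 2 * gradSq θ z := e
      _ ≤ m ^ 2 * (θ z ^ (k + 3)) ^ 2 * B₁ := by gcongr; exact b₁' z
      _ = m ^ 2 * B₁ * (θ z ^ (k + 4) * θ z ^ (k + 2)) := by ring
      _ ≤ (m ^ 2 * B₁ + m * B₂ + m * B₃) * (θ z ^ (k + 4) * θ z ^ (k + 2)) := by gcongr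
      _ = _ := by ring
  · intro z
    have e : dT (fun z => θ z ^ (k + 4)) z = m * θ z ^ (k + 3) * dT θ z := by
      rw [dT, dirD_pow_succ hd _ (k + 3), hm]; push_cast; ring
    have t := h0 z
    rw [e, abs_mul, abs_of_nonneg (by positivity)]
    calc m * θ z ^ (k + 3) * |dT θ z| ≤ m * θ z ^ (k + 2) * B₂ :=
          mul_le_mul (mul_le_mul_of_nonneg_left (mono z _ _ (by omega)) hm0) (b₂ z)
            (abs_nonneg _) (by positivity)
      _ = m * B₂ * θ z ^ (k + 2) := by ring
      _ ≤ (m ^ 2 * B₁ + m * B₂ + m * B₃) * θ z ^ (k + 2) := by gcongr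
      _ = _ := by ring
  · intro z
    have t := h0 z
    have e : lap (fun z => θ z ^ (k + 4)) z = m * θ z ^ (k + 3) * lap θ z
        + m * (m - 1) * θ z ^ (k + 2) * gradSq θ z := by
      rw [lap_pow_add_two hθ (k + 2), hm]; push_cast; ring
    have g0 := gradSq_nonneg θ z
    have hm1 : 0 ≤ m - 1 := by linarith
    calc |lap (fun z => θ z ^ (k + 4)) z|
        ≤ m * θ z ^ (k + 3) * |lap θ z| + m * (m - 1) * θ z ^ (k + 2) * gradSq θ z := by
          rw [e]
          refine (abs_add_le _ _).trans (le_of_eq ?_)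
          rw [abs_mul, abs_of_nonneg (by positivity : 0 ≤ m * θ z ^ (k + 3)),
            abs_of_nonneg (by positivity : 0 ≤ m * (m - 1) * θ z ^ (k + 2) * gradSq θ z)]
      _ ≤ m * θ z ^ (k + 2) * B₃ + m * m * θ z ^ (k + 2) * B₁ := by
          have : m * θ z ^ (k + 3) * |lap θ z| ≤ m * θ z ^ (k + 2) * B₃ :=
            mul_le_mul (mul_le_mul_of_nonneg_left (mono z _ _ (by omega)) hm0) (b₃ z)
              (abs_nonneg _) (by positivity)
          have : m * (m - 1) * θ z ^ (k + 2) * gradSq θ z ≤ m * m * θ z ^ (k + 2) * B₁ := by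
            gcongr
            · linarith
            · exact b₁' z
          linarith
      _ = (m ^ 2 * B₁ + m * B₃) * θ z ^ (k + 2) := by ring
      _ ≤ (m ^ 2 * B₁ + m * B₂ + m * B₃) * θ z ^ (k + 2) := by
          gcongr
          linarith [mul_nonneg hm0 hB₂]
      _ = _ := by ring
  · intro z
    have e : gradSq (fun z => θ z ^ (k + 2)) z = (m - 2) ^ 2 * (θ z ^ (k + 1)) ^ 2 * gradSq θ z := by
      rw [gradSq_pow_succ hd (k + 1), hm]; push_cast; ring
    have t := h0 z
    have hm2 : (m - 2) ^ 2 ≤ m ^ 2 := by nlinarith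
    calc _ = (m - 2) ^ 2 * (θ z ^ (k + 1)) ^ 2 * gradSq θ z := e
      _ ≤ m ^ 2 * (θ z ^ (k + 1)) ^ 2 * B₁ := by
          gcongr
          · exact gradSq_nonneg θ z
          · exact b₁' z
      _ = m ^ 2 * B₁ * (θ z ^ (k + 2) * θ z ^ k) := by ring
      _ ≤ (m ^ 2 * B₁ + m * B₂ + m * B₃) * (θ z ^ (k + 2) * θ z ^ k) := by gcongr
      _ = _ := by ring
  · intro z
    have e : dT (fun z => θ z ^ (k + 2)) z = (m - 2) * θ z ^ (k + 1) * dT θ z := by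
      rw [dT, dirD_pow_succ hd _ (k + 1), hm]; push_cast; ring
    have t := h0 z
    have hm2 : 0 ≤ m - 2 := by linarith
    rw [e, abs_mul, abs_of_nonneg (by positivity)]
    calc (m - 2) * θ z ^ (k + 1) * |dT θ z| ≤ m * θ z ^ k * B₂ :=
          mul_le_mul (mul_le_mul (by linarith) (mono z _ _ (by omega)) (by positivity) hm0) (b₂ z)
            (abs_nonneg _) (by positivity)
      _ = m * B₂ * θ z ^ k := by ring
      _ ≤ (m ^ 2 * B₁ + m * B₂ + m * B₃) * θ z ^ k := by gcongr
      _ = _ := by ring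

/-- The parabolic dilation `(x, t) ↦ (x / R, t / R²)`. -/
noncomputable def parabolicScaling (n : ℕ) (R : ℝ) : SpaceTime n →L[ℝ] SpaceTime n :=
  (R⁻¹ • ContinuousLinearMap.fst ℝ _ _).prod ((R ^ 2)⁻¹ • ContinuousLinearMap.snd ℝ _ _)

theorem parabolicScaling_apply (R : ℝ) (z : SpaceTime n) :
    parabolicScaling n R z = (R⁻¹ • z.1, (R ^ 2)⁻¹ * z.2) := by
  simp [parabolicScaling]

theorem dirD_comp_parabolicScaling (hθ : Differentiable ℝ θ) (R : ℝ) (e z : SpaceTime n) :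
    dirD e (fun z => θ (parabolicScaling n R z)) z
      = dirD (parabolicScaling n R e) θ (parabolicScaling n R z) := by
  have h : HasFDerivAt (fun z => θ (parabolicScaling n R z))
      ((fderiv ℝ θ (parabolicScaling n R z)).comp (parabolicScaling n R)) z :=
    (hθ _).hasFDerivAt.comp z (parabolicScaling n R).hasFDerivAt
  rw [dirD_eq h]
  rfl

theorem dX_comp_parabolicScaling (hθ : Differentiable ℝ θ) (R : ℝ) (i : Fin n)
    (z : SpaceTime n) : dX i (fun z => θ (parabolicScaling n R z)) z
      = R⁻¹ * dX i θ (parabolicScaling n R z) := by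
  rw [dX, dirD_comp_parabolicScaling hθ]
  have : parabolicScaling n R (spaceDir i) = R⁻¹ • spaceDir i := by
    rw [parabolicScaling_apply]; simp [spaceDir]
  rw [this]
  simp [dirD]

theorem dT_comp_parabolicScaling (hθ : Differentiable ℝ θ) (R : ℝ)
    (z : SpaceTime n) : dT (fun z => θ (parabolicScaling n R z)) z
      = (R ^ 2)⁻¹ * dT θ (parabolicScaling n R z) := by
  rw [dT, dirD_comp_parabolicScaling hθ]
  have : parabolicScaling n R (timeDir n) = (R ^ 2)⁻¹ • timeDir n := by
    rw [parabolicScaling_apply]; simp [timeDir]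
  rw [this]
  simp [dirD]

theorem gradSq_comp_parabolicScaling (hθ : Differentiable ℝ θ) (R : ℝ)
    (z : SpaceTime n) : gradSq (fun z => θ (parabolicScaling n R z)) z
      = (R ^ 2)⁻¹ * gradSq θ (parabolicScaling n R z) := by
  simp only [gradSq, dX_comp_parabolicScaling hθ, mul_pow, Finset.mul_sum, inv_pow]

theorem lap_comp_parabolicScaling (hθ : ContDiff ℝ ∞ θ) (R : ℝ)
    (z : SpaceTime n) : lap (fun z => θ (parabolicScaling n R z)) z
      = (R ^ 2)⁻¹ * lap θ (parabolicScaling n R z) := by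
  have hd := hθ.smooth_differentiable
  have key : ∀ i : Fin n, dX i (dX i (fun z => θ (parabolicScaling n R z))) z
      = (R ^ 2)⁻¹ * dX i (dX i θ) (parabolicScaling n R z) := by
    intro i
    have e : dX i (fun z => θ (parabolicScaling n R z))
        = fun z => R⁻¹ * dX i θ (parabolicScaling n R z) :=
      funext fun y => dX_comp_parabolicScaling hd R i y
    have d2 : Differentiable ℝ (dX i θ) := (hθ.dirD _).smooth_differentiable
    have d3 : Differentiable ℝ fun z => dX i θ (parabolicScaling n R z) :=
      d2.comp (parabolicScaling n R).differentiable
    rw [e, dX, dirD_mul (differentiableAt_const _) (d3 z)]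
    have h0 : dirD (spaceDir i) (fun _ : SpaceTime n => R⁻¹) z = 0 := by simp [dirD]
    have h1 := dX_comp_parabolicScaling d2 R i z
    rw [dX] at h1
    rw [h0, h1]
    ring
  simp only [lap, key, Finset.mul_sum]

theorem CutoffWeights.comp_parabolicScaling {c R : ℝ} {K' : Set (SpaceTime n)}
    {φ ψ χ : SpaceTime n → ℝ} (h : CutoffWeights K c 1 φ ψ χ)
    (hK' : ∀ z, parabolicScaling n R z ∈ K → z ∈ K') :
    CutoffWeights K' c (R ^ 2)⁻¹ (fun z => φ (parabolicScaling n R z))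
      (fun z => ψ (parabolicScaling n R z)) (fun z => χ (parabolicScaling n R z)) := by
  have hS := (parabolicScaling n R).contDiff (n := ∞)
  have hr : 0 ≤ (R ^ 2)⁻¹ := by positivity
  have dφ := h.smooth_φ.smooth_differentiable
  have dψ := h.smooth_ψ.smooth_differentiable
  constructor
  · exact h.smooth_φ.comp hS
  · exact h.smooth_ψ.comp hS
  · exact h.cont_χ.comp hS.continuous
  · exact fun z => h.φ_nonneg _
  · exact fun z => h.ψ_nonneg _
  · exact fun z => h.χ_nonneg _
  · exact fun z hz => h.φ_off _ fun hz' => hz (hK' z hz')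
  · exact fun z hz => h.ψ_off _ fun hz' => hz (hK' z hz')
  · exact fun z => h.sq_ψ _
  · intro z
    rw [gradSq_comp_parabolicScaling dφ]
    have := mul_le_mul_of_nonneg_left (h.grad_φ (parabolicScaling n R z)) hr
    linarith
  · intro z
    rw [dT_comp_parabolicScaling dφ, abs_mul, abs_of_nonneg hr]
    have := mul_le_mul_of_nonneg_left (h.time_φ (parabolicScaling n R z)) hr
    linarith
  · intro z
    rw [lap_comp_parabolicScaling h.smooth_φ, abs_mul, abs_of_nonneg hr]
    have := mul_le_mul_of_nonneg_left (h.lap_φ (parabolicScaling n R z)) hr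
    linarith
  · intro z
    rw [gradSq_comp_parabolicScaling dψ]
    have := mul_le_mul_of_nonneg_left (h.grad_ψ (parabolicScaling n R z)) hr
    linarith
  · intro z
    rw [dT_comp_parabolicScaling dψ, abs_mul, abs_of_nonneg hr]
    have := mul_le_mul_of_nonneg_left (h.time_ψ (parabolicScaling n R z)) hr
    linarith

/-- Parabolic cut-offs at scale `R`: the constants do not depend on `R`, and the mass of the
cut-off is at most that of a parabolic cylinder, `R ^ (n + 2)`. -/
theorem exists_parabolic_cutoff (n k : ℕ) : ∃ c V : ℝ, 0 ≤ c ∧ 0 ≤ V ∧ ∀ R : ℝ, 1 ≤ R →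
    ∃ (K : Set (SpaceTime n)) (η : SpaceTime n → ℝ), IsCompact K ∧ Continuous η ∧
      (∀ z, 0 ≤ η z) ∧ (∀ z, η z ≤ 1) ∧ (∀ z ∉ K, η z = 0) ∧ (∀ z, ‖z‖ ≤ R → η z = 1) ∧
      CutoffWeights K c (R ^ 2)⁻¹ (fun z => η z ^ (k + 4)) (fun z => η z ^ (k + 2))
        (fun z => η z ^ k) ∧ ∫ z, η z ≤ V * R ^ (n + 2) := by
  let θ : ContDiffBump (0 : SpaceTime n) := ⟨1, 2, one_pos, one_lt_two⟩
  have hoff : ∀ z ∉ Metric.closedBall (0 : SpaceTime n) 2, θ z = 0 := fun z hz =>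
    θ.zero_of_le_dist (not_le.1 hz).le
  obtain ⟨c, hc, hw⟩ := exists_cutoffWeights_pow (isCompact_closedBall 0 2) θ.contDiff
    (fun z => θ.nonneg) (fun z => θ.le_one) hoff k
  set w₁ : ℝ := (volume : Measure (EuclideanSpace ℝ (Fin n))).real (Metric.ball 0 1) with hw₁
  refine ⟨c, 2 ^ n * w₁ * 4, hc, by positivity, fun R hR => ?_⟩
  have hR0 : 0 < R := by linarith
  set K : Set (SpaceTime n) := Metric.closedBall (0 : EuclideanSpace ℝ (Fin n)) (2 * R) ×ˢ
    Metric.closedBall (0 : ℝ) (2 * R ^ 2) with hK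
  have hKc : IsCompact K := (isCompact_closedBall _ _).prod (isCompact_closedBall _ _)
  have hnorm : ∀ z : SpaceTime n, ‖parabolicScaling n R z‖ = max (R⁻¹ * ‖z.1‖) ((R ^ 2)⁻¹ * |z.2|) := by
    intro z
    rw [parabolicScaling_apply, Prod.norm_mk, norm_smul, norm_mul, Real.norm_eq_abs,
      Real.norm_eq_abs, Real.norm_eq_abs, abs_of_pos (by positivity : 0 < R⁻¹),
      abs_of_pos (by positivity : 0 < (R ^ 2)⁻¹)]
  have hSK : ∀ z, parabolicScaling n R z ∈ Metric.closedBall (0 : SpaceTime n) 2 → z ∈ K := by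
    intro z hz
    rw [mem_closedBall_zero_iff, hnorm, max_le_iff, inv_mul_le_iff₀ hR0,
      inv_mul_le_iff₀ (by positivity)] at hz
    rw [hK, mem_prod, mem_closedBall_zero_iff, mem_closedBall_zero_iff]
    exact ⟨by linarith [hz.1], by rw [Real.norm_eq_abs]; linarith [hz.2]⟩
  have hη0 : ∀ z ∉ K, θ (parabolicScaling n R z) = 0 := fun z hz =>
    hoff _ fun h => hz (hSK z h)
  have hηc : Continuous fun z => θ (parabolicScaling n R z) :=
    θ.continuous.comp (parabolicScaling n R).continuous
  refine ⟨K, fun z => θ (parabolicScaling n R z), hKc, hηc, fun z => θ.nonneg, fun z => θ.le_one,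
    hη0, fun z hz => ?_, hw.comp_parabolicScaling hSK, ?_⟩
  · refine θ.one_of_mem_closedBall ?_
    change _ ∈ Metric.closedBall (0 : SpaceTime n) 1
    rw [mem_closedBall_zero_iff, hnorm, max_le_iff, inv_mul_le_iff₀ hR0,
      inv_mul_le_iff₀ (by positivity)]
    have h1 : ‖z.1‖ ≤ R := (norm_fst_le z).trans hz
    have h2 : |z.2| ≤ R := (norm_snd_le z).trans hz
    exact ⟨by linarith, by nlinarith⟩
  · have hvol : (volume : Measure (SpaceTime n)).real K = 2 ^ n * w₁ * 4 * R ^ (n + 2) := by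
      rw [hK, Measure.volume_eq_prod, measureReal_prod_prod,
        Measure.addHaar_real_closedBall _ _ (by positivity), finrank_euclideanSpace_fin,
        Real.volume_real_closedBall (by positivity), ← hw₁]
      ring
    rw [← hvol]
    have hi : ∫ z, θ (parabolicScaling n R z) = ∫ z in K, θ (parabolicScaling n R z) :=
      (setIntegral_eq_integral_of_forall_compl_eq_zero hη0).symm
    rw [hi]
    have := setIntegral_mono_on (μ := (volume : Measure (SpaceTime n))) (s := K)
      (f := fun z => θ (parabolicScaling n R z)) (g := fun _ => (1 : ℝ))
      (hηc.continuousOn.integrableOn_compact hKc) (by simpa using hKc.measure_lt_top)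
      hKc.measurableSet (fun z _ => θ.le_one)
    simpa using this

end Cutoff

/-! ### Growth of the nonlinearity -/

section Growth

/-- A function whose increments over fixed steps tend to zero at infinity grows at most linearly,
with arbitrarily small slope. Baire's theorem gives a bound on the increments which is uniform for
steps in some interval; steps of a fixed length then contribute the slope. -/
theorem exists_increment_bound {h : ℝ → ℝ} (hc : Continuous h)
    (hlim : ∀ y, Tendsto (fun x => h (x + y) - h x) atTop (𝓝 0)) {ε : ℝ} (hε : 0 < ε) :
    ∃ X C : ℝ, ∀ x y, X ≤ x → x ≤ y → |h y - h x| ≤ ε * (y - x) + C := by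
  let E : ℕ → Set ℝ := fun k => {y | ∀ x : ℝ, (k : ℝ) ≤ x → |h (x + y) - h x| ≤ 1}
  have hE : ∀ k, IsClosed (E k) := by
    intro k
    have : E k = ⋂ x : ℝ, ⋂ _ : (k : ℝ) ≤ x, {y | |h (x + y) - h x| ≤ 1} := by
      ext y; simp [E]
    rw [this]
    exact isClosed_iInter fun x => isClosed_iInter fun _ =>
      isClosed_le (by fun_prop) continuous_const
  have hU : ⋃ k, E k = univ := by
    refine eq_univ_of_forall fun y => ?_
    have h1 : ∀ᶠ x in atTop, |h (x + y) - h x| ≤ 1 := by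
      have := (hlim y).abs
      rw [abs_zero] at this
      exact this.eventually_le_const one_pos
    obtain ⟨X, hX⟩ := eventually_atTop.1 h1
    obtain ⟨k, hk⟩ := exists_nat_ge X
    exact mem_iUnion.2 ⟨k, fun x hx => hX x (hk.trans hx)⟩
  obtain ⟨k, b, hb⟩ := nonempty_interior_of_iUnion_of_closed hE hU
  obtain ⟨d, hd, hball⟩ := Metric.mem_nhds_iff.1 (mem_interior_iff_mem_nhds.1 hb)
  set δ := d / 2 with hδ
  have hδ0 : 0 < δ := by positivity
  have hshort : ∀ x s : ℝ, (k : ℝ) + b ≤ x → 0 ≤ s → s ≤ δ → |h (x + s) - h x| ≤ 2 := by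
    intro x s hx hs hsδ
    have h1 := hball (show b ∈ Metric.ball b d from Metric.mem_ball_self hd) (x - b) (by linarith)
    have h2 := hball (show b + s ∈ Metric.ball b d by
      rw [Metric.mem_ball, Real.dist_eq, add_sub_cancel_left, abs_of_nonneg hs]; linarith)
      (x - b) (by linarith)
    rw [show x - b + b = x by ring] at h1
    rw [show x - b + (b + s) = x + s by ring] at h2
    rw [abs_le] at *
    constructor <;> linarith [h1.1, h1.2, h2.1, h2.2]
  have hstep : ∀ᶠ x in atTop, |h (x + δ) - h x| ≤ ε * δ := by
    have := (hlim δ).abs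
    rw [abs_zero] at this
    exact this.eventually_le_const (by positivity)
  obtain ⟨X, hX⟩ := eventually_atTop.1 hstep
  have hsteps : ∀ (j : ℕ) (x : ℝ), X ≤ x → |h (x + j * δ) - h x| ≤ j * (ε * δ) := by
    intro j x hx
    induction j with
    | zero => simp
    | succ j ih =>
      have h1 := hX (x + j * δ) (by have : 0 ≤ (j : ℝ) * δ := by positivity
                                    linarith)
      have e : x + ((j + 1 : ℕ) : ℝ) * δ = x + j * δ + δ := by push_cast; ring
      rw [e]
      calc |h (x + j * δ + δ) - h x|
          = |(h (x + j * δ + δ) - h (x + j * δ)) + (h (x + j * δ) - h x)| := by ring_nf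
        _ ≤ ε * δ + j * (ε * δ) := (abs_add_le _ _).trans (add_le_add h1 ih)
        _ = _ := by push_cast; ring
  refine ⟨max X (k + b), 2, fun x y hx hxy => ?_⟩
  set j := ⌊(y - x) / δ⌋₊ with hj
  have hq : 0 ≤ (y - x) / δ := div_nonneg (by linarith) hδ0.le
  have hj1 : (j : ℝ) * δ ≤ y - x := by
    have := Nat.floor_le hq
    rwa [le_div_iff₀ hδ0] at this
  have hj2 : y - x ≤ j * δ + δ := by
    have := (Nat.lt_floor_add_one ((y - x) / δ)).le
    rw [div_le_iff₀ hδ0] at this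
    linarith
  have hj0 : 0 ≤ (j : ℝ) * δ := by positivity
  have h1 := hsteps j x ((le_max_left _ _).trans hx)
  have h2 := hshort (x + j * δ) (y - (x + j * δ))
    (by linarith [(le_max_right X ((k : ℝ) + b)).trans hx]) (by linarith) (by linarith)
  rw [add_sub_cancel] at h2
  calc |h y - h x| = |(h y - h (x + j * δ)) + (h (x + j * δ) - h x)| := by ring_nf
    _ ≤ 2 + j * (ε * δ) := (abs_add_le _ _).trans (add_le_add h2 h1)
    _ ≤ _ := by nlinarith

/-- Potter's bound for a regularly varying function, in logarithmic coordinates. The sign `σ`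
selects the end: `σ = 1` for infinity, `σ = -1` for zero. -/
theorem RegularVariation.exists_log_bound {f : ℝ → ℝ} {m σ : ℝ} {l : Filter ℝ}
    (hreg : RegularVariation f m l) (hl : Tendsto (fun x => Real.exp (σ * x)) atTop l)
    (hf : ContinuousOn f (Ioi 0)) (hfpos : ∀ s, 0 < s → 0 < f s) {ε : ℝ} (hε : 0 < ε) :
    ∃ X C : ℝ, ∀ x y, X ≤ x → x ≤ y →
      |(Real.log (f (Real.exp (σ * y))) - m * (σ * y))
        - (Real.log (f (Real.exp (σ * x))) - m * (σ * x))| ≤ ε * (y - x) + C := by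
  have hfe : ∀ x, 0 < f (Real.exp x) := fun x => hfpos _ (Real.exp_pos x)
  refine exists_increment_bound (h := fun x => Real.log (f (Real.exp (σ * x))) - m * (σ * x))
    ?_ (fun y => ?_) hε
  · have : Continuous fun x => f (Real.exp (σ * x)) :=
      hf.comp_continuous (by fun_prop) fun x => Real.exp_pos _
    exact (this.log fun x => (hfe _).ne').sub (by fun_prop)
  · have h1 := (hreg (Real.exp (σ * y)) (Real.exp_pos _)).comp hl
    have h2 := ((Real.continuousAt_log one_ne_zero).tendsto.comp h1)
    rw [Real.log_one] at h2
    refine h2.congr fun x => ?_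
    have hp : ∀ t : ℝ, Real.exp t ^ (-m) = Real.exp (-(m * t)) := fun t => by
      rw [← Real.exp_mul]; ring_nf
    simp only [Function.comp]
    rw [← Real.exp_add, ← mul_add, hp, hp,
      Real.log_div (mul_pos (Real.exp_pos _) (hfe _)).ne' (mul_pos (Real.exp_pos _) (hfe _)).ne',
      Real.log_mul (Real.exp_pos _).ne' (hfe _).ne', Real.log_mul (Real.exp_pos _).ne' (hfe _).ne',
      Real.log_exp, Real.log_exp]
    ring

/-- A function varying regularly at infinity with index greater than `1` is nondecreasing there up
to a constant, and superlinear. -/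
theorem RegularVariationAtInfty.exists_bounds {f : ℝ → ℝ} {m : ℝ} (hm : 1 < m)
    (hreg : RegularVariationAtInfty f m) (hf : ContinuousOn f (Ioi 0))
    (hfpos : ∀ s, 0 < s → 0 < f s) :
    (∃ S C : ℝ, 0 < S ∧ ∀ τ s, S ≤ τ → τ ≤ s → f τ ≤ C * f s) ∧
      ∃ S c q : ℝ, 0 < S ∧ 0 < c ∧ 1 < q ∧ ∀ s, S ≤ s → c * s ^ q ≤ f s := by
  obtain ⟨X, C, hXC⟩ := RegularVariation.exists_log_bound (σ := 1) hreg
    (by simpa using Real.tendsto_exp_atTop) hf hfpos (ε := (m - 1) / 2) (by linarith)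
  set q := m - (m - 1) / 2 with hq
  have key : ∀ τ s : ℝ, Real.exp X ≤ τ → τ ≤ s →
      q * (Real.log s - Real.log τ) - C ≤ Real.log (f s) - Real.log (f τ) := by
    intro τ s hτ hs
    have hτ0 : 0 < τ := (Real.exp_pos X).trans_le hτ
    have hs0 := hτ0.trans_le hs
    have h1 := hXC (Real.log τ) (Real.log s) ((Real.le_log_iff_exp_le hτ0).2 hτ)
      (Real.log_le_log hτ0 hs)
    rw [one_mul, one_mul, Real.exp_log hτ0, Real.exp_log hs0] at h1
    have h2 := (abs_le.1 h1).1
    rw [hq]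
    linarith
  refine ⟨⟨Real.exp X, Real.exp C, Real.exp_pos X, fun τ s hτ hs => ?_⟩,
    Real.exp X, Real.exp (Real.log (f (Real.exp X)) - C - q * X), q, Real.exp_pos X,
    Real.exp_pos _, by rw [hq]; linarith, fun s hs => ?_⟩
  · have hτ0 : 0 < τ := (Real.exp_pos X).trans_le hτ
    have hs0 := hτ0.trans_le hs
    have h1 := key τ s hτ hs
    have h2 : 0 ≤ q * (Real.log s - Real.log τ) :=
      mul_nonneg (by rw [hq]; linarith) (sub_nonneg.2 (Real.log_le_log hτ0 hs))
    rw [← Real.exp_log (hfpos τ hτ0), ← Real.exp_log (hfpos s hs0), ← Real.exp_add]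
    exact Real.exp_le_exp.2 (by linarith)
  · have hs0 := (Real.exp_pos X).trans_le hs
    have h1 := key _ s le_rfl hs
    rw [Real.log_exp] at h1
    rw [← Real.exp_log (hfpos s hs0), Real.rpow_def_of_pos hs0, ← Real.exp_add]
    exact Real.exp_le_exp.2 (by linarith)

/-- A function varying regularly at `0` with index greater than `1` is nondecreasing near `0` up to a
constant. -/
theorem RegularVariationAtZero.exists_bound {f : ℝ → ℝ} {m : ℝ} (hm : 1 < m)
    (hreg : RegularVariationAtZero f m) (hf : ContinuousOn f (Ioi 0))
    (hfpos : ∀ s, 0 < s → 0 < f s) :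
    ∃ δ C : ℝ, 0 < δ ∧ ∀ τ s, 0 < τ → τ ≤ s → s ≤ δ → f τ ≤ C * f s := by
  have hl : Tendsto (fun x : ℝ => Real.exp (-1 * x)) atTop (𝓝[>] 0) := by
    simp only [neg_one_mul]
    exact Real.tendsto_exp_atBot_nhdsGT.comp tendsto_neg_atTop_atBot
  obtain ⟨X, C, hXC⟩ := RegularVariation.exists_log_bound hreg hl hf hfpos (ε := 1) one_pos
  refine ⟨Real.exp (-X), Real.exp C, Real.exp_pos _, fun τ s hτ hs hsδ => ?_⟩
  have hs0 := hτ.trans_le hs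
  have hlog := Real.log_le_log hτ hs
  have h1 := hXC (-Real.log s) (-Real.log τ)
    (by have := (Real.log_le_iff_le_exp hs0).2 hsδ; linarith) (by linarith)
  rw [neg_one_mul, neg_one_mul, neg_neg, neg_neg, Real.exp_log hτ, Real.exp_log hs0] at h1
  have h2 := (abs_le.1 h1).2
  have h3 : 0 ≤ (m - 1) * (Real.log s - Real.log τ) :=
    mul_nonneg (by linarith) (sub_nonneg.2 hlog)
  rw [← Real.exp_log (hfpos τ hτ), ← Real.exp_log (hfpos s hs0), ← Real.exp_add]
  exact Real.exp_le_exp.2 (by linarith)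

/-- A positive continuous function which is nondecreasing up to a constant near `0` and near `∞`
is so on the whole half-line. -/
theorem exists_almost_monotone {f : ℝ → ℝ} (hf : ContinuousOn f (Ioi 0))
    (hfpos : ∀ s, 0 < s → 0 < f s)
    (h0 : ∃ δ C : ℝ, 0 < δ ∧ ∀ τ s, 0 < τ → τ ≤ s → s ≤ δ → f τ ≤ C * f s)
    (h1 : ∃ S C : ℝ, 0 < S ∧ ∀ τ s, S ≤ τ → τ ≤ s → f τ ≤ C * f s) :
    ∃ C : ℝ, 0 ≤ C ∧ ∀ τ s, 0 < τ → τ ≤ s → f τ ≤ C * f s := by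
  obtain ⟨δ, C₀, hδ, h0⟩ := h0
  obtain ⟨S, C₁, hS, h1⟩ := h1
  have one_le : ∀ s C : ℝ, 0 < s → f s ≤ C * f s → 1 ≤ C := fun s C hs h => by
    by_contra! hC
    nlinarith [hfpos s hs]
  have hC₀ := one_le δ C₀ hδ (h0 δ δ hδ le_rfl le_rfl)
  have hC₁ := one_le S C₁ hS (h1 S S le_rfl le_rfl)
  set S' := max S δ with hS'
  have hδS : δ ≤ S' := le_max_right _ _
  have hc : ContinuousOn f (Icc δ S') := hf.mono fun x hx => hδ.trans_le hx.1
  obtain ⟨xm, hxm, hmin⟩ := isCompact_Icc.exists_isMinOn (nonempty_Icc.2 hδS) hc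
  obtain ⟨xM, hxM, hmax⟩ := isCompact_Icc.exists_isMaxOn (nonempty_Icc.2 hδS) hc
  set b := f xm with hb
  set B := f xM with hB
  have hb0 : 0 < b := hfpos _ (hδ.trans_le hxm.1)
  have hB0 : 0 < B := hfpos _ (hδ.trans_le hxM.1)
  have up : ∀ τ, 0 < τ → τ ≤ S' → f τ ≤ C₀ * B := by
    intro τ hτ hτS
    rcases le_total τ δ with h | h
    · exact (h0 τ δ hτ h le_rfl).trans
        (mul_le_mul_of_nonneg_left (hmax ⟨le_rfl, hδS⟩) (by linarith))
    · have : f τ ≤ B := hmax ⟨h, hτS⟩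
      nlinarith
  have low : ∀ s, δ ≤ s → b ≤ C₁ * f s := by
    intro s hs
    have hs0 := hfpos s (hδ.trans_le hs)
    rcases le_total s S' with h | h
    · have : b ≤ f s := hmin ⟨hs, h⟩
      nlinarith
    · have h2 : b ≤ f S' := hmin ⟨hδS, le_rfl⟩
      exact h2.trans (h1 S' s (le_max_left _ _) h)
  have hA : 0 ≤ C₀ * B / b * C₁ := by positivity
  refine ⟨C₀ + C₁ + C₀ * B / b * C₁, by positivity, fun τ s hτ hs => ?_⟩
  have hfs := hfpos s (hτ.trans_le hs)
  have z0 : 0 ≤ C₀ * f s := by positivity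
  have z1 : 0 ≤ C₁ * f s := by positivity
  have z2 : 0 ≤ C₀ * B / b * C₁ * f s := by positivity
  rcases lt_or_ge s δ with h | h
  · linarith [h0 τ s hτ hs h.le]
  rcases lt_or_ge S' τ with h' | h'
  · linarith [h1 τ s ((le_max_left _ _).trans h'.le) hs]
  have h2 : C₀ * B ≤ C₀ * B / b * C₁ * f s := by
    calc C₀ * B = C₀ * B / b * b := by field_simp
      _ ≤ C₀ * B / b * (C₁ * f s) := mul_le_mul_of_nonneg_left (low s h) (by positivity)
      _ = _ := by ring
  linarith [up τ hτ h']

/-- A lower bound by a power near infinity extends, with a smaller constant, to `[1, ∞)`. -/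
theorem exists_rpow_le {f : ℝ → ℝ} (hf : ContinuousOn f (Ioi 0))
    (hfpos : ∀ s, 0 < s → 0 < f s) {S c q : ℝ} (hc : 0 < c) (hq : 0 ≤ q)
    (h : ∀ s, S ≤ s → c * s ^ q ≤ f s) :
    ∃ c' : ℝ, 0 < c' ∧ ∀ s, 1 ≤ s → c' * s ^ q ≤ f s := by
  set S' := max S 1 with hS'
  have h1S : 1 ≤ S' := le_max_right _ _
  obtain ⟨xm, hxm, hmin⟩ := isCompact_Icc.exists_isMinOn (nonempty_Icc.2 h1S)
    (hf.mono fun x (hx : x ∈ Icc 1 S') => one_pos.trans_le hx.1)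
  have hb0 : 0 < f xm := hfpos _ (one_pos.trans_le hxm.1)
  have hSq : 0 < S' ^ q := Real.rpow_pos_of_pos (by linarith) q
  refine ⟨min c (f xm / S' ^ q), lt_min hc (by positivity), fun s hs => ?_⟩
  have hsq : 0 ≤ s ^ q := Real.rpow_nonneg (by linarith) q
  rcases le_total s S' with h' | h'
  · calc min c (f xm / S' ^ q) * s ^ q ≤ f xm / S' ^ q * S' ^ q :=
        mul_le_mul (min_le_right _ _) (Real.rpow_le_rpow (by linarith) h' hq) hsq (by positivity)
      _ = f xm := by field_simp
      _ ≤ f s := hmin ⟨hs, h'⟩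
  · exact (mul_le_mul_of_nonneg_right (min_le_left _ _) hsq).trans
      (h s ((le_max_left _ _).trans h'))

/-- Where `f(s) ≥ c sᵠ` with `q > 1`, the term `R⁻⁴ ηᵏ s²` is absorbed by `R⁻² ηᵏ⁺² s f(s)` up to
`R ^ (-4q/(q-1))`: compare `sᵠ⁻¹` with `(R η)⁻²`. -/
theorem exists_absorption_of_rpow_le {f : ℝ → ℝ} {c q : ℝ} (hc : 0 < c) (hq : 1 < q) {k : ℕ}
    (hk : 1 + 4 / (q - 1) ≤ k) {κ : ℝ} (hκ : 0 < κ) :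
    ∃ C : ℝ, 0 ≤ C ∧ ∀ R η s : ℝ, 1 ≤ R → 0 ≤ η → η ≤ 1 → 0 < s → c * s ^ q ≤ f s →
      ((R ^ 2)⁻¹) ^ 2 * η ^ k * s ^ 2 ≤ κ * ((R ^ 2)⁻¹ * η ^ (k + 2) * (s * f s))
        + C * (R ^ (-(4 + 4 / (q - 1))) * η) := by
  have hq1 : 0 < q - 1 := by linarith
  set β := 4 / (q - 1) with hβ
  have hβ0 : 0 < β := by positivity
  refine ⟨(κ * c)⁻¹ ^ (2 / (q - 1)), by positivity, ?_⟩
  intro R η s hR hη hη1 hs hfs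
  have hR0 : 0 < R := by linarith
  have hf0 : 0 ≤ f s := le_trans (by positivity) hfs
  rcases hη.eq_or_lt with rfl | hη0
  · have hk0 : k ≠ 0 := by
      rintro rfl
      norm_num at hk
      linarith
    simp [hk0]
  have hsq : s * s ^ q = s ^ 2 * s ^ (q - 1) := by
    rw [Real.rpow_sub_one hs.ne']; field_simp
  rcases le_or_gt ((R ^ 2)⁻¹) (κ * c * s ^ (q - 1) * η ^ 2) with h | h
  · have h1 : ((R ^ 2)⁻¹) ^ 2 * η ^ k * s ^ 2 ≤ κ * ((R ^ 2)⁻¹ * η ^ (k + 2) * (s * f s)) := by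
      calc ((R ^ 2)⁻¹) ^ 2 * η ^ k * s ^ 2 = (R ^ 2)⁻¹ * ((R ^ 2)⁻¹ * η ^ k * s ^ 2) := by ring
        _ ≤ (κ * c * s ^ (q - 1) * η ^ 2) * ((R ^ 2)⁻¹ * η ^ k * s ^ 2) := by gcongr
        _ = κ * ((R ^ 2)⁻¹ * η ^ (k + 2) * (c * (s ^ 2 * s ^ (q - 1)))) := by ring
        _ = κ * ((R ^ 2)⁻¹ * η ^ (k + 2) * (s * (c * s ^ q))) := by rw [← hsq]; ring
        _ ≤ _ := by gcongr
    have h2 : 0 ≤ (κ * c)⁻¹ ^ (2 / (q - 1)) * (R ^ (-(4 + β)) * η) := by positivity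
    linarith
  · have h1 : s ^ (q - 1) ≤ (κ * c)⁻¹ * ((R * η) ^ 2)⁻¹ := by
      rw [← mul_inv, ← one_div, le_div_iff₀ (by positivity)]
      have := mul_le_mul_of_nonneg_right h.le (by positivity : 0 ≤ R ^ 2)
      rw [inv_mul_cancel₀ (by positivity)] at this
      linarith
    have h2 : s ^ 2 ≤ (κ * c)⁻¹ ^ (2 / (q - 1)) * (R * η) ^ (-β) := by
      have h3 := Real.rpow_le_rpow (by positivity) h1 (by positivity : 0 ≤ 2 / (q - 1))
      rw [← Real.rpow_mul hs.le, Real.mul_rpow (by positivity) (by positivity)] at h3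
      have e1 : (q - 1) * (2 / (q - 1)) = (2 : ℕ) := by field_simp; norm_num
      have e2 : (((R * η) ^ 2)⁻¹) ^ (2 / (q - 1)) = (R * η) ^ (-β) := by
        rw [← Real.rpow_natCast, ← Real.rpow_neg (by positivity), ← Real.rpow_mul (by positivity)]
        congr 1
        rw [hβ]; push_cast; ring
      rw [e1, Real.rpow_natCast, e2] at h3
      exact h3
    have h4 : ((R ^ 2)⁻¹) ^ 2 * η ^ k * s ^ 2 ≤
        (κ * c)⁻¹ ^ (2 / (q - 1)) * (R ^ (-(4 + β)) * η) := by
      have hηk : η ^ k * η ^ (-β) ≤ η := by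
        rw [← Real.rpow_natCast, ← Real.rpow_add hη0]
        calc η ^ ((k : ℝ) + -β) ≤ η ^ (1 : ℝ) :=
            Real.rpow_le_rpow_of_exponent_ge hη0 hη1 (by linarith)
          _ = η := Real.rpow_one η
      have hRe : ((R ^ 2)⁻¹) ^ 2 * R ^ (-β) = R ^ (-(4 + β)) := by
        rw [neg_add, Real.rpow_add hR0, Real.rpow_neg hR0.le 4]
        norm_num [← pow_mul]
      calc ((R ^ 2)⁻¹) ^ 2 * η ^ k * s ^ 2
          ≤ ((R ^ 2)⁻¹) ^ 2 * η ^ k * ((κ * c)⁻¹ ^ (2 / (q - 1)) * (R * η) ^ (-β)) := by gcongr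
        _ = (κ * c)⁻¹ ^ (2 / (q - 1)) * ((((R ^ 2)⁻¹) ^ 2 * R ^ (-β)) * (η ^ k * η ^ (-β))) := by
            rw [Real.mul_rpow hR0.le hη]; ring
        _ ≤ _ := by rw [hRe]; gcongr
    have h5 : 0 ≤ κ * ((R ^ 2)⁻¹ * η ^ (k + 2) * (s * f s)) := by positivity
    linarith

end Growth

/-! ### Decay of the energy as the cut-off grows -/

section Decay

/-- The lower-order term is absorbed with a remainder decaying faster than the volume
`R ^ (n + 2)` of parabolic cylinders grows. For `n = 1` small values of `s` are harmless because
`R ^ (n + 2 - 4)` already decays; for `n ≥ 2` they are handled by `f(s) ≥ f(1) s ^ p`, and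
`4 p / (p - 1) > n + 2` since `p < pB n`. -/
theorem exists_growth_absorption {n : ℕ} (hn : 1 ≤ n) {f : ℝ → ℝ}
    (hfpos : ∀ s, 0 < s → 0 < f s) {c q : ℝ} (hc : 0 < c) (hq : 1 < q)
    (hfq : ∀ s, 1 ≤ s → c * s ^ q ≤ f s)
    (hsub : n = 1 ∨ ∃ p : ℝ, 1 < p ∧ p < pB n ∧ AntitoneOn (fun s : ℝ => f s / s ^ p) (Ioi 0)) :
    ∃ (k : ℕ) (α : ℝ), (n : ℝ) + 2 < α ∧ ∀ κ, 0 < κ → ∃ C : ℝ, 0 ≤ C ∧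
      ∀ R η s : ℝ, 1 ≤ R → 0 ≤ η → η ≤ 1 → 0 < s →
        ((R ^ 2)⁻¹) ^ 2 * η ^ k * s ^ 2 ≤ κ * ((R ^ 2)⁻¹ * η ^ (k + 2) * (s * f s))
          + C * (R ^ (-α) * η) := by
  rcases Nat.eq_or_lt_of_le hn with h1 | h2
  · obtain ⟨k, hk⟩ := exists_nat_ge (1 + 4 / (q - 1))
    have hβ : 0 < 4 / (q - 1) := div_pos (by norm_num) (by linarith)
    refine ⟨k, 4, by rw [← h1]; norm_num, fun κ hκ => ?_⟩
    obtain ⟨C, hC, hCb⟩ := exists_absorption_of_rpow_le (f := f) hc hq hk hκ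
    refine ⟨C + 1, by positivity, fun R η s hR hη hη1 hs => ?_⟩
    have hR0 : 0 < R := by linarith
    rcases le_total 1 s with h | h
    · refine (hCb R η s hR hη hη1 hs (hfq s h)).trans (add_le_add le_rfl ?_)
      have : R ^ (-(4 + 4 / (q - 1))) ≤ R ^ (-4 : ℝ) :=
        Real.rpow_le_rpow_of_exponent_le hR (by linarith)
      gcongr
      linarith
    · have hk1 : 1 ≤ k := by
        have : (1 : ℝ) ≤ k := by linarith
        exact_mod_cast this
      have e : ((R ^ 2)⁻¹) ^ 2 = R ^ (-4 : ℝ) := by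
        rw [Real.rpow_neg hR0.le]; norm_num [← pow_mul]
      have p0 : 0 ≤ κ * ((R ^ 2)⁻¹ * η ^ (k + 2) * (s * f s)) := by
        have := (hfpos s hs).le
        positivity
      have p1 : 0 ≤ C * (R ^ (-4 : ℝ) * η) := by positivity
      have p2 : ((R ^ 2)⁻¹) ^ 2 * η ^ k * s ^ 2 ≤ R ^ (-4 : ℝ) * η * 1 := by
        rw [e]
        have a1 : η ^ k ≤ η := pow_le_of_le_one hη hη1 (by omega)
        have a2 : s ^ 2 ≤ 1 := pow_le_one₀ hs.le h
        exact mul_le_mul (mul_le_mul_of_nonneg_left a1 (by positivity)) a2 (by positivity)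
          (by positivity)
      linarith
  · obtain ⟨p, hp1, hpB, hanti⟩ := hsub.resolve_left (by omega)
    have hn2 : (2 : ℝ) ≤ n := by exact_mod_cast h2
    set q' := min p q with hq'
    have hq'1 : 1 < q' := lt_min hp1 hq
    have hβ : 4 / (p - 1) ≤ 4 / (q' - 1) :=
      div_le_div_of_nonneg_left (by norm_num) (by linarith) (by linarith [min_le_left p q])
    have hβ0 : 0 < 4 / (p - 1) := div_pos (by norm_num) (by linarith)
    have hα : (n : ℝ) + 2 < 4 + 4 / (p - 1) := by
      rw [pB, lt_div_iff₀ (by nlinarith)] at hpB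
      have h3 : p * (n - 2) < n + 2 := by
        by_contra! hcon
        have h4 : 0 ≤ (n : ℝ) - 2 := by linarith
        nlinarith [mul_le_mul_of_nonneg_left hcon (sq_nonneg ((n : ℝ) - 1)),
          mul_le_mul_of_nonneg_right hpB.le h4]
      have h5 : (n : ℝ) + 2 - 4 < 4 / (p - 1) := by
        rw [lt_div_iff₀ (by linarith)]
        nlinarith
      linarith
    obtain ⟨k, hk⟩ := exists_nat_ge (1 + 4 / (q' - 1))
    refine ⟨k, 4 + 4 / (p - 1), hα, fun κ hκ => ?_⟩
    obtain ⟨C₁, hC₁, hb₁⟩ := exists_absorption_of_rpow_le (f := f) (hfpos 1 one_pos) hp1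
      (by linarith : 1 + 4 / (p - 1) ≤ (k : ℝ)) hκ
    obtain ⟨C₂, hC₂, hb₂⟩ := exists_absorption_of_rpow_le (f := f) hc hq'1 hk hκ
    refine ⟨C₁ + C₂, by positivity, fun R η s hR hη hη1 hs => ?_⟩
    have hR0 : 0 < R := by linarith
    rcases le_total 1 s with h | h
    · have hs' : c * s ^ q' ≤ f s := (mul_le_mul_of_nonneg_left
        (Real.rpow_le_rpow_of_exponent_le h (min_le_right _ _)) hc.le).trans (hfq s h)
      refine (hb₂ R η s hR hη hη1 hs hs').trans (add_le_add le_rfl ?_)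
      have : R ^ (-(4 + 4 / (q' - 1))) ≤ R ^ (-(4 + 4 / (p - 1))) :=
        Real.rpow_le_rpow_of_exponent_le hR (by linarith)
      gcongr
      linarith
    · have hs' : f 1 * s ^ p ≤ f s := by
        have := hanti (show s ∈ Ioi (0 : ℝ) from hs) (show (1 : ℝ) ∈ Ioi (0 : ℝ) from mem_Ioi.2 one_pos) h
        simp only [Real.one_rpow, div_one] at this
        rwa [le_div_iff₀ (Real.rpow_pos_of_pos hs p)] at this
      refine (hb₁ R η s hR hη hη1 hs hs').trans (add_le_add le_rfl ?_)
      gcongr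
      linarith

/-- The admissible coefficients `a` of `∂ᵢv ∂ⱼv / v` in the trace inequality: the interval for `a`
is nonempty exactly because `p < pB n`. -/
theorem exists_trace_coefficient {n : ℕ} (hn : 2 ≤ n) {p : ℝ} (hp : 1 < p) (hpB : p < pB n) :
    ∃ a : ℝ, 0 < a ∧ 0 < a - (1 - (n : ℝ)⁻¹) * a ^ 2 ∧
      0 < a * (1 + 2 * (n : ℝ)⁻¹) - p * (1 - (n : ℝ)⁻¹) := by
  have hn2 : (2 : ℝ) ≤ n := by exact_mod_cast hn
  have hn0 : (0 : ℝ) < n := by linarith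
  have hn1 : (0 : ℝ) < (n : ℝ) - 1 := by linarith
  have h1 : p * (n - 1) / (n + 2) < n / (n - 1) := by
    rw [pB, lt_div_iff₀ (by positivity)] at hpB
    rw [div_lt_div_iff₀ (by positivity) hn1]
    nlinarith
  obtain ⟨a, ha1, ha2⟩ := exists_between h1
  have ha0 : 0 < a := lt_trans (by positivity) ha1
  rw [div_lt_iff₀ (by positivity)] at ha1
  rw [lt_div_iff₀ hn1] at ha2
  refine ⟨a, ha0, ?_, ?_⟩
  · have e : a - (1 - (n : ℝ)⁻¹) * a ^ 2 = a * (n - a * (n - 1)) / n := by field_simp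
    rw [e]
    exact div_pos (mul_pos ha0 (by linarith)) hn0
  · have e : a * (1 + 2 * (n : ℝ)⁻¹) - p * (1 - (n : ℝ)⁻¹) = (a * (n + 2) - p * (n - 1)) / n := by
      field_simp
    rw [e]
    exact div_pos (by linarith) hn0

/-- The energy of a smooth positive `v` on a ball of radius `R` is at most a negative power of `R`,
plus a term measuring the defect of `v` in the equation. -/
theorem exists_energy_decay {n : ℕ} (hn : 1 ≤ n) {f : ℝ → ℝ} (hf : Continuous f)
    (hfpos : ∀ s, 0 < s → 0 < f s)
    (hsub : n = 1 ∨ ∃ p : ℝ, 1 < p ∧ p < pB n ∧ AntitoneOn (fun s : ℝ => f s / s ^ p) (Ioi 0))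
    (hmono : ∃ C : ℝ, 0 ≤ C ∧ ∀ τ s, 0 < τ → τ ≤ s → f τ ≤ C * f s)
    (hgrow : ∃ c q : ℝ, 0 < c ∧ 1 < q ∧ ∀ s, 1 ≤ s → c * s ^ q ≤ f s) :
    ∃ C κ₀ ϑ : ℝ, 0 ≤ C ∧ 0 < κ₀ ∧ 0 < ϑ ∧ ∀ R : ℝ, 1 ≤ R →
      ∃ (K : Set (SpaceTime n)) (φ : SpaceTime n → ℝ), IsCompact K ∧ Continuous φ ∧
        (∀ z, 0 ≤ φ z) ∧ (∀ z ∉ K, φ z = 0) ∧ (∀ z, ‖z‖ ≤ R → φ z = 1) ∧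
        ∀ v : SpaceTime n → ℝ, ContDiff ℝ ∞ v → (∀ z, 0 < v z) →
          ∫ z, (φ z * dT v z ^ 2 + κ₀ * (φ z * (gradSq v z / v z) ^ 2)) ≤
            C * (R ^ (-ϑ) + ∫ z, φ z * (defect f v z ^ 2 + f (v z) * |defect f v z|)) := by
  obtain ⟨c, q, hc, hq, hfq⟩ := hgrow
  obtain ⟨CF, hCF, hmono⟩ := hmono
  obtain ⟨k, α, hα, habs⟩ := exists_growth_absorption hn hfpos hc hq hfq hsub
  have hF : ∀ s, HasDerivAt (fun s => ∫ t in (0 : ℝ)..s, f t) (f s) s := fun s =>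
    intervalIntegral.integral_hasDerivAt_right (hf.intervalIntegrable _ _)
      hf.stronglyMeasurable.stronglyMeasurableAtFilter hf.continuousAt
  have hF0 : ∀ s, 0 < s → 0 ≤ ∫ t in (0 : ℝ)..s, f t := by
    intro s hs
    have : ∫ _t in (0 : ℝ)..s, (0 : ℝ) ≤ ∫ t in (0 : ℝ)..s, f t :=
      intervalIntegral.integral_mono_on_of_le_Ioo hs.le (by simp) (hf.intervalIntegrable _ _)
        fun t ht => (hfpos t ht.1).le
    simpa using this
  have hFle : ∀ s, 0 < s → ∫ t in (0 : ℝ)..s, f t ≤ CF * (s * f s) := by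
    intro s hs
    have : ∫ t in (0 : ℝ)..s, f t ≤ ∫ _t in (0 : ℝ)..s, CF * f s :=
      intervalIntegral.integral_mono_on_of_le_Ioo hs.le (hf.intervalIntegrable _ _) (by simp)
        fun t ht => hmono t s ht.1 ht.2.le
    refine this.trans (le_of_eq ?_)
    rw [intervalIntegral.integral_const, smul_eq_mul]
    ring
  obtain ⟨a, p, ha, hI, hM, hsub'⟩ : ∃ a p : ℝ, 0 < a ∧ 0 < a - (1 - (n : ℝ)⁻¹) * a ^ 2 ∧
      0 < a * (1 + 2 * (n : ℝ)⁻¹) - p * (1 - (n : ℝ)⁻¹) ∧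
      (n = 1 ∨ AntitoneOn (fun s : ℝ => f s / s ^ p) (Ioi 0)) := by
    rcases Nat.eq_or_lt_of_le hn with h1 | h2
    · exact ⟨1, 1, by norm_num, by rw [← h1]; norm_num, by rw [← h1]; norm_num, Or.inl h1.symm⟩
    · obtain ⟨p, hp1, hpB, hanti⟩ := hsub.resolve_left (by omega)
      obtain ⟨a, ha, hI, hM⟩ := exists_trace_coefficient h2 hp1 hpB
      exact ⟨a, p, ha, hI, hM, Or.inr hanti⟩
  choose! Cκ hCκ hCb using habs
  obtain ⟨c', V, hc', hV, hcut⟩ := exists_parabolic_cutoff n k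
  obtain ⟨C, κ₀, hC, hκ₀, hen⟩ := energy_estimate hf hfpos hF hF0 hCF hFle hn ha hI hM hsub' hc' hCκ
  refine ⟨C * (V + 1), κ₀, α - (n + 2), by positivity, hκ₀, by linarith, fun R hR => ?_⟩
  have hR0 : 0 < R := by linarith
  obtain ⟨K, η, hK, cη, hη0, hη1, hηoff, hηone, hw, hηint⟩ := hcut R hR
  refine ⟨K, fun z => η z ^ (k + 4), hK, cη.pow _, hw.φ_nonneg, hw.φ_off,
    fun z hz => by simp [hηone z hz], fun v hv hpos => ?_⟩
  have h1 := hen K (R ^ 2)⁻¹ _ _ _ (fun z => R ^ (-α) * η z) hK (by positivity) hw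
    (continuous_const.mul cη) (fun z => mul_nonneg (by positivity) (hη0 z))
    (fun z hz => by rw [hηoff z hz, mul_zero])
    (fun κ hκ z s hs => hCb κ hκ R (η z) s hR (hη0 z) (hη1 z) hs) v hv hpos
  refine h1.trans ?_
  have ce := continuous_defect hf hv
  have cfv : Continuous fun z => f (v z) := hf.comp hv.continuous
  have iη : Integrable fun z => R ^ (-α) * η z :=
    integrable_of_zero_off hK (continuous_const.mul cη) fun z hz => by rw [hηoff z hz, mul_zero]
  have iE : Integrable fun z => η z ^ (k + 4) * (defect f v z ^ 2 + f (v z) * |defect f v z|) :=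
    integrable_of_zero_off hK ((cη.pow _).mul ((ce.pow 2).add (cfv.mul ce.abs)))
      fun z hz => by simp [hηoff z hz]
  rw [integral_add iη iE, integral_const_mul, mul_assoc]
  refine mul_le_mul_of_nonneg_left ?_ hC
  set E := ∫ z, η z ^ (k + 4) * (defect f v z ^ 2 + f (v z) * |defect f v z|)
  have hE : 0 ≤ E := integral_nonneg fun z => by
    have := hη0 z
    have := (hfpos _ (hpos z)).le
    positivity
  have h2 : R ^ (-α) * ∫ z, η z ≤ V * R ^ (-(α - (n + 2))) := by
    calc R ^ (-α) * ∫ z, η z ≤ R ^ (-α) * (V * R ^ (n + 2)) := by gcongr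
      _ = V * (R ^ (-α) * R ^ ((n + 2 : ℕ) : ℝ)) := by rw [Real.rpow_natCast]; ring
      _ = V * R ^ (-(α - (n + 2))) := by
        rw [← Real.rpow_add hR0]
        congr 2
        push_cast
        ring
  have h3 : 0 ≤ R ^ (-(α - (n + 2) : ℝ)) := by positivity
  nlinarith [mul_nonneg hV hE]

end Decay

/-! ### Mollification of continuous distributional solutions -/

section Mollification

open scoped Convolution

variable {n : ℕ} {u w : SpaceTime n → ℝ}

/-- The convolution `(u ⋆ w)(x) = ∫ u(t) w(x - t) dt` on space-time. -/
noncomputable abbrev conv (u w : SpaceTime n → ℝ) : SpaceTime n → ℝ :=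
  u ⋆[ContinuousLinearMap.mul ℝ ℝ, volume] w

theorem conv_apply (u w : SpaceTime n → ℝ) (x : SpaceTime n) :
    conv u w x = ∫ t, u t * w (x - t) := rfl

theorem dirD_eq_zero_off_tsupport (e : SpaceTime n) (z : SpaceTime n) (hz : z ∉ tsupport w) :
    dirD e w z = 0 :=
  dirD_eq_zero_off (isClosed_tsupport w) (fun _ hy => image_eq_zero_of_notMem_tsupport hy) z hz

theorem HasCompactSupport.dirD (hw : HasCompactSupport w) (e : SpaceTime n) :
    HasCompactSupport (dirD e w) :=
  HasCompactSupport.intro hw fun z hz => dirD_eq_zero_off_tsupport e z hz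

theorem contDiff_conv (hu : LocallyIntegrable u) (hw : HasCompactSupport w)
    (hw' : ContDiff ℝ ∞ w) : ContDiff ℝ ∞ (conv u w) :=
  hw.contDiff_convolution_right (ContinuousLinearMap.mul ℝ ℝ) hu hw'

theorem dirD_conv (hu : LocallyIntegrable u) (hw : HasCompactSupport w)
    (hw' : ContDiff ℝ ∞ w) (e : SpaceTime n) : dirD e (conv u w) = conv u (dirD e w) := by
  funext x
  rw [dirD_eq (hw.hasFDerivAt_convolution_right (ContinuousLinearMap.mul ℝ ℝ) hu
    (hw'.of_le (by simp)) x)]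
  exact convolution_precompR_apply (ContinuousLinearMap.mul ℝ ℝ) hu (hw.fderiv ℝ)
    (hw'.continuous_fderiv (by simp)) x e

theorem dirD_comp_const_sub (hw : Differentiable ℝ w) (e x t : SpaceTime n) :
    dirD e (fun t => w (x - t)) t = -dirD e w (x - t) := by
  have h : HasFDerivAt (fun t => w (x - t)) ((fderiv ℝ w (x - t)).comp
      (-ContinuousLinearMap.id ℝ (SpaceTime n))) t :=
    (hw _).hasFDerivAt.comp t ((hasFDerivAt_id t).const_sub x)
  rw [dirD_eq h]
  simp [dirD]

theorem integrable_mul_comp_sub (hu : LocallyIntegrable u) (hw : HasCompactSupport w)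
    (hw' : Continuous w) (x : SpaceTime n) : Integrable fun t => u t * w (x - t) := by
  have hs : HasCompactSupport fun t => w (x - t) :=
    hw.comp_homeomorph (Homeomorph.subLeft x)
  simpa [mul_comm] using
    hu.integrable_smul_right_of_hasCompactSupport (hw'.comp (by fun_prop)) hs

/-- `u` solves `∂ₜu - Δu = g` in the sense of distributions. -/
def IsDistribSolution (u g : SpaceTime n → ℝ) : Prop :=
  ∀ ψ : SpaceTime n → ℝ, ContDiff ℝ ∞ ψ → HasCompactSupport ψ →
    ∫ z, u z * (-dT ψ z - lap ψ z) = ∫ z, g z * ψ z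

/-- Mollification commutes with the heat operator. -/
theorem IsDistribSolution.heat_conv {g : SpaceTime n → ℝ} (h : IsDistribSolution u g)
    (hu : LocallyIntegrable u) (hw : HasCompactSupport w) (hw' : ContDiff ℝ ∞ w)
    (x : SpaceTime n) : dT (conv u w) x - lap (conv u w) x = conv g w x := by
  have hd := hw'.smooth_differentiable
  have e1 : dT (conv u w) = conv u (dT w) := dirD_conv hu hw hw' _
  have e2 : lap (conv u w) x = ∑ i, conv u (dX i (dX i w)) x := by
    refine Finset.sum_congr rfl fun i _ => ?_
    rw [dX, dX, dirD_conv hu hw hw', dirD_conv hu (hw.dirD _) (hw'.dirD _)]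
  have ψs : ContDiff ℝ ∞ fun t => w (x - t) := hw'.comp (contDiff_const.sub contDiff_id)
  have ψc : HasCompactSupport fun t => w (x - t) := hw.comp_homeomorph (Homeomorph.subLeft x)
  have e3 : ∀ t, dT (fun t => w (x - t)) t = -dT w (x - t) := dirD_comp_const_sub hd _ x
  have e4 : ∀ t, lap (fun t => w (x - t)) t = lap w (x - t) := by
    intro t
    refine Finset.sum_congr rfl fun i _ => ?_
    have : dX i (fun t => w (x - t)) = fun t => -1 * dX i w (x - t) := by
      funext y
      rw [neg_one_mul]
      exact dirD_comp_const_sub hd _ x y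
    have d1 : Differentiable ℝ fun t => dX i w (x - t) :=
      ((hw'.dirD (spaceDir i)).comp (contDiff_const.sub contDiff_id)).smooth_differentiable
    rw [this, dX, dirD_mul (differentiableAt_const _) (d1 t),
      dirD_comp_const_sub (hw'.dirD _).smooth_differentiable]
    simp [dirD]
  have h1 := h _ ψs ψc
  rw [conv_apply g, ← h1, e1, e2, conv_apply]
  simp only [conv_apply]
  rw [← integral_finsetSum _ fun i _ => integrable_mul_comp_sub hu ((hw.dirD _).dirD _)
    ((hw'.dirD _).dirD _).continuous x, ← integral_sub
    (integrable_mul_comp_sub hu (hw.dirD _) (hw'.dirD _).continuous x)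
    (integrable_finsetSum _ fun i _ => integrable_mul_comp_sub hu ((hw.dirD _).dirD _)
    ((hw'.dirD _).dirD _).continuous x)]
  refine integral_congr_ae (Eventually.of_forall fun t => ?_)
  beta_reduce
  rw [e3, e4, lap, ← Finset.mul_sum]
  ring

/-- Mollifications of a continuous function converge uniformly on compact sets. -/
theorem exists_forall_dist_conv_le {g : SpaceTime n → ℝ} (hg : Continuous g)
    {K : Set (SpaceTime n)} (hK : IsCompact K) {ε : ℝ} (hε : 0 < ε) :
    ∃ ρ : ℝ, 0 < ρ ∧ ∀ b : ContDiffBump (0 : SpaceTime n), b.rOut ≤ ρ →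
      ∀ z ∈ K, |conv g (b.normed volume) z - g z| ≤ ε := by
  have h := hK.uniformContinuousAt_of_continuousAt g (fun a _ => hg.continuousAt)
    (Metric.dist_mem_uniformity hε)
  obtain ⟨ρ, hρ, hh⟩ := Metric.mem_uniformity_dist.1 h
  refine ⟨ρ, hρ, fun b hb z hz => ?_⟩
  have h1 := b.dist_normed_convolution_le (μ := volume) (g := g) (x₀ := z) (ε := ε)
    hg.aestronglyMeasurable fun x hx => by
      have : dist z x < ρ := by rw [dist_comm]; exact (Metric.mem_ball.1 hx).trans_le hb
      have := hh this hz
      rw [dist_comm]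
      exact le_of_lt this
  have e : conv g (b.normed volume) z
      = (b.normed volume ⋆[ContinuousLinearMap.lsmul ℝ ℝ, volume] g) z := by
    rw [conv_apply, convolution_eq_swap]
    exact integral_congr_ae (Eventually.of_forall fun t => by simp [mul_comm])
  rw [e, ← Real.dist_eq]
  exact h1

/-- A continuous nonnegative distributional solution of `∂ₜu - Δu = f(u)` is approximated, locally
uniformly, by smooth positive functions with locally uniformly small defect. -/
theorem IsDistribSolution.exists_approx {f : ℝ → ℝ} (hf : Continuous f) (hu : Continuous u)
    (hu0 : ∀ z, 0 ≤ u z) (h : IsDistribSolution u fun z => f (u z)) {K : Set (SpaceTime n)}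
    (hK : IsCompact K) {ε : ℝ} (hε : 0 < ε) :
    ∃ v : SpaceTime n → ℝ, ContDiff ℝ ∞ v ∧ (∀ z, 0 < v z) ∧
      ∀ z ∈ K, |v z - u z| ≤ ε ∧ |defect f v z| ≤ ε := by
  obtain ⟨M, hM⟩ := hK.exists_bound_of_continuousOn hu.continuousOn
  have huc : UniformContinuousOn f (Icc (-(M + 1)) (M + 1)) :=
    isCompact_Icc.uniformContinuousOn_of_continuous hf.continuousOn
  obtain ⟨δ, hδ, hfδ⟩ := Metric.uniformContinuousOn_iff.1 huc (ε / 2) (by positivity)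
  set τ := min (min (ε / 2) (δ / 3)) (1 / 2) with hτ
  have hτ0 : 0 < τ := lt_min (lt_min (by positivity) (by positivity)) (by norm_num)
  have hτε : τ ≤ ε / 2 := (min_le_left _ _).trans (min_le_left _ _)
  have hτδ : τ ≤ δ / 3 := (min_le_left _ _).trans (min_le_right _ _)
  have hτ1 : τ ≤ 1 / 2 := min_le_right _ _
  obtain ⟨ρ₁, hρ₁, h₁⟩ := exists_forall_dist_conv_le hu hK hτ0
  obtain ⟨ρ₂, hρ₂, h₂⟩ := exists_forall_dist_conv_le (hf.comp hu) hK (half_pos hε)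
  set ρ := min ρ₁ ρ₂ with hρ
  have hρ0 : 0 < ρ := lt_min hρ₁ hρ₂
  let b : ContDiffBump (0 : SpaceTime n) := ⟨ρ / 2, ρ, by positivity, by linarith⟩
  have hwc : HasCompactSupport (b.normed volume) := b.hasCompactSupport_normed
  have hws : ContDiff ℝ ∞ (b.normed volume) := b.contDiff_normed
  have hul : LocallyIntegrable u := hu.locallyIntegrable
  have hcs := contDiff_conv hul hwc hws
  refine ⟨fun z => conv u (b.normed volume) z + τ, hcs.add contDiff_const, fun z => ?_,
    fun z hz => ?_⟩
  · have : 0 ≤ conv u (b.normed volume) z :=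
      integral_nonneg fun t => mul_nonneg (hu0 t) (b.nonneg_normed _)
    positivity
  · have a1 := h₁ b (min_le_left _ _) z hz
    have a2 := h₂ b (min_le_right _ _) z hz
    have a3 : |conv u (b.normed volume) z + τ - u z| ≤ 2 * τ := by
      rw [abs_le] at a1 ⊢
      constructor <;> linarith [a1.1, a1.2]
    refine ⟨a3.trans (by linarith), ?_⟩
    have hdir : ∀ e, dirD e (fun z => conv u (b.normed volume) z + τ)
        = dirD e (conv u (b.normed volume)) := by
      intro e
      funext y
      rw [dirD_add (hcs.smooth_differentiable y) (differentiableAt_const _)]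
      simp [dirD]
    have hheat := h.heat_conv hul hwc hws z
    have hdef : defect f (fun z => conv u (b.normed volume) z + τ) z
        = conv (fun z => f (u z)) (b.normed volume) z - f (conv u (b.normed volume) z + τ) := by
      rw [defect, dT, hdir, ← hheat]
      simp only [lap, dX, hdir]
    have huM := abs_le.1 (hM z hz)
    have a3' := abs_le.1 a3
    have a4 := hfδ (u z) ⟨by linarith [huM.1], by linarith [huM.2]⟩
      (conv u (b.normed volume) z + τ) ⟨by linarith [huM.1, a3'.1], by linarith [huM.2, a3'.2]⟩
      (by rw [dist_comm, Real.dist_eq]; linarith)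
    rw [Real.dist_eq] at a4
    rw [hdef]
    have a5 : conv (fun z => f (u z)) (b.normed volume) z - f (conv u (b.normed volume) z + τ)
      = (conv (f ∘ u) (b.normed volume) z - (f ∘ u) z)
        + (f (u z) - f (conv u (b.normed volume) z + τ)) := by
      simp only [Function.comp_def]; ring
    rw [a5]
    refine (abs_add_le _ _).trans ?_
    linarith

end Mollification

/-! ### Continuous representatives -/

section ContinuousRepresentative

open scoped Convolution

variable {n : ℕ} {u : SpaceTime n → ℝ}

/-- The `L¹`-normalised dilates `y ↦ cᴺ χ(c y)` of a kernel, with `N = n + 1` the dimension of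
space-time. -/
noncomputable def dilate (χ : SpaceTime n → ℝ) (c : ℝ) (y : SpaceTime n) : ℝ :=
  c ^ (n + 1) * χ (c • y)

/-- The derivative of `dilate χ c y` in the parameter `c`. -/
noncomputable def dilateDeriv (χ : SpaceTime n → ℝ) (c : ℝ) (y : SpaceTime n) : ℝ :=
  (n + 1) * c ^ n * χ (c • y) + c ^ (n + 1) * fderiv ℝ χ (c • y) y

/-- The coordinate directions of space-time: those of space, then time. -/
noncomputable def coordDir : Fin n ⊕ Unit → SpaceTime n := Sum.elim spaceDir fun _ => timeDir n

/-- The coordinates of a point of space-time. -/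
noncomputable def coord : Fin n ⊕ Unit → SpaceTime n →L[ℝ] ℝ :=
  Sum.elim (fun i => (EuclideanSpace.proj i : EuclideanSpace ℝ (Fin n) →L[ℝ] ℝ).comp
    (ContinuousLinearMap.fst ℝ _ _)) fun _ => ContinuousLinearMap.snd ℝ _ _

theorem coord_coordDir (j : Fin n ⊕ Unit) : coord j (coordDir j) = 1 := by
  rcases j with i | _
  · simp [coord, coordDir, spaceDir]
  · simp [coord, coordDir, timeDir]

theorem sum_coord_smul (y : SpaceTime n) : ∑ j, coord j y • coordDir j = y := by
  rw [Fintype.sum_sum_type]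
  simp only [coord, coordDir, Sum.elim_inl, Sum.elim_inr, spaceDir, timeDir]
  refine Prod.ext ?_ ?_
  · ext i
    simp [Prod.fst_sum, Finset.sum_apply, Pi.single_apply]
  · simp [Prod.snd_sum]

theorem abs_coord_le (j : Fin n ⊕ Unit) (y : SpaceTime n) : |coord j y| ≤ ‖y‖ := by
  rcases j with i | _
  · exact (PiLp.norm_apply_le y.1 i).trans (norm_fst_le y)
  · exact norm_snd_le y

theorem contDiff_dilate {χ : SpaceTime n → ℝ} (hχ : ContDiff ℝ ∞ χ) :
    ContDiff ℝ ∞ (Function.uncurry (dilate χ)) := by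
  have h : ContDiff ℝ ∞ fun q : ℝ × SpaceTime n => q.1 ^ (n + 1) * χ (q.1 • q.2) :=
    (contDiff_fst.pow _).mul (hχ.comp (contDiff_fst.smul contDiff_snd))
  exact h

theorem dilate_eq_zero {χ : SpaceTime n → ℝ} (hχ0 : ∀ y, 1 < ‖y‖ → χ y = 0) {c : ℝ} (hc : 0 < c)
    {y : SpaceTime n} (hy : 1 < c * ‖y‖) : χ (c • y) = 0 :=
  hχ0 _ (by rwa [norm_smul, Real.norm_eq_abs, abs_of_pos hc])

theorem hasDerivAt_dilate {χ : SpaceTime n → ℝ} (hχ : ContDiff ℝ ∞ χ) (c : ℝ) (y : SpaceTime n) :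
    HasDerivAt (fun c => dilate χ c y) (dilateDeriv χ c y) c := by
  have h1 : HasDerivAt (fun c : ℝ => c • y) y c := by
    simpa using (hasDerivAt_id c).smul_const y
  have h2 : HasDerivAt (fun c : ℝ => χ (c • y)) (fderiv ℝ χ (c • y) y) c :=
    (hχ.smooth_differentiable _).hasFDerivAt.comp_hasDerivAt c h1
  have h3 := (hasDerivAt_pow (n + 1) c).fun_mul h2
  simpa [dilateDeriv, dilate] using h3

theorem hasDerivAt_conv_dilate {χ : SpaceTime n → ℝ} (hχ : ContDiff ℝ ∞ χ)
    (hχ0 : ∀ y, 1 < ‖y‖ → χ y = 0) (hu : LocallyIntegrable u) (x : SpaceTime n) {c : ℝ}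
    (hc : 1 ≤ c) :
    HasDerivAt (fun c => conv u (dilate χ c) x) (conv u (dilateDeriv χ c) x) c := by
  have hsm := contDiff_dilate hχ
  have hz : ∀ (p : ℝ) (y : SpaceTime n), p ∈ Ioi (1 / 2 : ℝ) →
      y ∉ Metric.closedBall (0 : SpaceTime n) 2 → dilate χ p y = 0 := by
    intro p y hp hy
    rw [mem_closedBall_zero_iff, not_le] at hy
    rw [mem_Ioi] at hp
    rw [dilate, dilate_eq_zero hχ0 (by linarith) (by nlinarith), mul_zero]
  have h := hasFDerivAt_convolution_right_with_param (ContinuousLinearMap.mul ℝ ℝ)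
    (g := dilate χ) isOpen_Ioi (isCompact_closedBall (0 : SpaceTime n) 2) hz hu
    ((hsm.of_le (by simp)).contDiffOn) (c, x) (by rw [mem_Ioi]; linarith)
  have h2 : HasDerivAt (fun c : ℝ => ((c, x) : ℝ × SpaceTime n)) (1, 0) c :=
    (hasDerivAt_id c).prodMk (hasDerivAt_const c x)
  have h3 := h.comp_hasDerivAt c h2
  have hf : ∀ y, fderiv ℝ (Function.uncurry (dilate χ)) (c, y) (1, 0) = dilateDeriv χ c y := by
    intro y
    have h4 : HasDerivAt (fun c : ℝ => ((c, y) : ℝ × SpaceTime n)) (1, 0) c :=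
      (hasDerivAt_id c).prodMk (hasDerivAt_const c y)
    have h5 := (hsm.differentiable (by simp) (c, y)).hasFDerivAt.comp_hasDerivAt c h4
    exact h5.unique (hasDerivAt_dilate hχ c y)
  have hcs : HasCompactSupport fun y => fderiv ℝ (Function.uncurry (dilate χ)) (c, y) := by
    refine HasCompactSupport.intro (isCompact_closedBall (0 : SpaceTime n) 2) fun y hy => ?_
    have : Function.uncurry (dilate χ) =ᶠ[𝓝 (c, y)] fun _ => 0 := by
      have ho : IsOpen (Ioi (1 / 2 : ℝ) ×ˢ (Metric.closedBall (0 : SpaceTime n) 2)ᶜ) :=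
        isOpen_Ioi.prod Metric.isClosed_closedBall.isOpen_compl
      filter_upwards [ho.mem_nhds ⟨by rw [mem_Ioi]; linarith, hy⟩] with q hq
      exact hz q.1 q.2 hq.1 hq.2
    rw [this.fderiv_eq]
    simp
  have hcont : Continuous fun y => fderiv ℝ (Function.uncurry (dilate χ)) (c, y) :=
    (hsm.continuous_fderiv (by simp)).comp (by fun_prop)
  have h6 := convolution_precompR_apply (ContinuousLinearMap.mul ℝ ℝ)
    (g := fun y => fderiv ℝ (Function.uncurry (dilate χ)) (c, y)) hu hcs hcont x (1, 0)
  have h7 : conv u (dilateDeriv χ c) x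
      = (u ⋆[ContinuousLinearMap.mul ℝ ℝ, volume] fun a =>
        (fderiv ℝ (Function.uncurry (dilate χ)) (c, a)) (1, 0)) x := by
    simp only [hf]
  rw [h7, ← h6]
  exact h3

/-- The derivative of the dilated kernel in the parameter is a divergence. -/
theorem dilateDeriv_eq_sum {χ : SpaceTime n → ℝ} (hχ : ContDiff ℝ ∞ χ) (c : ℝ) (y : SpaceTime n) :
    dilateDeriv χ c y =
      ∑ j, dirD (coordDir j) (fun y => coord j y * (c ^ n * χ (c • y))) y := by
  have h1 : HasFDerivAt (fun y : SpaceTime n => χ (c • y))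
      ((fderiv ℝ χ (c • y)).comp (c • ContinuousLinearMap.id ℝ (SpaceTime n))) y :=
    (hχ.smooth_differentiable _).hasFDerivAt.comp y ((hasFDerivAt_id y).const_smul c)
  have h2 : ∀ j, dirD (coordDir j) (fun y => coord j y * (c ^ n * χ (c • y))) y
      = c ^ n * χ (c • y) + c ^ (n + 1) * fderiv ℝ χ (c • y) (coord j y • coordDir j) := by
    intro j
    have h3 := ((coord j).hasFDerivAt (x := y)).fun_mul (h1.const_mul (c ^ n))
    rw [dirD_eq h3]
    simp [coord_coordDir]
    ring
  simp only [h2, Finset.sum_add_distrib, ← Finset.mul_sum, ← map_sum, sum_coord_smul]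
  simp [dilateDeriv]
  ring

/-- A derivative falling on the mollifier is moved to the function as its weak derivative. -/
theorem weakDeriv_conv {w χ : SpaceTime n → ℝ} {e : SpaceTime n} (h : HasWeakDirDeriv u w e)
    (hχ : ContDiff ℝ ∞ χ) (hχc : HasCompactSupport χ) (x : SpaceTime n) :
    conv u (dirD e χ) x = conv w χ x := by
  have h1 := h.2.2 (fun t => χ (x - t)) (hχ.comp (contDiff_const.sub contDiff_id))
    (hχc.comp_homeomorph (Homeomorph.subLeft x))
  have h2 : ∀ t, fderiv ℝ (fun t => χ (x - t)) t e = -dirD e χ (x - t) :=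
    dirD_comp_const_sub hχ.smooth_differentiable e x
  simp only [h2, mul_neg, integral_neg, neg_inj] at h1
  exact h1

/-- The bound on the derivative in `c = μ²` of the mollifications at scale `1 / c`. It uses
`|w| ≤ μ + μ^(1 - 2N) |w|^(2N)`, where `N = n + 1`. -/
theorem abs_conv_coord_le {w χ : SpaceTime n → ℝ} (hχ : ContDiff ℝ ∞ χ) (hχpos : ∀ y, 0 ≤ χ y)
    (hχ0 : ∀ y, 1 < ‖y‖ → χ y = 0) (hχ1 : ∫ y, χ y = 1) {B : ℝ} (hB : ∀ y, χ y ≤ B)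
    (x : SpaceTime n)
    (hw : IntegrableOn (fun t => ‖w t‖ ^ (2 * (n + 1))) (Metric.closedBall x 1))
    {μ : ℝ} (hμ : 1 ≤ μ) (j : Fin n ⊕ Unit) :
    |conv w (fun y => coord j y * ((μ ^ 2) ^ n * χ (μ ^ 2 • y))) x| ≤
      μ⁻¹ ^ 3 * (1 + B * ∫ t in Metric.closedBall x 1, ‖w t‖ ^ (2 * (n + 1))) := by
  have hμ0 : 0 < μ := by linarith
  have hμ2 : 1 ≤ μ ^ 2 := one_le_pow₀ hμ
  have hB0 : 0 ≤ B := (hχpos 0).trans (hB 0)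
  have hcχ : Continuous fun t => χ (μ ^ 2 • (x - t)) := hχ.continuous.comp (by fun_prop)
  have hoff : ∀ t ∉ Metric.closedBall x 1, χ (μ ^ 2 • (x - t)) = 0 := by
    intro t ht
    rw [Metric.mem_closedBall, not_le, dist_comm, dist_eq_norm] at ht
    exact dilate_eq_zero hχ0 (by positivity) (by nlinarith)
  have hiχ : Integrable fun t => (μ ^ 2) ^ (n + 1) * χ (μ ^ 2 • (x - t)) :=
    (integrable_of_zero_off (isCompact_closedBall x 1) hcχ hoff).const_mul _
  have hiw : Integrable ((Metric.closedBall x 1).indicator fun t => ‖w t‖ ^ (2 * (n + 1))) :=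
    (integrable_indicator_iff Metric.isClosed_closedBall.measurableSet).2 hw
  have hint1 : ∫ t, (μ ^ 2) ^ (n + 1) * χ (μ ^ 2 • (x - t)) = 1 := by
    rw [integral_const_mul, integral_sub_left_eq_self (fun t => χ (μ ^ 2 • t)) volume x,
      Measure.integral_comp_smul, hχ1, abs_of_nonneg (by positivity)]
    have : Module.finrank ℝ (SpaceTime n) = n + 1 := by simp
    rw [this, smul_eq_mul, mul_one, mul_inv_cancel₀ (by positivity)]
  have hmain : ∀ t, ‖w t * (coord j (x - t) * ((μ ^ 2) ^ n * χ (μ ^ 2 • (x - t))))‖ ≤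
      μ⁻¹ ^ 3 * ((μ ^ 2) ^ (n + 1) * χ (μ ^ 2 • (x - t))
        + B * (Metric.closedBall x 1).indicator (fun t => ‖w t‖ ^ (2 * (n + 1))) t) := by
    intro t
    by_cases ht : t ∈ Metric.closedBall x 1
    · rw [indicator_of_mem ht]
      set X := χ (μ ^ 2 • (x - t)) with hX
      have hX0 : 0 ≤ X := hχpos _
      have h1 : ‖coord j (x - t)‖ * X ≤ μ⁻¹ ^ 2 * X := by
        rcases le_or_gt (μ ^ 2 * ‖x - t‖) 1 with h | h
        · refine mul_le_mul_of_nonneg_right ((abs_coord_le j _).trans ?_) hX0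
          rw [inv_pow, ← one_div, le_div_iff₀ (by positivity)]
          linarith
        · have : X = 0 := dilate_eq_zero hχ0 (by positivity) h
          rw [this]; simp
      have h2 : μ ^ (2 * (n + 1)) * ‖w t‖ ≤ μ ^ (2 * (n + 1)) * μ + μ * ‖w t‖ ^ (2 * (n + 1)) := by
        rcases le_total ‖w t‖ μ with h | h
        · have : μ ^ (2 * (n + 1)) * ‖w t‖ ≤ μ ^ (2 * (n + 1)) * μ := by gcongr
          have : 0 ≤ μ * ‖w t‖ ^ (2 * (n + 1)) := by positivity
          linarith
        · have e : 2 * (n + 1) = (2 * n + 1) + 1 := by ring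
          have : μ ^ (2 * (n + 1)) * ‖w t‖ ≤ μ * ‖w t‖ ^ (2 * (n + 1)) := by
            calc μ ^ (2 * (n + 1)) * ‖w t‖ = μ * (μ ^ (2 * n + 1) * ‖w t‖) := by rw [e]; ring
              _ ≤ μ * (‖w t‖ ^ (2 * n + 1) * ‖w t‖) := by gcongr
              _ = _ := by rw [e]; ring
          have : 0 ≤ μ ^ (2 * (n + 1)) * μ := by positivity
          linarith
      rw [norm_mul, norm_mul, norm_mul, Real.norm_of_nonneg hX0,
        Real.norm_of_nonneg (by positivity : 0 ≤ (μ ^ 2) ^ n)]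
      calc ‖w t‖ * (‖coord j (x - t)‖ * ((μ ^ 2) ^ n * X))
          = ‖w t‖ * (μ ^ 2) ^ n * (‖coord j (x - t)‖ * X) := by ring
        _ ≤ ‖w t‖ * (μ ^ 2) ^ n * (μ⁻¹ ^ 2 * X) := by gcongr
        _ = μ⁻¹ ^ 4 * X * (μ ^ (2 * (n + 1)) * ‖w t‖) := by field_simp; ring
        _ ≤ μ⁻¹ ^ 4 * X * (μ ^ (2 * (n + 1)) * μ + μ * ‖w t‖ ^ (2 * (n + 1))) := by gcongr
        _ = μ⁻¹ ^ 3 * ((μ ^ 2) ^ (n + 1) * X + X * ‖w t‖ ^ (2 * (n + 1))) := by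
          rw [← pow_mul]; field_simp
        _ ≤ μ⁻¹ ^ 3 * ((μ ^ 2) ^ (n + 1) * X + B * ‖w t‖ ^ (2 * (n + 1))) := by
          gcongr
          exact hB _
    · rw [indicator_of_notMem ht, hoff t ht]
      simp
  rw [conv_apply]
  calc _ ≤ ∫ t, μ⁻¹ ^ 3 * ((μ ^ 2) ^ (n + 1) * χ (μ ^ 2 • (x - t))
        + B * (Metric.closedBall x 1).indicator (fun t => ‖w t‖ ^ (2 * (n + 1))) t) :=
        norm_integral_le_of_norm_le ((hiχ.add (hiw.const_mul B)).const_mul _)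
          (Eventually.of_forall hmain)
    _ = _ := by
      rw [integral_const_mul, integral_add hiχ (hiw.const_mul B), hint1, integral_const_mul,
        integral_indicator Metric.isClosed_closedBall.measurableSet]

/-- The dilates of a normalised bump function are normalised bump functions. -/
theorem exists_bump_normed_eq_dilate (b : ContDiffBump (0 : SpaceTime n)) (hb : b.rOut = 1)
    {c : ℝ} (hc : 0 < c) : ∃ b' : ContDiffBump (0 : SpaceTime n),
      b'.rOut = c⁻¹ ∧ b'.rOut ≤ b.rIn⁻¹ * b'.rIn ∧
      b'.normed volume = dilate (b.normed volume) c := by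
  have hbi := b.rIn_pos
  have hlt : b.rIn < 1 := hb ▸ b.rIn_lt_rOut
  let b' : ContDiffBump (0 : SpaceTime n) := ⟨b.rIn * c⁻¹, c⁻¹, by positivity, by
    have := mul_lt_mul_of_pos_right hlt (inv_pos.2 hc)
    linarith⟩
  have h1 : ∀ y, b' y = b (c • y) := by
    intro y
    rw [ContDiffBump.apply, ContDiffBump.apply]
    have e1 : b'.rOut / b'.rIn = b.rOut / b.rIn := by
      change c⁻¹ / (b.rIn * c⁻¹) = _
      rw [hb]; field_simp
    have e2 : b'.rIn⁻¹ • (y - 0) = b.rIn⁻¹ • (c • y - 0) := by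
      change (b.rIn * c⁻¹)⁻¹ • (y - 0) = _
      rw [sub_zero, sub_zero, smul_smul, mul_inv, inv_inv]
    rw [e1, e2]
  refine ⟨b', rfl, ?_, ?_⟩
  · change c⁻¹ ≤ b.rIn⁻¹ * (b.rIn * c⁻¹)
    rw [inv_mul_cancel_left₀ hbi.ne']
  · funext y
    have h2 : ∫ y, b' y = (c ^ (n + 1))⁻¹ * ∫ y, b y := by
      simp only [h1]
      rw [Measure.integral_comp_smul, abs_of_nonneg (by positivity)]
      have : Module.finrank ℝ (SpaceTime n) = n + 1 := by simp
      rw [this, smul_eq_mul]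
    rw [ContDiffBump.normed_def, dilate, ContDiffBump.normed_def, h2, h1]
    have : ∫ y, b y ≠ 0 := b.integral_pos.ne'
    field_simp

/-- A function with weak derivatives in `L^(2N)_loc`, where `N = n + 1`, has a continuous
representative. Its mollifications at scale `1 / c` form a uniformly Cauchy family on compact sets,
since their derivative in `c` is integrable at infinity (`abs_conv_coord_le`), and they converge to
the function at its Lebesgue points. -/
theorem exists_continuous_representative {w : Fin n ⊕ Unit → SpaceTime n → ℝ}
    (h : ∀ j, HasWeakDirDeriv u (w j) (coordDir j))
    (hw : ∀ j, MemLrLoc ((2 * (n + 1) : ℕ) : ℝ≥0∞) (w j)) :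
    ∃ u' : SpaceTime n → ℝ, Continuous u' ∧ u =ᵐ[volume] u' := by
  have hu : LocallyIntegrable u := (h (Sum.inr ())).1
  let b : ContDiffBump (0 : SpaceTime n) := ⟨1 / 2, 1, by norm_num, by norm_num⟩
  set χ : SpaceTime n → ℝ := b.normed volume with hχdef
  have hχ : ContDiff ℝ ∞ χ := b.contDiff_normed
  have hχpos : ∀ y, 0 ≤ χ y := fun y => b.nonneg_normed y
  have hχ0 : ∀ y, 1 < ‖y‖ → χ y = 0 := fun y hy => by
    rw [hχdef, ContDiffBump.normed_def, b.zero_of_le_dist (by simpa [b] using hy.le), zero_div]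
  have hχ1 : ∫ y, χ y = 1 := b.integral_normed
  obtain ⟨B, hB⟩ : ∃ B, ∀ y, χ y ≤ B := by
    obtain ⟨B, hB⟩ := b.hasCompactSupport_normed.exists_bound_of_continuous hχ.continuous
    exact ⟨B, fun y => (le_abs_self _).trans (hB y)⟩
  have hB0 : 0 ≤ B := (hχpos 0).trans (hB 0)
  have hint : ∀ (j : Fin n ⊕ Unit) (K : Set (SpaceTime n)), IsCompact K →
      IntegrableOn (fun t => ‖w j t‖ ^ (2 * (n + 1))) K := fun j K hK =>
    (hw j K hK).integrable_norm_pow (by omega)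
  set a : ℝ → SpaceTime n → ℝ := fun μ x => conv u (dilate χ (μ ^ 2)) x with ha
  -- local Lipschitz bound in `1 / μ`
  have hlip : ∀ ρ : ℝ, ∃ C : ℝ, 0 ≤ C ∧ ∀ x ∈ Metric.closedBall (0 : SpaceTime n) ρ,
      ∀ μ ν : ℝ, 1 ≤ μ → μ ≤ ν → |a ν x - a μ x| ≤ C * (μ⁻¹ - ν⁻¹) := by
    intro ρ
    set W : ℝ := ∑ j, (1 + B * ∫ t in Metric.closedBall (0 : SpaceTime n) (ρ + 1),
      ‖w j t‖ ^ (2 * (n + 1))) with hW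
    refine ⟨2 * W, ?_, fun x hx μ ν hμ hν => ?_⟩
    · have : ∀ j, 0 ≤ ∫ t in Metric.closedBall (0 : SpaceTime n) (ρ + 1),
          ‖w j t‖ ^ (2 * (n + 1)) := fun j => integral_nonneg fun t => by positivity
      have : 0 ≤ W := Finset.sum_nonneg fun j _ => by
        have := mul_nonneg hB0 (this j)
        linarith
      positivity
    have hd : ∀ μ : ℝ, 1 ≤ μ → HasDerivAt (fun μ => a μ x)
        (conv u (dilateDeriv χ (μ ^ 2)) x * (2 * μ)) μ := by
      intro μ hμ
      have h1 := hasDerivAt_conv_dilate hχ hχ0 hu x (one_le_pow₀ hμ : 1 ≤ μ ^ 2)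
      have h2 : HasDerivAt (fun μ : ℝ => μ ^ 2) (2 * μ) μ := by simpa using hasDerivAt_pow 2 μ
      exact HasDerivAt.comp (h₂ := fun c => conv u (dilate χ c) x) μ h1 h2
    have hbd : ∀ μ : ℝ, 1 ≤ μ → |conv u (dilateDeriv χ (μ ^ 2)) x * (2 * μ)| ≤ 2 * W * μ⁻¹ ^ 2 := by
      intro μ hμ
      have hμ0 : 0 < μ := by linarith
      have hμ2 : 0 < μ ^ 2 := by positivity
      set Y : Fin n ⊕ Unit → SpaceTime n → ℝ :=
        fun j y => coord j y * ((μ ^ 2) ^ n * χ (μ ^ 2 • y)) with hY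
      have hYs : ∀ j, ContDiff ℝ ∞ (Y j) := fun j =>
        (coord j).contDiff.mul (contDiff_const.mul (hχ.comp (contDiff_const_smul _)))
      have hYc : ∀ j, HasCompactSupport (Y j) := fun j =>
        HasCompactSupport.intro (isCompact_closedBall (0 : SpaceTime n) (μ ^ 2)⁻¹) fun y hy => by
          rw [mem_closedBall_zero_iff, not_le, inv_eq_one_div, div_lt_iff₀ hμ2] at hy
          simp only [hY]
          rw [dilate_eq_zero hχ0 hμ2 (by linarith)]
          simp
      have e1 : conv u (dilateDeriv χ (μ ^ 2)) x = ∑ j, conv (w j) (Y j) x := by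
        have e2 : ∀ t, u t * dilateDeriv χ (μ ^ 2) (x - t)
            = ∑ j, u t * dirD (coordDir j) (Y j) (x - t) := fun t => by
          rw [dilateDeriv_eq_sum hχ, Finset.mul_sum]
        simp only [conv_apply, e2]
        rw [integral_finsetSum _ fun j _ => integrable_mul_comp_sub hu ((hYc j).dirD _)
          ((hYs j).dirD _).continuous x]
        exact Finset.sum_congr rfl fun j _ => weakDeriv_conv (h j) (hYs j) (hYc j) x
      have hsub : Metric.closedBall x 1 ⊆ Metric.closedBall (0 : SpaceTime n) (ρ + 1) :=
        Metric.closedBall_subset_closedBall' (by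
          have := Metric.mem_closedBall.1 hx
          linarith)
      have e3 : |∑ j, conv (w j) (Y j) x| ≤ μ⁻¹ ^ 3 * W := by
        rw [hW, Finset.mul_sum]
        refine (Finset.abs_sum_le_sum_abs _ _).trans (Finset.sum_le_sum fun j _ => ?_)
        refine (abs_conv_coord_le hχ hχpos hχ0 hχ1 hB x
          (hint j _ (isCompact_closedBall x 1)) hμ j).trans ?_
        gcongr
        exact Eventually.of_forall fun t => by positivity
        exact hint j _ (isCompact_closedBall _ _)
      rw [e1, abs_mul, abs_of_pos (by positivity : 0 < 2 * μ)]
      calc |∑ j, conv (w j) (Y j) x| * (2 * μ) ≤ μ⁻¹ ^ 3 * W * (2 * μ) := by gcongr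
        _ = _ := by field_simp
    have hinv : ∀ t : ℝ, 1 ≤ t → HasDerivAt (fun t : ℝ => 2 * W * (μ⁻¹ - t⁻¹))
        (2 * W * t⁻¹ ^ 2) t := by
      intro t ht
      have := ((hasDerivAt_inv (by linarith : t ≠ 0)).const_sub μ⁻¹).const_mul (2 * W)
      simpa using this
    have := image_norm_le_of_norm_deriv_right_le_deriv_boundary' (a := μ) (b := ν)
      (f := fun t => a t x - a μ x) (f' := fun t => conv u (dilateDeriv χ (t ^ 2)) x * (2 * t))
      (B := fun t => 2 * W * (μ⁻¹ - t⁻¹)) (B' := fun t => 2 * W * t⁻¹ ^ 2)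
      (fun t ht => ((hd t (hμ.trans ht.1)).sub_const _).continuousAt.continuousWithinAt)
      (fun t ht => ((hd t (hμ.trans ht.1)).sub_const _).hasDerivWithinAt) (by simp)
      (fun t ht => (hinv t (hμ.trans ht.1)).continuousAt.continuousWithinAt)
      (fun t ht => (hinv t (hμ.trans ht.1)).hasDerivWithinAt)
      (fun t ht => hbd t (hμ.trans ht.1))
    exact this (right_mem_Icc.2 hν)
  have hlipk : ∀ ρ : ℝ, ∃ C : ℝ, 0 ≤ C ∧ ∀ x ∈ Metric.closedBall (0 : SpaceTime n) ρ,
      ∀ k l : ℕ, k ≤ l → |a (l + 1) x - a (k + 1) x| ≤ C * (1 / ((k : ℝ) + 1)) := by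
    intro ρ
    obtain ⟨C, hC, hb⟩ := hlip ρ
    refine ⟨C, hC, fun x hx k l hkl => ?_⟩
    have hkl' : (k : ℝ) ≤ l := by exact_mod_cast hkl
    have hk : (0 : ℝ) ≤ k := Nat.cast_nonneg k
    refine (hb x hx (k + 1) (l + 1) (by linarith) (by linarith)).trans ?_
    have : 0 ≤ ((l : ℝ) + 1)⁻¹ := by positivity
    rw [one_div]
    gcongr
    linarith
  have hex : ∀ x, ∃ L, Tendsto (fun k : ℕ => a ((k : ℝ) + 1) x) atTop (𝓝 L) := by
    intro x
    obtain ⟨C, hC, hb⟩ := hlipk ‖x‖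
    refine cauchySeq_tendsto_of_complete (cauchySeq_of_le_tendsto_0'
      (fun k : ℕ => C * (1 / ((k : ℝ) + 1))) (fun k l hkl => ?_) ?_)
    · rw [dist_comm, Real.dist_eq]
      exact hb x (by simp) k l hkl
    · simpa using tendsto_one_div_add_atTop_nhds_zero_nat.const_mul C
  choose u' hu' using hex
  refine ⟨u', ?_, ?_⟩
  · have hloc : TendstoLocallyUniformly (fun (k : ℕ) x => a ((k : ℝ) + 1) x) u' atTop := by
      rw [Metric.tendstoLocallyUniformly_iff]
      intro ε hε x
      obtain ⟨C, hC, hb⟩ := hlipk (‖x‖ + 1)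
      refine ⟨Metric.ball x 1, Metric.ball_mem_nhds x one_pos, ?_⟩
      have hz : Tendsto (fun k : ℕ => C * (1 / ((k : ℝ) + 1))) atTop (𝓝 0) := by
        simpa using tendsto_one_div_add_atTop_nhds_zero_nat.const_mul C
      filter_upwards [hz.eventually_lt_const hε] with k hk y hy
      have hy' : y ∈ Metric.closedBall (0 : SpaceTime n) (‖x‖ + 1) := by
        rw [mem_closedBall_zero_iff]
        have h1 := norm_sub_norm_le y x
        rw [Metric.mem_ball, dist_eq_norm] at hy
        linarith
      refine lt_of_le_of_lt ?_ hk
      rw [Real.dist_eq]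
      exact le_of_tendsto ((hu' y).sub_const _).abs
        (eventually_atTop.2 ⟨k, fun l hl => hb y hy' k l hl⟩)
    refine hloc.continuous (Eventually.of_forall fun k => ?_).frequently
    have hs : HasCompactSupport (dilate χ (((k : ℝ) + 1) ^ 2)) := by
      obtain ⟨b', -, -, hb'⟩ := exists_bump_normed_eq_dilate b rfl
        (by positivity : 0 < ((k : ℝ) + 1) ^ 2)
      rw [← hb']
      exact b'.hasCompactSupport_normed
    have hc : ContDiff ℝ ∞ (dilate χ (((k : ℝ) + 1) ^ 2)) :=
      contDiff_const.mul (hχ.comp (contDiff_const_smul _))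
    exact (contDiff_conv hu hs hc).continuous
  · choose b' hb'1 hb'2 hb'3 using fun k : ℕ => exists_bump_normed_eq_dilate b rfl
      (by positivity : 0 < ((k : ℝ) + 1) ^ 2)
    have hr : Tendsto (fun k => (b' k).rOut) atTop (𝓝 0) := by
      simp only [hb'1]
      exact tendsto_inv_atTop_zero.comp ((tendsto_pow_atTop two_ne_zero).comp
        (tendsto_atTop_add_const_right _ 1 tendsto_natCast_atTop_atTop))
    filter_upwards [ContDiffBump.ae_convolution_tendsto_right_of_locallyIntegrable hr
      (Eventually.of_forall hb'2) hu] with x hx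
    refine tendsto_nhds_unique (hx.congr fun k => ?_) (hu' x)
    rw [hb'3, convolution_eq_swap, ha]
    exact integral_congr_ae (Eventually.of_forall fun t => by simp [mul_comm, hχdef])

end ContinuousRepresentative

/-! ### The Liouville property of continuous solutions -/

section Liouville

variable {n : ℕ} {u : SpaceTime n → ℝ} {f : ℝ → ℝ}

/-- A nonnegative continuous solution is approximated on any ball, and to any precision, by smooth
positive functions of arbitrarily small energy on that ball: in the energy decay on a much larger
ball, the defect of a fine enough mollification is negligible. The energy density is dominated by
the function `Q`, of small integral over all of space-time. -/
theorem IsDistribSolution.exists_approx_small_energy (hn : 1 ≤ n) (hf : Continuous f)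
    (hfpos : ∀ s, 0 < s → 0 < f s)
    (hsub : n = 1 ∨ ∃ p : ℝ, 1 < p ∧ p < pB n ∧ AntitoneOn (fun s : ℝ => f s / s ^ p) (Ioi 0))
    (hmono : ∃ C : ℝ, 0 ≤ C ∧ ∀ τ s, 0 < τ → τ ≤ s → f τ ≤ C * f s)
    (hgrow : ∃ c q : ℝ, 0 < c ∧ 1 < q ∧ ∀ s, 1 ≤ s → c * s ^ q ≤ f s)
    (hu : Continuous u) (hu0 : ∀ z, 0 ≤ u z) (h : IsDistribSolution u fun z => f (u z)) :
    ∃ κ : ℝ, 0 < κ ∧ ∀ R η : ℝ, 0 < η → ∃ v Q : SpaceTime n → ℝ, ContDiff ℝ ∞ v ∧ (∀ z, 0 < v z) ∧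
      Integrable Q ∧ (∀ z, 0 ≤ Q z) ∧ ∫ z, Q z ≤ η ∧ ∀ z, ‖z‖ ≤ R →
        |v z - u z| ≤ η ∧ dT v z ^ 2 + κ * (gradSq v z / v z) ^ 2 ≤ Q z := by
  obtain ⟨C, κ, ϑ, hC, hκ, hϑ, H⟩ := exists_energy_decay hn hf hfpos hsub hmono hgrow
  refine ⟨κ, hκ, fun R η hη => ?_⟩
  obtain ⟨R', hR1, hRR, hRη⟩ : ∃ R', 1 ≤ R' ∧ R ≤ R' ∧ C * R' ^ (-ϑ) ≤ η / 2 := by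
    have ht : Tendsto (fun R : ℝ => C * R ^ (-ϑ)) atTop (𝓝 (C * 0)) :=
      (tendsto_rpow_neg_atTop hϑ).const_mul C
    rw [mul_zero] at ht
    have h1 := ht.eventually (ge_mem_nhds (show (0 : ℝ) < η / 2 by positivity))
    obtain ⟨R', h1, h2, h3⟩ := (h1.and ((eventually_ge_atTop 1).and (eventually_ge_atTop R))).exists
    exact ⟨R', h2, h3, h1⟩
  obtain ⟨K, φ, hK, hφ, hφ0, hφK, hφ1, H⟩ := H R' hR1
  obtain ⟨M, hM⟩ := hK.exists_bound_of_continuousOn hu.continuousOn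
  obtain ⟨B, hB⟩ := (isCompact_Icc (a := (0 : ℝ)) (b := M + 1)).exists_bound_of_continuousOn
    hf.continuousOn
  set J := ∫ z, φ z with hJ
  have hJ0 : 0 ≤ J := integral_nonneg hφ0
  set ε := min (min η 1) (η / (2 * (1 + C * ((1 + |B|) * J)))) with hε
  have hden : 0 < 1 + C * ((1 + |B|) * J) := by positivity
  have hε0 : 0 < ε := lt_min (lt_min hη one_pos) (by positivity)
  have hεη : ε ≤ η := (min_le_left _ _).trans (min_le_left _ _)
  have hε1 : ε ≤ 1 := (min_le_left _ _).trans (min_le_right _ _)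
  have hε2 : C * (ε * ((1 + |B|) * J)) ≤ η / 2 := by
    have h1 : ε ≤ η / (2 * (1 + C * ((1 + |B|) * J))) := min_le_right _ _
    rw [le_div_iff₀ (by positivity)] at h1
    nlinarith
  obtain ⟨v, hv, hv0, happ⟩ := h.exists_approx hf hu hu0 hK hε0
  have hgc : Continuous fun z => gradSq v z / v z :=
    (continuous_gradSq hv).div hv.continuous fun z => (hv0 z).ne'
  have hdT : Continuous (dT v) := (hv.dirD _).continuous
  have hdc := continuous_defect hf hv
  refine ⟨v, fun z => φ z * dT v z ^ 2 + κ * (φ z * (gradSq v z / v z) ^ 2), hv, hv0, ?_,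
    fun z => ?_, ?_, fun z hz => ?_⟩
  · exact integrable_of_zero_off hK (by fun_prop) fun z hz => by simp [hφK z hz]
  · have := hφ0 z
    positivity
  · have hE : ∫ z, φ z * (defect f v z ^ 2 + f (v z) * |defect f v z|) ≤
        ∫ z, φ z * (ε * (1 + |B|)) := by
      have hvc := hv.continuous
      refine integral_mono (integrable_of_zero_off hK (by fun_prop) fun z hz => by simp [hφK z hz])
        (integrable_of_zero_off hK (by fun_prop) fun z hz => by simp [hφK z hz]) fun z => ?_
      by_cases hz : z ∈ K
      · obtain ⟨h1, h2⟩ := happ z hz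
        have h3 : f (v z) ≤ |B| := by
          refine (le_abs_self _).trans ((hB (v z) ⟨(hv0 z).le, ?_⟩).trans (le_abs_self B))
          have := (le_abs_self _).trans (hM z hz)
          have := (le_abs_self _).trans h1
          linarith
        refine mul_le_mul_of_nonneg_left ?_ (hφ0 z)
        have h4 : defect f v z ^ 2 ≤ ε := by
          rw [← sq_abs]
          nlinarith [abs_nonneg (defect f v z)]
        have h5 : f (v z) * |defect f v z| ≤ |B| * ε :=
          mul_le_mul h3 h2 (abs_nonneg _) (abs_nonneg _)
        linarith
      · simp [hφK z hz]
    rw [integral_mul_const, ← hJ] at hE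
    have h1 := H v hv hv0
    have h2 := mul_le_mul_of_nonneg_left hE hC
    linarith
  · have hz1 := hφ1 z (hz.trans hRR)
    have hzK : z ∈ K := by
      by_contra hzK
      rw [hφK z hzK] at hz1
      exact zero_ne_one hz1
    refine ⟨(happ z hzK).1.trans hεη, ?_⟩
    simp [hz1]

/-- A directional derivative vanishes in the sense of distributions if it is approximated by
functions bounded by `ε + D Q`, with `∫ Q` arbitrarily small for given `ε` and `D`. -/
theorem integral_mul_dirD_eq_zero_of_approx (hu : Continuous u) {ψ : SpaceTime n → ℝ}
    (hψ : ContDiff ℝ ∞ ψ) (hψc : HasCompactSupport ψ) {e : SpaceTime n}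
    (H : ∀ ε : ℝ, 0 < ε → ∃ D : ℝ, 0 ≤ D ∧ ∀ η : ℝ, 0 < η → η ≤ 1 → ∃ v Q : SpaceTime n → ℝ,
      ContDiff ℝ ∞ v ∧ Integrable Q ∧ (∀ z, 0 ≤ Q z) ∧ ∫ z, Q z ≤ η ∧
        ∀ z ∈ tsupport ψ, |v z - u z| ≤ η ∧ |dirD e v z| ≤ ε + D * Q z) :
    ∫ z, u z * dirD e ψ z = 0 := by
  have hψ0 : ∀ z ∉ tsupport ψ, ψ z = 0 := fun z hz => image_eq_zero_of_notMem_tsupport hz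
  have hdψ0 : ∀ z ∉ tsupport ψ, dirD e ψ z = 0 := dirD_eq_zero_off_tsupport e
  have hψC := hψ.continuous
  have hdψC := (hψ.dirD e).continuous
  have hsupp : IsCompact (tsupport ψ) := hψc
  obtain ⟨B, hB⟩ := hψc.exists_bound_of_continuous hψC
  have hB0 : 0 ≤ B := (norm_nonneg _).trans (hB 0)
  have iψ : Integrable fun z => |ψ z| :=
    integrable_of_zero_off hsupp hψC.abs fun z hz => by simp [hψ0 z hz]
  have idψ : Integrable fun z => |dirD e ψ z| :=
    integrable_of_zero_off hsupp hdψC.abs fun z hz => by simp [hdψ0 z hz]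
  set I₀ := ∫ z, |ψ z| with hI₀
  set I₁ := ∫ z, |dirD e ψ z| with hI₁
  have hI₀0 : 0 ≤ I₀ := integral_nonneg fun z => abs_nonneg _
  have hI₁0 : 0 ≤ I₁ := integral_nonneg fun z => abs_nonneg _
  have key : ∀ ε : ℝ, 0 < ε → |∫ z, u z * dirD e ψ z| ≤ ε * (I₀ + 1) := by
    intro ε hε
    obtain ⟨D, hD, H⟩ := H ε hε
    have hden : 0 < 1 + I₁ + D * B := by positivity
    set η := min 1 (ε / (1 + I₁ + D * B)) with hη
    have hη0 : 0 < η := lt_min one_pos (by positivity)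
    have hηε : η * (1 + I₁ + D * B) ≤ ε := by
      rw [← le_div_iff₀ hden]
      exact min_le_right _ _
    obtain ⟨v, Q, hv, hQ, hQ0, hQη, hvQ⟩ := H η hη0 (min_le_left _ _)
    have hvC := hv.continuous
    have hdvC := (hv.dirD e).continuous
    have i1 : Integrable fun z => (u z - v z) * dirD e ψ z :=
      integrable_of_zero_off hsupp (by fun_prop) fun z hz => by simp [hdψ0 z hz]
    have i2 : Integrable fun z => v z * dirD e ψ z :=
      integrable_of_zero_off hsupp (by fun_prop) fun z hz => by simp [hdψ0 z hz]
    have i3 : Integrable fun z => dirD e v z * ψ z :=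
      integrable_of_zero_off hsupp (by fun_prop) fun z hz => by simp [hψ0 z hz]
    have e1 : ∫ z, u z * dirD e ψ z =
        (∫ z, (u z - v z) * dirD e ψ z) + ∫ z, v z * dirD e ψ z := by
      rw [← integral_add i1 i2]
      exact integral_congr_ae (Eventually.of_forall fun z => by ring)
    have e2 : ∫ z, v z * dirD e ψ z = -∫ z, dirD e v z * ψ z := by
      have h0 := (nullOn_of_dirD hsupp (hv.smooth_differentiable.mul hψ.smooth_differentiable)
        (fun z => dirD_mul (hv.smooth_differentiable z) (hψ.smooth_differentiable z))
        (by fun_prop) (fun z hz => by simp [hψ0 z hz]) :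
        NullOn (tsupport ψ) fun z => dirD e v z * ψ z + v z * dirD e ψ z).integral_eq
      rw [integral_add i3 i2] at h0
      linarith
    have b1 : |∫ z, (u z - v z) * dirD e ψ z| ≤ η * I₁ := by
      rw [hI₁, ← integral_const_mul]
      refine abs_integral_le_integral_abs.trans
        (integral_mono i1.abs (idψ.const_mul η) fun z => ?_)
      by_cases hz : z ∈ tsupport ψ
      · simp only [abs_mul]
        refine mul_le_mul_of_nonneg_right ?_ (abs_nonneg _)
        rw [abs_sub_comm]
        exact (hvQ z hz).1
      · simp [hdψ0 z hz]
    have b2 : |∫ z, dirD e v z * ψ z| ≤ ε * I₀ + D * B * η := by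
      have : |∫ z, dirD e v z * ψ z| ≤ ∫ z, (ε * |ψ z| + D * B * Q z) := by
        refine abs_integral_le_integral_abs.trans
          (integral_mono i3.abs ((iψ.const_mul ε).add (hQ.const_mul (D * B))) fun z => ?_)
        have hQz := hQ0 z
        by_cases hz : z ∈ tsupport ψ
        · simp only [abs_mul]
          have h1 := mul_le_mul_of_nonneg_right (hvQ z hz).2 (abs_nonneg (ψ z))
          have h2 : D * Q z * |ψ z| ≤ D * Q z * B :=
            mul_le_mul_of_nonneg_left (hB z) (by positivity)
          calc |dirD e v z| * |ψ z| ≤ (ε + D * Q z) * |ψ z| := h1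
            _ ≤ ε * |ψ z| + D * B * Q z := by linarith
        · simp only [hψ0 z hz, mul_zero, abs_zero, zero_add]
          positivity
      rw [integral_add (iψ.const_mul ε) (hQ.const_mul _), integral_const_mul,
        integral_const_mul] at this
      exact this.trans (add_le_add le_rfl (mul_le_mul_of_nonneg_left hQη (by positivity)))
    rw [e1, e2]
    calc |(∫ z, (u z - v z) * dirD e ψ z) + -∫ z, dirD e v z * ψ z|
        ≤ |∫ z, (u z - v z) * dirD e ψ z| + |∫ z, dirD e v z * ψ z| := by
          rw [← abs_neg (∫ z, dirD e v z * ψ z)]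
          exact abs_add_le _ _
      _ ≤ η * I₁ + (ε * I₀ + D * B * η) := add_le_add b1 b2
      _ ≤ ε * (I₀ + 1) := by linarith
  by_contra hne
  have hpos : 0 < |∫ z, u z * dirD e ψ z| := abs_pos.2 hne
  have h1 := key (|∫ z, u z * dirD e ψ z| / (2 * (I₀ + 1))) (by positivity)
  rw [div_mul_eq_mul_div, le_div_iff₀ (by positivity)] at h1
  nlinarith

theorem le_add_inv_mul_sq {ε y : ℝ} (hε : 0 < ε) : y ≤ ε + ε⁻¹ * y ^ 2 := by
  have h : ε * (ε + ε⁻¹ * y ^ 2 - y) = ε ^ 2 + y ^ 2 - ε * y := by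
    field_simp
  have : 0 ≤ ε * (ε + ε⁻¹ * y ^ 2 - y) := by
    rw [h]
    nlinarith [sq_nonneg (ε - y), sq_nonneg ε, sq_nonneg y]
  linarith [nonneg_of_mul_nonneg_right this hε]

/-- All first derivatives of a nonnegative continuous solution vanish. -/
theorem IsDistribSolution.integral_mul_dirD_eq_zero (hn : 1 ≤ n) (hf : Continuous f)
    (hfpos : ∀ s, 0 < s → 0 < f s)
    (hsub : n = 1 ∨ ∃ p : ℝ, 1 < p ∧ p < pB n ∧ AntitoneOn (fun s : ℝ => f s / s ^ p) (Ioi 0))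
    (hmono : ∃ C : ℝ, 0 ≤ C ∧ ∀ τ s, 0 < τ → τ ≤ s → f τ ≤ C * f s)
    (hgrow : ∃ c q : ℝ, 0 < c ∧ 1 < q ∧ ∀ s, 1 ≤ s → c * s ^ q ≤ f s)
    (hu : Continuous u) (hu0 : ∀ z, 0 ≤ u z) (h : IsDistribSolution u fun z => f (u z))
    (j : Fin n ⊕ Unit) {ψ : SpaceTime n → ℝ} (hψ : ContDiff ℝ ∞ ψ) (hψc : HasCompactSupport ψ) :
    ∫ z, u z * dirD (coordDir j) ψ z = 0 := by
  obtain ⟨κ, hκ, H⟩ := h.exists_approx_small_energy hn hf hfpos hsub hmono hgrow hu hu0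
  have hsupp : IsCompact (tsupport ψ) := hψc
  obtain ⟨R, hR⟩ := hsupp.isBounded.exists_norm_le
  obtain ⟨M, hM⟩ := hsupp.exists_bound_of_continuousOn hu.continuousOn
  set A := |M| + 1 with hA
  have hA0 : 0 < A := by positivity
  refine integral_mul_dirD_eq_zero_of_approx hu hψ hψc fun ε hε => ?_
  rcases j with i | _
  · refine ⟨ε⁻¹ * ((ε⁻¹) ^ 2 * A ^ 2 * κ⁻¹), by positivity, fun η hη hη1 => ?_⟩
    obtain ⟨v, Q, hv, hv0, hQ, hQ0, hQη, hvQ⟩ := H R η hη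
    refine ⟨v, Q, hv, hQ, hQ0, hQη, fun z hz => ⟨(hvQ z (hR z hz)).1, ?_⟩⟩
    obtain ⟨h1, h2⟩ := hvQ z (hR z hz)
    have hvz := hv0 z
    have hvA : v z ≤ A := by
      have := (le_abs_self _).trans ((hM z hz).trans (le_abs_self M))
      have := (le_abs_self _).trans h1
      linarith
    set G := gradSq v z / v z with hG
    have hG0 : 0 ≤ G := div_nonneg (gradSq_nonneg v z) hvz.le
    have hyG : |dX i v z| ^ 2 ≤ A * G := by
      have e1 : gradSq v z = v z * G := by
        rw [hG]
        field_simp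
      calc |dX i v z| ^ 2 = dX i v z ^ 2 := sq_abs _
        _ ≤ gradSq v z := Finset.single_le_sum (f := fun i => dX i v z ^ 2)
            (fun _ _ => sq_nonneg _) (Finset.mem_univ i)
        _ = v z * G := e1
        _ ≤ A * G := mul_le_mul_of_nonneg_right hvA hG0
    have hGQ : G ^ 2 ≤ κ⁻¹ * Q z := by
      rw [inv_mul_eq_div, le_div_iff₀ hκ]
      nlinarith [sq_nonneg (dT v z)]
    have hy4 : (|dX i v z| ^ 2) ^ 2 ≤ A ^ 2 * (κ⁻¹ * Q z) := by
      calc (|dX i v z| ^ 2) ^ 2 ≤ (A * G) ^ 2 := pow_le_pow_left₀ (by positivity) hyG 2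
        _ = A ^ 2 * G ^ 2 := by ring
        _ ≤ _ := mul_le_mul_of_nonneg_left hGQ (by positivity)
    -- `y ≤ ε + ε⁻³ y⁴`: if `y > ε` then `y⁴ > ε³ y`.
    have hy : |dX i v z| ≤ ε + ε⁻¹ ^ 3 * (|dX i v z| ^ 2) ^ 2 := by
      have hy0 := abs_nonneg (dX i v z)
      rcases le_or_gt (|dX i v z|) ε with hle | hlt
      · have : 0 ≤ ε⁻¹ ^ 3 * (|dX i v z| ^ 2) ^ 2 := by positivity
        linarith
      · have h3 : ε ^ 3 * |dX i v z| ≤ (|dX i v z| ^ 2) ^ 2 := by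
          calc ε ^ 3 * |dX i v z| ≤ |dX i v z| ^ 3 * |dX i v z| := by gcongr
            _ = _ := by ring
        have h4 : |dX i v z| ≤ ε⁻¹ ^ 3 * (|dX i v z| ^ 2) ^ 2 := by
          rw [inv_pow, inv_mul_eq_div, le_div_iff₀ (by positivity)]
          linarith
        linarith
    calc |dX i v z| ≤ ε + ε⁻¹ ^ 3 * (|dX i v z| ^ 2) ^ 2 := hy
      _ ≤ ε + ε⁻¹ ^ 3 * (A ^ 2 * (κ⁻¹ * Q z)) := by gcongr
      _ = _ := by ring
  · refine ⟨ε⁻¹, by positivity, fun η hη _ => ?_⟩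
    obtain ⟨v, Q, hv, hv0, hQ, hQ0, hQη, hvQ⟩ := H R η hη
    refine ⟨v, Q, hv, hQ, hQ0, hQη, fun z hz => ⟨(hvQ z (hR z hz)).1, ?_⟩⟩
    have h2 := (hvQ z (hR z hz)).2
    have h3 : |dT v z| ^ 2 ≤ Q z := by
      rw [sq_abs]
      have : 0 ≤ κ * (gradSq v z / v z) ^ 2 := by positivity
      linarith
    calc |dT v z| ≤ ε + ε⁻¹ * |dT v z| ^ 2 := le_add_inv_mul_sq hε
      _ ≤ ε + ε⁻¹ * Q z := by gcongr

/-- A nonnegative continuous solution has `f(u) = ∂ₜu - Δu = 0`, hence vanishes. -/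
theorem IsDistribSolution.ae_eq_zero (hn : 1 ≤ n) (hf : Continuous f)
    (hfpos : ∀ s, 0 < s → 0 < f s)
    (hsub : n = 1 ∨ ∃ p : ℝ, 1 < p ∧ p < pB n ∧ AntitoneOn (fun s : ℝ => f s / s ^ p) (Ioi 0))
    (hmono : ∃ C : ℝ, 0 ≤ C ∧ ∀ τ s, 0 < τ → τ ≤ s → f τ ≤ C * f s)
    (hgrow : ∃ c q : ℝ, 0 < c ∧ 1 < q ∧ ∀ s, 1 ≤ s → c * s ^ q ≤ f s)
    (hu : Continuous u) (hu0 : ∀ z, 0 ≤ u z) (h : IsDistribSolution u fun z => f (u z)) :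
    ∀ᵐ z, u z = 0 := by
  have hfu : Continuous fun z => f (u z) := hf.comp hu
  have h1 : ∀ᵐ z, f (u z) = 0 := by
    refine ae_eq_zero_of_integral_contDiff_smul_eq_zero hfu.locallyIntegrable
      fun ψ hψ hψc => ?_
    have hd := fun (j : Fin n ⊕ Unit) {ψ : SpaceTime n → ℝ} (hψ : ContDiff ℝ ∞ ψ) hψc =>
      h.integral_mul_dirD_eq_zero hn hf hfpos hsub hmono hgrow hu hu0 j hψ hψc
    have hint : ∀ {w : SpaceTime n → ℝ}, ContDiff ℝ ∞ w → HasCompactSupport w →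
        Integrable fun z => u z * w z := fun hw hwc =>
      hu.locallyIntegrable.integrable_smul_right_of_hasCompactSupport hw.continuous hwc
    have iT : Integrable fun z => u z * dT ψ z := hint (hψ.dirD _) (hψc.dirD _)
    have iX : ∀ i ∈ Finset.univ, Integrable fun z => u z * dX i (dX i ψ) z := fun i _ =>
      hint ((hψ.dirD _).dirD _) ((hψc.dirD _).dirD _)
    have e1 : ∫ z, u z * dT ψ z = 0 := hd (Sum.inr ()) hψ hψc
    have e2 : ∀ i, ∫ z, u z * dX i (dX i ψ) z = 0 := fun i =>
      hd (Sum.inl i) (hψ.dirD (spaceDir i)) (hψc.dirD (spaceDir i))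
    have e3 : ∫ z, u z * (-dT ψ z - lap ψ z) = 0 := by
      have e4 : ∀ z, u z * (-dT ψ z - lap ψ z) =
          -(u z * dT ψ z) - ∑ i, u z * dX i (dX i ψ) z := fun z => by
        rw [lap, ← Finset.mul_sum]
        ring
      simp only [e4]
      have iT' : Integrable fun z => -(u z * dT ψ z) := iT.neg
      rw [integral_sub iT' (integrable_finsetSum _ iX), integral_neg, e1,
        integral_finsetSum _ iX, Finset.sum_eq_zero fun i _ => e2 i]
      simp
    rw [h ψ hψ hψc] at e3
    simpa [mul_comm] using e3
  filter_upwards [h1] with z hz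
  by_contra hne
  exact (hfpos _ ((hu0 z).lt_of_ne' hne)).ne' hz

end Liouville

/-! ### Strong solutions -/

section StrongSolutions

variable {n : ℕ} {f : ℝ → ℝ} {u : SpaceTime n → ℝ}

theorem HasWeakDirDeriv.congr_left {u' w : SpaceTime n → ℝ} {e : SpaceTime n}
    (h : HasWeakDirDeriv u w e) (hu : u =ᵐ[volume] u') : HasWeakDirDeriv u' w e := by
  refine ⟨h.1.congr hu, h.2.1, fun φ hφ hφc => ?_⟩
  rw [← h.2.2 φ hφ hφc]
  refine integral_congr_ae ?_
  filter_upwards [hu] with z hz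
  rw [hz]

/-- Twice integrating by parts, a strong solution is a distributional solution. -/
theorem isDistribSolution_of_weakDeriv {g ut : SpaceTime n → ℝ} {Du : Fin n → SpaceTime n → ℝ}
    {D2u : Fin n → Fin n → SpaceTime n → ℝ} (ht : HasWeakDirDeriv u ut (timeDir n))
    (hx : ∀ i, HasWeakDirDeriv u (Du i) (spaceDir i))
    (hxx : ∀ i j, HasWeakDirDeriv (Du i) (D2u i j) (spaceDir j))
    (heq : ∀ᵐ z, ut z - ∑ i, D2u i i z = g z) : IsDistribSolution u g := by
  intro ψ hψ hψc
  have hint : ∀ {v w : SpaceTime n → ℝ}, LocallyIntegrable v → ContDiff ℝ ∞ w →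
      HasCompactSupport w → Integrable fun z => v z * w z := fun hv hw hwc =>
    hv.integrable_smul_right_of_hasCompactSupport hw.continuous hwc
  have iT : Integrable fun z => -(u z * dT ψ z) := (hint ht.1 (hψ.dirD _) (hψc.dirD _)).neg
  have iX : ∀ i ∈ Finset.univ, Integrable fun z => u z * dX i (dX i ψ) z := fun i _ =>
    hint ht.1 ((hψ.dirD _).dirD _) ((hψc.dirD _).dirD _)
  have jT : Integrable fun z => ut z * ψ z := hint ht.2.1 hψ hψc
  have jX : ∀ i ∈ Finset.univ, Integrable fun z => D2u i i z * ψ z := fun i _ =>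
    hint (hxx i i).2.1 hψ hψc
  have eT : ∫ z, u z * dT ψ z = -∫ z, ut z * ψ z := ht.2.2 ψ hψ hψc
  have eX : ∀ i, ∫ z, u z * dX i (dX i ψ) z = ∫ z, D2u i i z * ψ z := by
    intro i
    have h1 : ∫ z, u z * dX i (dX i ψ) z = -∫ z, Du i z * dX i ψ z :=
      (hx i).2.2 _ (hψ.dirD _) (hψc.dirD _)
    have h2 : ∫ z, Du i z * dX i ψ z = -∫ z, D2u i i z * ψ z := (hxx i i).2.2 ψ hψ hψc
    rw [h1, h2, neg_neg]
  have e1 : ∫ z, u z * (-dT ψ z - lap ψ z) =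
      ∫ z, (-(u z * dT ψ z) - ∑ i, u z * dX i (dX i ψ) z) :=
    integral_congr_ae (Eventually.of_forall fun z => by
      simp only [lap, ← Finset.mul_sum]
      ring)
  have e2 : ∫ z, g z * ψ z = ∫ z, (ut z * ψ z - ∑ i, D2u i i z * ψ z) := by
    refine integral_congr_ae ?_
    filter_upwards [heq] with z hz
    rw [← hz, sub_mul, Finset.sum_mul]
  rw [e1, e2, integral_sub iT (integrable_finsetSum _ iX),
    integral_sub jT (integrable_finsetSum _ jX), integral_neg, eT, integral_finsetSum _ iX,
    integral_finsetSum _ jX, neg_neg]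
  simp only [eX]

/-- A strong solution has a nonnegative continuous version, which solves the equation in the sense
of distributions. -/
theorem IsStrongSolution.exists_continuous_version (h : IsStrongSolution f u) :
    ∃ u' : SpaceTime n → ℝ, Continuous u' ∧ (∀ z, 0 ≤ u' z) ∧ u =ᵐ[volume] u' ∧
      IsDistribSolution u' fun z => f (u' z) := by
  obtain ⟨h0, ut, Du, D2u, hW, heq⟩ := h
  have hW' := hW ((2 * (n + 1) : ℕ) : ℝ≥0∞) (by exact_mod_cast (by lia : 1 ≤ 2 * (n + 1)))
    (ENNReal.natCast_ne_top _)
  obtain ⟨u', hu', hae⟩ := exists_continuous_representative (u := u)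
    (w := Sum.elim Du fun _ => ut)
    (fun j => by
      rcases j with i | _
      · exact hW'.space_deriv i
      · exact hW'.time_deriv)
    (fun j => by
      rcases j with i | _
      · exact hW'.mem_space i
      · exact hW'.mem_time)
  refine ⟨u', hu', ?_, hae, ?_⟩
  · have h1 : (fun z => max (u' z) 0) =ᵐ[volume] u' := by
      filter_upwards [h0, hae] with z hz hz'
      exact max_eq_left (hz' ▸ hz)
    have h2 := (hu'.max continuous_const).ae_eq_iff_eq volume hu' |>.1 h1
    intro z
    rw [← congrFun h2 z]
    exact le_max_right _ _
  · refine isDistribSolution_of_weakDeriv (hW'.time_deriv.congr_left hae)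
      (fun i => (hW'.space_deriv i).congr_left hae) hW'.space_deriv₂ ?_
    filter_upwards [heq, hae] with z hz hz'
    rw [hz, hz']

end StrongSolutions

/-- Either growth hypothesis makes `f` almost increasing and superlinear at infinity. -/
theorem almost_monotone_and_superlinear {f : ℝ → ℝ} (hf : ContinuousOn f (Ioi 0))
    (hfpos : ∀ s, 0 < s → 0 < f s)
    (hf_growth :
      (∃ m₀ m₁ : ℝ, 1 < m₀ ∧ 1 < m₁ ∧
        RegularVariationAtZero f m₀ ∧ RegularVariationAtInfty f m₁) ∨
      (∃ q σ : ℝ, 1 < q ∧ 0 < σ ∧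
        (∃ M : ℝ, MonotoneOn f (Ici M)) ∧
        (∀ᶠ s : ℝ in atTop, s ^ q ≤ f s) ∧
        (∃ δ : ℝ, 0 < δ ∧ MonotoneOn (fun s : ℝ => f s / s ^ σ) (Ioo 0 δ)))) :
    (∃ C : ℝ, 0 ≤ C ∧ ∀ τ s, 0 < τ → τ ≤ s → f τ ≤ C * f s) ∧
      ∃ c q : ℝ, 0 < c ∧ 1 < q ∧ ∀ s, 1 ≤ s → c * s ^ q ≤ f s := by
  rcases hf_growth with ⟨m₀, m₁, hm₀, hm₁, hr₀, hr₁⟩ | ⟨q, σ, hq, hσ, ⟨M, hM⟩, hgt, δ, hδ, hmon⟩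
  · obtain ⟨h1, S, c, q, hS, hc, hq, h⟩ := hr₁.exists_bounds hm₁ hf hfpos
    obtain ⟨c', hc', h'⟩ := exists_rpow_le hf hfpos hc (by linarith) h
    exact ⟨exists_almost_monotone hf hfpos (hr₀.exists_bound hm₀ hf hfpos) h1, c', q, hc', hq, h'⟩
  · obtain ⟨S, hS⟩ := eventually_atTop.1 hgt
    obtain ⟨c', hc', h'⟩ := exists_rpow_le hf hfpos one_pos (by linarith : (0 : ℝ) ≤ q) (S := S)
      fun s hs => by simpa using hS s hs
    refine ⟨exists_almost_monotone hf hfpos ⟨δ / 2, 1, by positivity, fun τ s hτ hτs hs => ?_⟩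
      ⟨max M 1, 1, by positivity, fun τ s hτ hτs => ?_⟩, c', q, hc', hq, h'⟩
    · have hs0 : 0 < s := hτ.trans_le hτs
      have h1 : f τ / τ ^ σ ≤ f s / s ^ σ :=
        hmon ⟨hτ, by linarith⟩ ⟨hs0, by linarith⟩ hτs
      have h2 : τ ^ σ ≤ s ^ σ := Real.rpow_le_rpow hτ.le hτs hσ.le
      have hτσ : 0 < τ ^ σ := Real.rpow_pos_of_pos hτ σ
      have hsσ : 0 < s ^ σ := Real.rpow_pos_of_pos hs0 σ
      calc f τ = f τ / τ ^ σ * τ ^ σ := by field_simp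
        _ ≤ f s / s ^ σ * s ^ σ :=
          mul_le_mul h1 h2 hτσ.le (div_nonneg (hfpos s hs0).le hsσ.le)
        _ = 1 * f s := by field_simp
    · rw [one_mul]
      exact hM ((le_max_left _ _).trans hτ) ((le_max_left _ _).trans (hτ.trans hτs)) hτs

theorem theorem5p1 (n : ℕ) (hn : 1 ≤ n) (f : ℝ → ℝ)
    (hf_cont : ContinuousOn f (Ici 0)) (hf_pos : ∀ s, 0 < s → 0 < f s)
    (hf_sub : n = 1 ∨
      ∃ p : ℝ, 1 < p ∧ p < pB n ∧ AntitoneOn (fun s : ℝ => f s / s ^ p) (Ioi 0))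
    (hf_growth :
      (∃ m₀ m₁ : ℝ, 1 < m₀ ∧ 1 < m₁ ∧
        RegularVariationAtZero f m₀ ∧ RegularVariationAtInfty f m₁) ∨
      (∃ q σ : ℝ, 1 < q ∧ 0 < σ ∧
        (∃ M : ℝ, MonotoneOn f (Ici M)) ∧
        (∀ᶠ s : ℝ in atTop, s ^ q ≤ f s) ∧
        (∃ δ : ℝ, 0 < δ ∧ MonotoneOn (fun s : ℝ => f s / s ^ σ) (Ioo 0 δ)))) :
    ∀ u : SpaceTime n → ℝ, IsStrongSolution f u → ∀ᵐ z, u z = 0 := by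
  intro u hu
  obtain ⟨u', hu', hu0, hae, hsol⟩ := hu.exists_continuous_version
  obtain ⟨⟨C, hC, hmono⟩, c, q, hc, hq, hgrow⟩ := almost_monotone_and_superlinear
    (hf_cont.mono Ioi_subset_Ici_self) hf_pos hf_growth
  -- Only the values of `f` on `[0, ∞)` matter; the extension by `f 0` is continuous on `ℝ`.
  set g : ℝ → ℝ := fun s => f (max s 0) with hg
  have hgf : ∀ s, 0 ≤ s → g s = f s := fun s hs => by rw [hg]; simp [hs]
  have hgc : Continuous g :=
    hf_cont.comp_continuous (continuous_id.max continuous_const) fun s => mem_Ici.2 (le_max_right _ _)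
  have hsol' : IsDistribSolution u' fun z => g (u' z) := by
    simpa only [hgf _ (hu0 _)] using hsol
  have h := hsol'.ae_eq_zero hn hgc (fun s hs => by rw [hgf s hs.le]; exact hf_pos s hs)
    (hf_sub.imp_right fun ⟨p, hp1, hp2, hp⟩ => ⟨p, hp1, hp2, hp.congr fun s hs => by
      rw [hgf s (le_of_lt hs)]⟩)
    ⟨C, hC, fun τ s hτ hτs => by
      rw [hgf τ hτ.le, hgf s (hτ.le.trans hτs)]
      exact hmono τ s hτ hτs⟩
    ⟨c, q, hc, hq, fun s hs => by
      rw [hgf s (by linarith)]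
      exact hgrow s hs⟩ hu' hu0
  filter_upwards [h, hae] with z hz hz'
  rw [hz', hz]
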